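/- **Setting.** Let $d\ge 1$, $L>0$, $\omega_n=\frac{\pi}{L}n$ for $n\in\mathbb Z^d$, and let $f:\mathbb R^d\to\mathbb C$ be continuous and $2L$-periodic in each variable, with Fourier coefficients $\hat f(\omega_n)=(2L)^{-d}\int_{[-L,L]^d}f(x)e^{-\mathrm i\omega_n\cdot x}\,dx$ such that, for some $c,C>0$ and $\ell>d$, $$(c/|n|)^\ell\le|\hat f(\omega_n)|\le (C/|n|)^\ell\qquad(n\in\mathbb Z^d\setminus\{0\}).$$ The data are $(x_j,y_j)$, $y_j=f(x_j)+\xi_j$, $j=1,\dots,J$, where the $x_j$ are independent with a probability density $\rho$ on $[-L,L]^d$ that is bounded below by a positive constant, and the real noise variables $\xi_j$ are i.i.d., independent of the $x_j$, with mean $0$ and variance $s^2<\infty$. $\mathbb E_x$ is the expectation over an independent point $x$ with density $\rho$. For a probability $p$ on the lattice $\{\omega_n\}$ put $C_p=\sum_n\frac{|\hat f(\omega_n)|^2}{p(\omega_n)}$, $C_p'=\sum_n\frac{|\hat f(\omega_n)|^4}{p(\omega_n)^3}$, $c_K=C_p'/K$, and $p_*(\omega_n)=|\hat f(\omega_n)|/\sum_m|\hat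 f(\omega_m)|$. Fix $0<\lambda<2$ and $\delta>0$, let $c_1=\mathbb E_x[|f(x)|^2]+s^2$ and $$\mathcal E(B,b)=\frac{(1+\frac{3\delta}2)B}{K}(1+\lambda)+\Big(\frac{2(1+\frac{3\delta}2)c_1B}{J\delta}\Big)^{1/2}+\big((1+\tfrac{3\delta}2)(B^2+b)\big)^{1/2}\Big(\frac{\lambda}{K}+\frac{2^{1/2}}{(J\delta)^{1/2}}\Big),$$ $$\lambda_1(B)=\max\Big(K\Big(\frac{c_1}{(1+\frac{3\delta}2)B\,2J\delta}\Big)^{1/2},\ \lambda\Big),\qquad \lambda_2(B,b)=K\max\Big(K\Big(\frac{1}{(1+\frac{3\delta}2)(B^2+b)2J\delta}\Big)^{1/2},\ \frac{\lambda}{\big((1+\frac{3\delta}2)(B^2+b)\big)^{1/2}}\Big).$$ For frequencies $\nu_1,\dots,\nu_K$ the *regularized least squares problem* with parameters $\lambda_1,\lambda_2>0$ is $$\min_{\hat v\in\mathbb C^K}\ \frac1J\sum_{j=1}^J\Big|\sum_{k=1}^K\hat v_ke^{\mathrm i\nu_k\cdot x_j}-y_j\Big|^2+\lambda_1\sum_k|\hat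 v_k|^2+\lambda_2\Big(\sum_k|\hat v_k|^2\Big)^2 .$$ **Method.** Given $p,K,J$, a cutoff $\epsilon>0$ and a ratio $q_\epsilon$: (1) draw the data and, independently, $K$ independent frequencies $\nu_k$ from $p$; let $\hat\beta$ solve the least squares problem with parameters $\lambda_1(C_p),\lambda_2(C_p,c_K)$, and put $\bar\beta_n=\sum_{k:\nu_k=\omega_n}\hat\beta_k$. (2) Given these, draw $\lfloor K(1-q_\epsilon)\rfloor$ independent frequencies from $\bar p(\omega_n)=|\bar\beta_n|\,/\sum_{m:|\bar\beta_m|\ge\epsilon}|\bar\beta_m|$ on $\{n:|\bar\beta_n|\ge\epsilon\}$ (from $p$ if this set is empty) and, independently, $\lceil Kq_\epsilon\rceil$ independent frequencies from $p$. (3) Let $\alpha(x)=\sum_k\hat\alpha_ke^{\mathrm i\bar\omega_k\cdot x}$, where $\bar\omega$ collects the frequencies of step (2) and $\hat\alpha$ solves the least squares problem for $\bar\omega$ and the same data, with parameters $\lambda_1(C_{p_*}),\lambda_2(C_{p_*},0)$. **Statement.** Fix $\kappa>0$ and choose $\epsilon=\mathcal E(C_p,c_K)^{1/4}$ and $q_\epsilon=\kappa\,\mathcal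 E(C_p,c_K)^{(1-d/\ell)/8}$. There is a constant $M$ (depending on $f$, $\rho$, the noise law, $\lambda,\delta,\kappa,d,L$, $\ell,c,C$, but not on $p,C'',K,J$) such that for every $C''>0$ there is $e_0>0$ with the following property: for every probability $p$ on the lattice with $|\hat f(\omega_n)|\le C''p(\omega_n)$ for all $n\in\mathbb Z^d$, and all $K,J\ge1$ with $\mathcal E(C_p,c_K)\le e_0$, $$\mathbb E\big[\mathbb E_x[|\alpha(x)-f(x)|^2]\big]\le\mathcal E(C_{p_*},0)\,\big(1+C''M\,q_\epsilon^{1/2}\big),$$ where $\mathbb E$ is the expectation over the data and all sampled frequencies. -/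

import Mathlib

open MeasureTheory
open scoped ENNReal

noncomputable section

namespace RFF

variable {d : ℕ}

/-- The fundamental cube `[-L, L]^d` of the torus with period `2L`. -/
def cube (d : ℕ) (L : ℝ) : Set (Fin d → ℝ) := Set.Icc (fun _ => -L) (fun _ => L)

/-- The Fourier mode `x ↦ exp(i ω_n · x)` with lattice frequency `ω_n = (π / L) n`, `n ∈ ℤ^d`.
A lattice frequency `ω_n` is represented throughout by its index `n`. -/
def mode (L : ℝ) (n : Fin d → ℤ) (x : Fin d → ℝ) : ℂ :=
  Complex.exp (Complex.I * ((∑ i, Real.pi / L * (n i : ℝ) * x i : ℝ) : ℂ))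

/-- The Fourier coefficient `(2L)^{-d} ∫_{[-L,L]^d} f(x) exp(-i ω_n · x) dx`. -/
def coeff (L : ℝ) (f : (Fin d → ℝ) → ℂ) (n : Fin d → ℤ) : ℂ :=
  (((2 * L) ^ d)⁻¹ : ℝ) * ∫ x in cube d L, f x * mode L (-n) x

/-- The Euclidean length `|n|` of a lattice index. -/
def len (n : Fin d → ℤ) : ℝ := Real.sqrt (∑ i, (n i : ℝ) ^ 2)

/-- The law of a data point: the density `ρ` on `[-L, L]^d`. -/
def pointLaw (L : ℝ) (ρ : (Fin d → ℝ) → ℝ) : Measure (Fin d → ℝ) :=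
  (volume.restrict (cube d L)).withDensity (fun x => ENNReal.ofReal (ρ x))

/-- The rate constant `C_p = ∑ₙ |f̂ₙ|² / p(ωₙ)`. (A term with `f̂ₙ = 0` and `p(ωₙ) = 0` is zero.) -/
def rateConst (a : (Fin d → ℤ) → ℂ) (p : (Fin d → ℤ) → ℝ) : ℝ := ∑' n, ‖a n‖ ^ 2 / p n

/-- The higher order constant `C_p' = ∑ₙ |f̂ₙ|⁴ / p(ωₙ)³`. -/
def rateConst' (a : (Fin d → ℤ) → ℂ) (p : (Fin d → ℤ) → ℝ) : ℝ := ∑' n, ‖a n‖ ^ 4 / p n ^ 3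

/-- The optimal distribution `p_*(ωₙ) = |f̂ₙ| / ∑ₘ |f̂ₘ|`. -/
def optimalDist (a : (Fin d → ℤ) → ℂ) (n : Fin d → ℤ) : ℝ := ‖a n‖ / ∑' m, ‖a m‖

/-- The constant `c₁ = E_x[|f(x)|²] + s²`. -/
def c₁ (μ : Measure (Fin d → ℝ)) (f : (Fin d → ℝ) → ℂ) (s : ℝ) : ℝ :=
  ∫ x, ‖f x‖ ^ 2 ∂μ + s ^ 2

/-- The noisy generalization bound `𝓔(B, b)` for `K` nodes and `J` data points. -/
def genBound (δ lam c₁ : ℝ) (K J : ℕ) (B b : ℝ) : ℝ :=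
  (1 + 3 * δ / 2) * B / K * (1 + lam)
    + Real.sqrt (2 * (1 + 3 * δ / 2) * c₁ * B / (J * δ))
    + Real.sqrt ((1 + 3 * δ / 2) * (B ^ 2 + b)) * (lam / K + Real.sqrt 2 / Real.sqrt (J * δ))

/-- The regularization parameter `λ₁` tuned to `(B, b)`. -/
def reg₁ (δ lam c₁ : ℝ) (K J : ℕ) (B : ℝ) : ℝ :=
  max (K * Real.sqrt (c₁ / ((1 + 3 * δ / 2) * B * (2 * J * δ)))) lam

/-- The regularization parameter `λ₂` tuned to `(B, b)`. -/
def reg₂ (δ lam : ℝ) (K J : ℕ) (B b : ℝ) : ℝ :=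
  K * max (K * Real.sqrt (1 / ((1 + 3 * δ / 2) * (B ^ 2 + b) * (2 * J * δ))))
    (lam / Real.sqrt ((1 + 3 * δ / 2) * (B ^ 2 + b)))

/-- The random Fourier feature network `x ↦ ∑ₖ vₖ exp(i ωₖ · x)`. -/
def network (L : ℝ) {ι : Type} [Fintype ι] (ω : ι → Fin d → ℤ) (v : ι → ℂ)
    (x : Fin d → ℝ) : ℂ := ∑ k, v k * mode L (ω k) x

/-- The regularized empirical least squares functional. -/
def loss (L l₁ l₂ : ℝ) {ι : Type} [Fintype ι] (ω : ι → Fin d → ℤ) {J : ℕ}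
    (x : Fin J → Fin d → ℝ) (y : Fin J → ℂ) (v : ι → ℂ) : ℝ :=
  (J : ℝ)⁻¹ * ∑ j, ‖network L ω v (x j) - y j‖ ^ 2
    + l₁ * ∑ k, ‖v k‖ ^ 2 + l₂ * (∑ k, ‖v k‖ ^ 2) ^ 2

/-- The amplitudes that minimize `loss`. -/
def amplitudes (L l₁ l₂ : ℝ) {ι : Type} [Fintype ι] (ω : ι → Fin d → ℤ) {J : ℕ}
    (x : Fin J → Fin d → ℝ) (y : Fin J → ℂ) : ι → ℂ :=
  Classical.epsilon (fun v => ∀ w, loss L l₁ l₂ ω x y v ≤ loss L l₁ l₂ ω x y w)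

/-- The minimum of `loss` is attained, so that `amplitudes` is indeed a minimizer. -/
theorem amplitudes_spec (L : ℝ) {l₁ l₂ : ℝ} (h₁ : 0 < l₁) (h₂ : 0 ≤ l₂) {ι : Type} [Fintype ι]
    (ω : ι → Fin d → ℤ) {J : ℕ} (x : Fin J → Fin d → ℝ) (y : Fin J → ℂ) (w : ι → ℂ) :
    loss L l₁ l₂ ω x y (amplitudes L l₁ l₂ ω x y) ≤ loss L l₁ l₂ ω x y w := by
  have hex : ∃ v, ∀ w, loss L l₁ l₂ ω x y v ≤ loss L l₁ l₂ ω x y w := by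
    apply Continuous.exists_forall_le
    · unfold loss network
      fun_prop
    · have hn : Filter.Tendsto (fun v : ι → ℂ => l₁ * ‖v‖ ^ 2) (Filter.cocompact _)
          Filter.atTop := by
        refine Filter.Tendsto.const_mul_atTop h₁ ?_
        exact (Filter.tendsto_pow_atTop (by norm_num)).comp tendsto_norm_cocompact_atTop
      refine Filter.tendsto_atTop_mono (fun v => ?_) hn
      have hv : ‖v‖ ^ 2 ≤ ∑ k, ‖v k‖ ^ 2 := by
        have hs : 0 ≤ ∑ k, ‖v k‖ ^ 2 := Finset.sum_nonneg fun _ _ => by positivity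
        have : ‖v‖ ≤ Real.sqrt (∑ k, ‖v k‖ ^ 2) := by
          refine (pi_norm_le_iff_of_nonneg (Real.sqrt_nonneg _)).2 fun k => ?_
          refine Real.le_sqrt_of_sq_le ?_
          exact Finset.single_le_sum (f := fun k => ‖v k‖ ^ 2)
            (fun _ _ => by positivity) (Finset.mem_univ k)
        calc ‖v‖ ^ 2 ≤ Real.sqrt (∑ k, ‖v k‖ ^ 2) ^ 2 := by gcongr
          _ = _ := Real.sq_sqrt hs
      have a1 : 0 ≤ (J : ℝ)⁻¹ * ∑ j, ‖network L ω v (x j) - y j‖ ^ 2 := by positivity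
      have a2 : 0 ≤ l₂ * (∑ k, ‖v k‖ ^ 2) ^ 2 := by positivity
      have a3 := mul_le_mul_of_nonneg_left hv h₁.le
      unfold loss
      linarith
  exact Classical.epsilon_spec hex w

/-- The collected amplitude `β̄ₙ = ∑_{k : ν_k = ω_n} β̂ₖ` of the mode `n`. -/
def collected {ι : Type} [Fintype ι] (ω : ι → Fin d → ℤ) (v : ι → ℂ) (n : Fin d → ℤ) : ℂ :=
  ∑ k, if ω k = n then v k else 0

open Classical in
/-- The amplitude weights after the cutoff: `|bₙ|` if `|bₙ| ≥ ε`, and `0` otherwise. -/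
def keptWeight (ε : ℝ) (b : (Fin d → ℤ) → ℂ) (n : Fin d → ℤ) : ℝ≥0∞ :=
  if ε ≤ ‖b n‖ then ENNReal.ofReal ‖b n‖ else 0

open Classical in
/-- The resampling distribution: `|bₙ| / ∑_{|bₘ| ≥ ε} |bₘ|` on the modes with `|bₙ| ≥ ε`.
When the cutoff leaves no mode at all, this quotient is undefined and the given distribution `p`
is kept. -/
def resampleDist (p : PMF (Fin d → ℤ)) (ε : ℝ) (b : (Fin d → ℤ) → ℂ) : PMF (Fin d → ℤ) :=
  if h : ∑' n, keptWeight ε b n ≠ 0 ∧ ∑' n, keptWeight ε b n ≠ ∞ then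
    PMF.normalize (keptWeight ε b) h.1 h.2
  else p

/-- The law of `N` independent frequencies with common distribution `p`. -/
def freqLaw (p : PMF (Fin d → ℤ)) (N : ℕ) : Measure (Fin N → Fin d → ℤ) :=
  Measure.pi (fun _ => p.toMeasure)

/-- The law of the data `(x_j, ξ_j)`, `j = 1, …, J`: independent pairs of independent variables,
with `x_j` distributed as `μ` and the noise `ξ_j` distributed as `N`. -/
def dataLaw (μ : Measure (Fin d → ℝ)) (N : Measure ℝ) (J : ℕ) :
    Measure (Fin J → (Fin d → ℝ) × ℝ) :=
  Measure.pi (fun _ => μ.prod N)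

/-- The noisy values `y_j = f(x_j) + ξ_j`. -/
def noisyValues (f : (Fin d → ℝ) → ℂ) {J : ℕ} (D : Fin J → (Fin d → ℝ) × ℝ) (j : Fin J) : ℂ :=
  f (D j).1 + ((D j).2 : ℂ)

/-- The expected generalization error `E[E_x[|α(x) - f(x)|²]]` of the resampled method.
* Data `D` are drawn, and `K` independent frequencies `ν` from `p`.
* `β̂` solves the regularized least squares problem for `(D, ν)` with parameters `l₁, l₂`.
* Given `(D, ν)`, there are drawn `⌊K(1-q)⌋` independent frequencies from the resampling
  distribution of `β̂` with cutoff `ε` and, independently, `⌈Kq⌉` frequencies from `p`.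
* `α̂` solves the regularized least squares problem for these frequencies and the same data,
  with parameters `m₁, m₂`. -/
def resampledError (L : ℝ) (f : (Fin d → ℝ) → ℂ) (μ : Measure (Fin d → ℝ)) (N : Measure ℝ)
    (p : PMF (Fin d → ℤ)) (K J : ℕ) (l₁ l₂ m₁ m₂ ε q : ℝ) : ℝ≥0∞ :=
  ∫⁻ D, ∫⁻ ν,
    (let x : Fin J → Fin d → ℝ := fun j => (D j).1
     let y : Fin J → ℂ := noisyValues f D
     let pbar : PMF (Fin d → ℤ) :=
       resampleDist p ε (collected ν (amplitudes L l₁ l₂ ν x y))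
     ∫⁻ νbar, ∫⁻ νtilde,
       (let ω : Fin ⌊(K : ℝ) * (1 - q)⌋₊ ⊕ Fin ⌈(K : ℝ) * q⌉₊ → Fin d → ℤ :=
          Sum.elim νbar νtilde
        ∫⁻ z, ‖network L ω (amplitudes L m₁ m₂ ω x y) z - f z‖ₑ ^ 2 ∂μ)
       ∂(freqLaw p ⌈(K : ℝ) * q⌉₊)
     ∂(freqLaw pbar ⌊(K : ℝ) * (1 - q)⌋₊))
    ∂(freqLaw p K) ∂(dataLaw μ N J)

end RFF

end

open MeasureTheory
open scoped ENNReal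

namespace RFF

/-! ### Fourier modes as characters, and their rescaling to the unit torus. -/

section Modes

variable {d : ℕ} (L : ℝ)

/-! Write a for the Fourier coefficients, S = ∑|a_n|, and e = 𝓔(C_p, c_K)^(1/8), so that the cutoff
is e². Sampling from p_* gives amplitudes with second moment C_{p_*}/K = S²/K, and the tuned
regularization turns this into a cost of at most 𝓔(C_{p_*}, 0)/(1 + 3δ/2) (`mul_approxBound_le`).
The factor 1 + 3δ/2 is therefore pure slack. The actual error is this cost times a factor close to
1, plus o(e⁸). Moreover e⁸ is comparable to 𝓔(C_{p_*}, 0), because |a| ≤ C''p confines C_p and c_K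
to a compact set. So for small e the slack absorbs everything, the bound holds even without the
factor 1 + C''M q^(1/2), and M = 1 serves.

The engine is a deterministic inequality (`Target.risk_amplitudes_le`). The risk differs from the
empirical error by a `gap`, an expectation minus a sample mean, which expands into gaps of single
modes. Fix a finite set A of modes. The amplitude errors on A are controlled by the risk itself,
through Bessel's inequality and the lower bound on the density. The amplitudes outside A are paid
for by the two regularization terms. Minimality allows any comparison amplitudes. Importance weights
reproduce f in the mean, and their expected excess over the noise is a second moment, for every
fixed data set (`Target.integral_regExcess_le`).

The difficulty is that the resampled frequencies depend on the data. If the first-stage risk is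
small, every collected amplitude is within cε of a_n. Then the resampling law is nearly optimal on
the modes it keeps and charges only the deterministic set A = {|a| ≥ ε/2}, whose gaps are absorbed
(`Target.mixedRisk_le_of_close`). The lost modes have |a| < 2ε. Their mass is o(q), by summability
of |a|^θ' for some θ' < 1, and the Kq fresh frequencies from p carry them. If the first stage fails,
an event of probability O(e⁴), the resampling law is still at most X times the sum of p and the
empirical law of the first frequencies. Tenth moments of the gaps then beat the factor X
(`Target.mixedRisk_le_dominated`). Noise with only two moments is truncated at √J, and its tail
contributes o(1) relative to e⁸. -/

theorem norm_mode (n : Fin d → ℤ) (x : Fin d → ℝ) : ‖mode L n x‖ = 1 := by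
  unfold mode
  rw [mul_comm, Complex.norm_exp_ofReal_mul_I]

theorem mode_zero (x : Fin d → ℝ) : mode L (0 : Fin d → ℤ) x = 1 := by simp [mode]

theorem mode_add (m n : Fin d → ℤ) (x : Fin d → ℝ) :
    mode L (m + n) x = mode L m x * mode L n x := by
  unfold mode
  rw [← Complex.exp_add, ← mul_add, ← Complex.ofReal_add, ← Finset.sum_add_distrib]
  congr 3
  refine Finset.sum_congr rfl fun i _ => ?_
  simp only [Pi.add_apply, Int.cast_add]
  ring

theorem mode_neg (n : Fin d → ℤ) (x : Fin d → ℝ) :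
    mode L (-n) x = (starRingEnd ℂ) (mode L n x) := by
  unfold mode
  rw [← Complex.exp_conj]
  simp

theorem mode_sub (m n : Fin d → ℤ) (x : Fin d → ℝ) :
    mode L (m - n) x = mode L m x * (starRingEnd ℂ) (mode L n x) := by
  rw [sub_eq_add_neg, mode_add, mode_neg]

theorem continuous_mode (n : Fin d → ℤ) : Continuous (mode L n) := by
  unfold mode
  fun_prop

theorem measurable_mode (n : Fin d → ℤ) : Measurable (mode L n) :=
  (continuous_mode L n).measurable

theorem mode_periodic {L : ℝ} (hL : L ≠ 0) (n : Fin d → ℤ) (x : Fin d → ℝ) (m : Fin d → ℤ) :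
    mode L n (fun i => x i + 2 * L * (m i : ℝ)) = mode L n x := by
  unfold mode
  have : (∑ i, Real.pi / L * (n i : ℝ) * (x i + 2 * L * (m i : ℝ)) : ℝ)
      = (∑ i, Real.pi / L * (n i : ℝ) * x i : ℝ) + ((∑ i, n i * m i : ℤ) : ℝ) * (2 * Real.pi) := by
    push_cast
    rw [Finset.sum_mul, ← Finset.sum_add_distrib]
    refine Finset.sum_congr rfl fun i _ => ?_
    field_simp
  rw [this, Complex.ofReal_add, mul_add, Complex.exp_add]
  have h2 : Complex.exp (Complex.I * (((((∑ i, n i * m i : ℤ) : ℝ) * (2 * Real.pi) : ℝ)) : ℂ)) = 1 := by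
    rw [Complex.exp_eq_one_iff]
    exact ⟨∑ i, n i * m i, by push_cast; ring⟩
  rw [h2, mul_one]

/-- The substitution x = 2Lt carries the Fourier theory of the unit torus over to the period 2L. -/
theorem mode_two_mul {L : ℝ} (hL : 0 < L) (n : Fin d → ℤ) (t : Fin d → ℝ) :
    mode L n ((2 * L) • t) = UnitAddTorus.mFourier n (fun i => (t i : UnitAddCircle)) := by
  simp only [mode, UnitAddTorus.mFourier, ContinuousMap.coe_mk, fourier_coe_apply]
  rw [← Complex.exp_sum]
  congr 1
  push_cast
  rw [Finset.mul_sum]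
  refine Finset.sum_congr rfl fun i _ => ?_
  have : (L : ℂ) ≠ 0 := by exact_mod_cast hL.ne'
  simp only [Pi.smul_apply, smul_eq_mul]
  push_cast
  field_simp

end Modes

/-! ### Fourier series and Parseval's identity for continuous periodic functions. -/

section Torus

variable {d : ℕ} {L : ℝ}

/-- Periodicity makes the rescaled function constant on the fibres of ℝ^d → torus, an open quotient
map, so it descends continuously. -/
theorem exists_torus_lift (hL : 0 < L) {f : (Fin d → ℝ) → ℂ} (hf : Continuous f)
    (hper : ∀ (x : Fin d → ℝ) (n : Fin d → ℤ), f (fun i => x i + 2 * L * (n i : ℝ)) = f x) :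
    ∃ F : C(UnitAddTorus (Fin d), ℂ),
      ∀ t : Fin d → ℝ, F (fun i => (t i : UnitAddCircle)) = f ((2 * L) • t) := by
  have hq : IsOpenQuotientMap
      (Pi.map (fun (_ : Fin d) (t : ℝ) => (t : UnitAddCircle))) :=
    IsOpenQuotientMap.piMap fun _ => QuotientAddGroup.isOpenQuotientMap_mk
  let g : C(Fin d → ℝ, ℂ) := ⟨fun t => f ((2 * L) • t), by fun_prop⟩
  have hg : Function.FactorsThrough g (Pi.map (fun (_ : Fin d) (t : ℝ) => (t : UnitAddCircle))) := by
    intro a b hab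
    have hk : ∀ i, ∃ k : ℤ, a i = b i + k := by
      intro i
      have := congrFun hab i
      simp only [Pi.map_apply] at this
      rw [eq_comm, QuotientAddGroup.eq] at this
      obtain ⟨k, hk⟩ := AddSubgroup.mem_zmultiples_iff.1 this
      exact ⟨k, by simp at hk; linarith⟩
    choose k hk using hk
    have := hper ((2 * L) • b) k
    change f _ = f _
    rw [← this]
    congr 1
    ext i
    simp [hk i]
    ring
  let q : C(Fin d → ℝ, UnitAddTorus (Fin d)) :=
    ⟨Pi.map (fun (_ : Fin d) (t : ℝ) => (t : UnitAddCircle)), hq.continuous⟩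
  have hq' : Topology.IsQuotientMap q := hq.isQuotientMap
  exact ⟨hq'.lift g hg, fun t => congrArg (fun φ : C(Fin d → ℝ, ℂ) => φ t) (hq'.lift_comp g hg)⟩

/-- The fundamental domain starts at -1/2 so that scaling by 2L gives the symmetric cube; half-open
and closed cubes differ by a null set. -/
theorem integral_unit_cube {E : Type*} [NormedAddCommGroup E] [NormedSpace ℝ E] (hL : 0 < L)
    (g : (Fin d → ℝ) → E) :
    ∫ t in {t : Fin d → ℝ | ∀ i, t i ∈ Set.Ioc (-(1 / 2) : ℝ) (-(1 / 2) + 1)}, g ((2 * L) • t)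
      = ((2 * L) ^ d)⁻¹ • ∫ x in cube d L, g x := by
  have h1 : {t : Fin d → ℝ | ∀ i, t i ∈ Set.Ioc (-(1 / 2) : ℝ) (-(1 / 2) + 1)}
      =ᵐ[volume] Set.Icc (fun _ => -(1 / 2) : Fin d → ℝ) (fun _ => 1 / 2) := by
    have : {t : Fin d → ℝ | ∀ i, t i ∈ Set.Ioc (-(1 / 2) : ℝ) (-(1 / 2) + 1)}
      = Set.univ.pi fun _ => Set.Ioc (-(1 / 2) : ℝ) (1 / 2) := by
      ext t
      simp only [Set.mem_ofPred_eq, Set.mem_univ_pi]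
      norm_num
    rw [this]
    exact Measure.univ_pi_Ioc_ae_eq_Icc
  rw [setIntegral_congr_set h1, Measure.setIntegral_comp_smul_of_pos _ _ _ (by positivity : 0 < 2 * L)]
  congr 2
  · simp
  · congr 1
    ext x
    rw [Set.mem_smul_set_iff_inv_smul_mem₀ (by positivity)]
    simp only [cube, Set.mem_Icc, Pi.le_def, Pi.smul_apply, smul_eq_mul]
    rw [← forall_and, ← forall_and]
    refine forall_congr' fun i => ?_
    have h2 : (2 * L)⁻¹ * x i = x i / (2 * L) := by ring
    rw [h2, le_div_iff₀ (by positivity), div_le_iff₀ (by positivity)]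
    constructor <;> rintro ⟨h, h'⟩ <;> constructor <;> linarith

theorem mFourierCoeff_lift (hL : 0 < L) {f : (Fin d → ℝ) → ℂ} {F : C(UnitAddTorus (Fin d), ℂ)}
    (hF : ∀ t : Fin d → ℝ, F (fun i => (t i : UnitAddCircle)) = f ((2 * L) • t))
    (n : Fin d → ℤ) : UnitAddTorus.mFourierCoeff F n = coeff L f n := by
  rw [UnitAddTorus.mFourierCoeff_eq_integral _ _ (fun _ => -(1 / 2))]
  simp only [hF, ← mode_two_mul hL]
  rw [integral_unit_cube hL (fun x => mode L (-n) x • f x)]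
  unfold coeff
  simp only [smul_eq_mul, Complex.real_smul]
  simp only [mul_comm]

theorem hasSum_coeff_mul_mode (hL : 0 < L) {f : (Fin d → ℝ) → ℂ} (hf : Continuous f)
    (hper : ∀ (x : Fin d → ℝ) (n : Fin d → ℤ), f (fun i => x i + 2 * L * (n i : ℝ)) = f x)
    (hs : Summable (coeff L f)) (x : Fin d → ℝ) :
    HasSum (fun n => coeff L f n * mode L n x) (f x) := by
  obtain ⟨F, hF⟩ := exists_torus_lift hL hf hper
  have hs' : Summable (UnitAddTorus.mFourierCoeff F) := by
    simpa only [funext (mFourierCoeff_lift hL hF)] using hs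
  have := UnitAddTorus.hasSum_mFourier_series_apply_of_summable hs'
    (fun i => (((2 * L)⁻¹ • x) i : UnitAddCircle))
  have h0 : (2 * L) ≠ 0 := by positivity
  simpa only [hF, ← mode_two_mul hL, mFourierCoeff_lift hL hF, smul_smul, mul_inv_cancel₀ h0,
    one_smul, smul_eq_mul] using this

/-- Parseval's identity for continuous periodic functions. -/
theorem hasSum_sq_coeff (hL : 0 < L) {f : (Fin d → ℝ) → ℂ} (hf : Continuous f)
    (hper : ∀ (x : Fin d → ℝ) (n : Fin d → ℤ), f (fun i => x i + 2 * L * (n i : ℝ)) = f x) :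
    HasSum (fun n => ‖coeff L f n‖ ^ 2) (((2 * L) ^ d)⁻¹ * ∫ x in cube d L, ‖f x‖ ^ 2) := by
  obtain ⟨F, hF⟩ := exists_torus_lift hL hf hper
  -- Normalized Haar measure is made the volume of the circle, so that the torus is a probability
  -- space and the modes are orthonormal.
  let _ : MeasureSpace UnitAddCircle := ⟨AddCircle.haarAddCircle⟩
  have _ : IsProbabilityMeasure (volume : Measure UnitAddCircle) :=
    inferInstanceAs (IsProbabilityMeasure AddCircle.haarAddCircle)
  have := UnitAddTorus.hasSum_sq_mFourierCoeff (ContinuousMap.toLp 2 (volume : Measure (UnitAddTorus (Fin d))) ℂ F)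
  simp only [UnitAddTorus.mFourierCoeff_toLp, mFourierCoeff_lift hL hF] at this
  convert! this using 1
  have h2 := integral_congr_ae ((F.coeFn_toLp (p := 2) (𝕜 := ℂ) (volume : Measure (UnitAddTorus (Fin d)))).mono
    (fun t ht => congrArg (fun z : ℂ => ‖z‖ ^ 2) ht))
  refine Eq.trans ?_ h2.symm
  rw [UnitAddTorus.integral_preimage _ (fun _ => -(1 / 2))]
  simp only [hF]
  rw [integral_unit_cube hL (fun x => ‖f x‖ ^ 2), smul_eq_mul]

end Torus

end RFF

open MeasureTheory
open scoped ENNReal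

namespace RFF

/-! ### Fourier coefficients of networks, and Bessel's inequality against the risk. -/

section NetworkCoefficients

variable {d : ℕ} {L : ℝ}

/-- Orthonormality, read off from the coordinates of a Hilbert basis vector. -/
theorem coeff_mode (hL : 0 < L) (m n : Fin d → ℤ) :
    coeff L (mode L m) n = if m = n then 1 else 0 := by
  have hF : ∀ t : Fin d → ℝ, UnitAddTorus.mFourier m (fun i => (t i : UnitAddCircle))
      = mode L m ((2 * L) • t) := fun t => (mode_two_mul hL m t).symm
  rw [← mFourierCoeff_lift hL hF, ← UnitAddTorus.mFourierCoeff_toLp,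
    ← UnitAddTorus.mFourierBasis_repr]
  have h1 : UnitAddTorus.mFourierBasis m = UnitAddTorus.mFourierLp 2 m := by
    rw [UnitAddTorus.coe_mFourierBasis]
  have h2 := UnitAddTorus.mFourierBasis.repr_self m
  rw [h1] at h2
  rw [h2, lp.single_apply]
  by_cases h : m = n
  · subst h; simp
  · simp [h, Ne.symm h]

theorem continuous_network {ι : Type} [Fintype ι] (ω : ι → Fin d → ℤ) (v : ι → ℂ) :
    Continuous (network L ω v) := by
  unfold network
  exact continuous_finsetSum _ fun k _ => continuous_const.mul (continuous_mode L _)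

theorem network_periodic (hL : 0 < L) {ι : Type} [Fintype ι] (ω : ι → Fin d → ℤ) (v : ι → ℂ)
    (x : Fin d → ℝ) (n : Fin d → ℤ) :
    network L ω v (fun i => x i + 2 * L * (n i : ℝ)) = network L ω v x := by
  simp only [network, mode_periodic hL.ne']

theorem integrableOn_cube_of_continuous {E : Type*} [NormedAddCommGroup E] {g : (Fin d → ℝ) → E}
    (hg : Continuous g) : IntegrableOn g (cube d L) :=
  hg.continuousOn.integrableOn_compact isCompact_Icc

theorem coeff_sub {g h : (Fin d → ℝ) → ℂ} (hg : Continuous g) (hh : Continuous h)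
    (n : Fin d → ℤ) : coeff L (fun x => g x - h x) n = coeff L g n - coeff L h n := by
  have hm := continuous_mode L (-n)
  have h := integral_sub (integrableOn_cube_of_continuous (L := L) (hg.mul hm))
    (integrableOn_cube_of_continuous (hh.mul hm))
  simp only [Pi.mul_apply] at h
  unfold coeff
  rw [← mul_sub, ← h]
  simp only [sub_mul]

theorem coeff_network (hL : 0 < L) {ι : Type} [Fintype ι] (ω : ι → Fin d → ℤ) (v : ι → ℂ)
    (n : Fin d → ℤ) : coeff L (network L ω v) n = collected ω v n := by
  have h : coeff L (network L ω v) n = ∑ k, v k * coeff L (mode L (ω k)) n := by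
    unfold coeff network
    simp only [Finset.sum_mul]
    rw [integral_finsetSum _ fun k _ => integrableOn_cube_of_continuous (by
      have := continuous_mode L (ω k)
      have := continuous_mode L (-n)
      fun_prop), Finset.mul_sum]
    refine Finset.sum_congr rfl fun k _ => ?_
    simp only [mul_assoc]
    rw [integral_const_mul]
    ring
  rw [h]
  simp only [coeff_mode hL, collected, mul_ite, mul_one, mul_zero]

/-- Bessel's inequality for the difference of a network and a continuous periodic function. -/
theorem sum_sq_collected_sub_le (hL : 0 < L) {f : (Fin d → ℝ) → ℂ} (hf : Continuous f)
    (hper : ∀ (x : Fin d → ℝ) (n : Fin d → ℤ), f (fun i => x i + 2 * L * (n i : ℝ)) = f x)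
    {ι : Type} [Fintype ι] (ω : ι → Fin d → ℤ) (v : ι → ℂ) (A : Finset (Fin d → ℤ)) :
    ∑ n ∈ A, ‖collected ω v n - coeff L f n‖ ^ 2
      ≤ ((2 * L) ^ d)⁻¹ * ∫ x in cube d L, ‖network L ω v x - f x‖ ^ 2 := by
  have h := hasSum_sq_coeff hL ((continuous_network (L := L) ω v).sub hf) (fun x n => by
    simp only [Pi.sub_apply, hper, network_periodic hL])
  have h2 : ∀ n, coeff L (network L ω v - f) n = collected ω v n - coeff L f n := fun n => by
    rw [← coeff_network hL]
    exact coeff_sub (continuous_network ω v) hf n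
  simp only [h2, Pi.sub_apply] at h
  exact sum_le_hasSum _ (fun _ _ => by positivity) h

/-- The lower bound of the density dominates Lebesgue measure on the cube by ρ₀⁻¹ times the data
law. Thus a small risk forces a small mean square on the whole cube. -/
theorem integral_cube_le_integral_pointLaw {ρ : (Fin d → ℝ) → ℝ} {ρ₀ : ℝ}
    (hρ₀ : 0 < ρ₀) (hρ : ∀ x ∈ cube d L, ρ₀ ≤ ρ x)
    (hρ1 : ∫⁻ x in cube d L, ENNReal.ofReal (ρ x) = 1) {g : (Fin d → ℝ) → ℝ}
    (hg : Continuous g) (hg0 : ∀ x, 0 ≤ g x) :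
    ∫ x in cube d L, g x ≤ ρ₀⁻¹ * ∫ x, g x ∂(pointLaw L ρ) := by
  have hi : Integrable g (pointLaw L ρ) := by
    have hK : IsCompact (cube d L) := isCompact_Icc
    obtain ⟨C, hC⟩ := hK.exists_bound_of_continuousOn hg.continuousOn
    have hfin : IsFiniteMeasure (pointLaw L ρ) := by
      refine ⟨?_⟩
      rw [pointLaw, withDensity_apply _ MeasurableSet.univ, Measure.restrict_univ, hρ1]
      exact ENNReal.one_lt_top
    refine Integrable.of_bound hg.aestronglyMeasurable C ?_
    refine (withDensity_absolutelyContinuous _ _).ae_le ?_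
    exact (ae_restrict_iff' measurableSet_Icc).2 (Filter.Eventually.of_forall hC)
  have hle : (volume.restrict (cube d L)) ≤ (ENNReal.ofReal ρ₀)⁻¹ • pointLaw L ρ := by
    refine Measure.le_iff.2 fun s hs => ?_
    rw [Measure.smul_apply, pointLaw, withDensity_apply _ hs, smul_eq_mul, mul_comm,
      ← div_eq_mul_inv, ENNReal.le_div_iff_mul_le (Or.inl (by simp [hρ₀])) (Or.inl (by simp)),
      mul_comm, ← setLIntegral_const]
    refine lintegral_mono_ae ?_
    refine ae_restrict_of_ae ((ae_restrict_iff' measurableSet_Icc).2 ?_)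
    exact Filter.Eventually.of_forall fun x hx => ENNReal.ofReal_le_ofReal (hρ x hx)
  have := integral_mono_measure hle (Filter.Eventually.of_forall hg0)
    (hi.smul_measure (by simp [hρ₀]))
  rw [integral_smul_measure] at this
  simpa [ENNReal.toReal_inv, hρ₀.le] using this

end NetworkCoefficients

/-! ### Summability of powers of the Fourier coefficients. -/

section LatticeSums

variable {d : ℕ}

/-- The index lattice is identified with the span of the standard basis in ℝ^d under the sup norm,
where the general lattice criterion applies. -/
theorem summable_norm_lattice_rpow {r : ℝ} (hr : r < -d) :
    Summable fun n : Fin d → ℤ => ‖n‖ ^ r := by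
  let b := Pi.basisFun ℝ (Fin d)
  let Λ := Submodule.span ℤ (Set.range b)
  have hfr : Module.finrank ℤ Λ = d := by
    rw [ZLattice.rank ℝ]
    simp
  have h := ZLattice.summable_norm_rpow Λ r (by rw [hfr]; exact hr)
  let e := (b.restrictScalars ℤ).equivFun
  have h2 := e.symm.toEquiv.summable_iff.2 h
  refine h2.congr fun n => ?_
  have : ((e.symm n : Λ) : Fin d → ℝ) = fun i => (n i : ℝ) := by
    have h3 : (e.symm n) = ∑ i, n i • (b.restrictScalars ℤ) i := Module.Basis.equivFun_symm_apply _ _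
    rw [h3]
    ext i
    simp [b, Pi.single_apply]
  simp only [Function.comp]
  congr 1
  change ‖((e.symm n : Λ) : Fin d → ℝ)‖ = _
  rw [this]
  simp only [Pi.norm_def]
  congr 1

theorem norm_le_len (n : Fin d → ℤ) : ‖n‖ ≤ len n := by
  refine (pi_norm_le_iff_of_nonneg (Real.sqrt_nonneg _)).2 fun i => ?_
  refine Real.le_sqrt_of_sq_le ?_
  rw [Int.norm_eq_abs, sq_abs]
  exact Finset.single_le_sum (f := fun i => (n i : ℝ) ^ 2) (fun _ _ => by positivity)
    (Finset.mem_univ i)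

/-- Exponents θ < 1 are allowed as long as θℓ > d. This surplus over absolute summability is what
gives a rate for the mass below a threshold. -/
theorem summable_rpow_of_decay {a : (Fin d → ℤ) → ℂ} {C ℓ : ℝ} (hC : 0 < C) (hℓ : 0 < ℓ)
    (ha : ∀ n, n ≠ 0 → ‖a n‖ ≤ (C / len n) ^ ℓ) {θ : ℝ} (hθ0 : 0 < θ) (hθ : d < θ * ℓ) :
    Summable fun n => ‖a n‖ ^ θ := by
  have h := (summable_norm_lattice_rpow (d := d) (r := -(θ * ℓ)) (by linarith)).mul_left
    (C ^ (θ * ℓ))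
  refine Summable.of_norm_bounded_eventually h ?_
  -- The decay hypothesis says nothing at the zero mode, so the comparison is made off a finite set.
  have : (Set.Finite {n : Fin d → ℤ | ¬ ‖‖a n‖ ^ θ‖ ≤ C ^ (θ * ℓ) * ‖n‖ ^ (-(θ * ℓ))}) := by
    refine (Set.finite_singleton (0 : Fin d → ℤ)).subset fun n hn => ?_
    by_contra hn0
    have hn0' : n ≠ 0 := hn0
    apply hn
    have hnp : 0 < ‖n‖ := norm_pos_iff.2 hn0'
    have hlen : 0 < len n := hnp.trans_le (norm_le_len n)
    rw [Real.norm_of_nonneg (by positivity)]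
    calc ‖a n‖ ^ θ ≤ ((C / len n) ^ ℓ) ^ θ := by gcongr; exact ha n hn0'
      _ ≤ ((C / ‖n‖) ^ ℓ) ^ θ := by gcongr; exact norm_le_len n
      _ = C ^ (θ * ℓ) * ‖n‖ ^ (-(θ * ℓ)) := by
        rw [← Real.rpow_mul (by positivity), mul_comm ℓ θ, Real.div_rpow hC.le hnp.le,
          Real.rpow_neg hnp.le, div_eq_mul_inv]
  exact this

end LatticeSums

/-! ### Mass and number of the coefficients below and above a threshold. -/

section Tails

variable {Λ : Type*}

/-- The mass of the coefficients of modulus less than `t`. -/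
noncomputable def tailMass (a : Λ → ℂ) (t : ℝ) : ℝ := ∑' n, {n | ‖a n‖ < t}.indicator (fun n => ‖a n‖) n

/-- Below the threshold, |a| = |a|^(1-θ)|a|^θ ≤ t^(1-θ)|a|^θ. -/
theorem tailMass_le {a : Λ → ℂ} {θ t : ℝ} (hθ1 : θ ≤ 1) (ht : 0 < t)
    (ha : Summable fun n => ‖a n‖) (haθ : Summable fun n => ‖a n‖ ^ θ) :
    tailMass a t ≤ t ^ (1 - θ) * ∑' n, ‖a n‖ ^ θ := by
  rw [← tsum_mul_left]
  refine (ha.indicator _).tsum_le_tsum (fun n => ?_) (haθ.mul_left _)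
  by_cases h : ‖a n‖ < t
  · rw [Set.indicator_of_mem (show n ∈ {n | ‖a n‖ < t} from h)]
    rcases (norm_nonneg (a n)).eq_or_lt with h0 | h0
    · rw [← h0]; positivity
    · calc ‖a n‖ = ‖a n‖ ^ (1 - θ) * ‖a n‖ ^ θ := by
            rw [← Real.rpow_add h0]; simp
        _ ≤ t ^ (1 - θ) * ‖a n‖ ^ θ := by
            gcongr
  · rw [Set.indicator_of_notMem (show n ∉ {n | ‖a n‖ < t} from h)]
    positivity

theorem tailMass_nonneg (a : Λ → ℂ) (t : ℝ) : 0 ≤ tailMass a t :=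
  tsum_nonneg fun _ => Set.indicator_nonneg (fun _ _ => norm_nonneg _) _

theorem tailMass_le_tsum {a : Λ → ℂ} (ha : Summable fun n => ‖a n‖) (t : ℝ) :
    tailMass a t ≤ ∑' n, ‖a n‖ :=
  (ha.indicator _).tsum_le_tsum
    (fun n => Set.indicator_le_self' (fun _ _ => norm_nonneg _) n) ha

theorem finite_setOf_le_norm {a : Λ → ℂ} (ha : Summable fun n => ‖a n‖) {t : ℝ} (ht : 0 < t) :
    {n | t ≤ ‖a n‖}.Finite := by
  have := ha.tendsto_cofinite_zero.eventually (gt_mem_nhds ht)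
  simpa [Filter.eventually_cofinite] using this

theorem card_mul_le_tsum {a : Λ → ℂ} (ha : Summable fun n => ‖a n‖) {t : ℝ} {A : Finset Λ}
    (hA : ∀ n ∈ A, t ≤ ‖a n‖) : A.card * t ≤ ∑' n, ‖a n‖ := by
  calc A.card * t = ∑ n ∈ A, t := by simp
    _ ≤ ∑ n ∈ A, ‖a n‖ := Finset.sum_le_sum hA
    _ ≤ _ := ha.sum_le_tsum _ fun _ _ => norm_nonneg _

end Tails

end RFF

open MeasureTheory ProbabilityTheory
open scoped ENNReal

namespace RFF

/-! ### Bias and variance of sums of independent variables. -/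

section SumOfIndependent

variable {ι : Type*} [Fintype ι] {Ω : Type*} [MeasurableSpace Ω] {P : ι → Measure Ω}
  [∀ i, IsProbabilityMeasure (P i)]

theorem memLp_two_sum_pi {E : Type*} [NormedAddCommGroup E] {X : ι → Ω → E}
    (hX : ∀ i, MemLp (X i) 2 (P i)) :
    MemLp (fun ω => ∑ i, X i (ω i)) 2 (Measure.pi P) :=
  memLp_finsetSum _ fun i _ => (hX i).comp_measurePreserving (measurePreserving_eval _ i)

theorem integral_comp_eval {E : Type*} [NormedAddCommGroup E] [NormedSpace ℝ E] {X : Ω → E} {i : ι}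
    (hX : AEStronglyMeasurable X (P i)) : ∫ ω, X (ω i) ∂(Measure.pi P) = ∫ z, X z ∂(P i) := by
  have h := measurePreserving_eval P i
  rw [← h.map_eq] at hX
  conv_rhs => rw [← h.map_eq]
  rw [integral_map h.measurable.aemeasurable hX]

/-- Bias-variance decomposition: variances of independent summands add up, and each is at most the
second moment. -/
theorem integral_sq_sum_sub_le_real {X : ι → Ω → ℝ} (hX : ∀ i, MemLp (X i) 2 (P i)) (y : ℝ) :
    ∫ ω, (∑ i, X i (ω i) - y) ^ 2 ∂(Measure.pi P)
      ≤ (∑ i, ∫ z, X i z ∂(P i) - y) ^ 2 + ∑ i, ∫ z, X i z ^ 2 ∂(P i) := by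
  have hZ := memLp_two_sum_pi hX
  have hmean : ∫ ω, ∑ i, X i (ω i) ∂(Measure.pi P) = ∑ i, ∫ z, X i z ∂(P i) := by
    have hint : ∀ i, Integrable (fun ω : ι → Ω => X i (ω i)) (Measure.pi P) := fun i =>
      ((hX i).comp_measurePreserving (measurePreserving_eval P i)).integrable one_le_two
    rw [integral_finsetSum _ fun i _ => hint i]
    exact Finset.sum_congr rfl fun i _ => integral_comp_eval (hX i).1
  have hvar := variance_sum_pi hX
  have hfun : (∑ i, fun ω : ι → Ω => X i (ω i)) = fun ω => ∑ i, X i (ω i) := by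
    ext ω; simp
  rw [hfun, variance_eq_sub hZ, hmean] at hvar
  have hle : ∑ i, Var[X i; P i] ≤ ∑ i, ∫ z, X i z ^ 2 ∂(P i) := by
    refine Finset.sum_le_sum fun i _ => ?_
    rw [variance_eq_sub (hX i)]
    have := sq_nonneg (∫ z, X i z ∂(P i))
    simp only [Pi.pow_apply]
    linarith
  have h1 : Integrable (fun ω : ι → Ω => (∑ i, X i (ω i)) ^ 2) (Measure.pi P) := hZ.integrable_sq
  have h2 : Integrable (fun ω : ι → Ω => ∑ i, X i (ω i)) (Measure.pi P) := hZ.integrable one_le_two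
  have hexp : ∫ ω, (∑ i, X i (ω i) - y) ^ 2 ∂(Measure.pi P)
      = ∫ ω, (∑ i, X i (ω i)) ^ 2 ∂(Measure.pi P) - 2 * y * ∑ i, ∫ z, X i z ∂(P i) + y ^ 2 := by
    rw [← hmean, ← integral_const_mul, ← integral_sub h1 (h2.const_mul _)]
    have : y ^ 2 = ∫ ω : ι → Ω, y ^ 2 ∂(Measure.pi P) := by simp
    have h3 : Integrable (fun ω : ι → Ω => (∑ i, X i (ω i)) ^ 2 - 2 * y * ∑ i, X i (ω i))
      (Measure.pi P) := h1.sub (h2.const_mul _)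
    rw [this, ← integral_add h3 (integrable_const _)]
    congr 1
    ext ω
    ring
  simp only [Pi.pow_apply] at hvar
  rw [hexp]
  nlinarith

theorem integral_norm_sq_sum_sub_le {X : ι → Ω → ℂ} (hX : ∀ i, MemLp (X i) 2 (P i)) (y : ℂ) :
    ∫ ω, ‖∑ i, X i (ω i) - y‖ ^ 2 ∂(Measure.pi P)
      ≤ ‖∑ i, ∫ z, X i z ∂(P i) - y‖ ^ 2 + ∑ i, ∫ z, ‖X i z‖ ^ 2 ∂(P i) := by
  have hsq : ∀ z : ℂ, ‖z‖ ^ 2 = z.re ^ 2 + z.im ^ 2 := fun z => by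
    rw [Complex.sq_norm, Complex.normSq_apply]; ring
  have hre : ∀ i, MemLp (fun z => (X i z).re) 2 (P i) := fun i => (hX i).re
  have him : ∀ i, MemLp (fun z => (X i z).im) 2 (P i) := fun i => (hX i).im
  have h1 := integral_sq_sum_sub_le_real hre y.re
  have h2 := integral_sq_sum_sub_le_real him y.im
  simp only [hsq, Complex.sub_re, Complex.sub_im, Complex.re_sum, Complex.im_sum]
  have i1 : Integrable (fun ω : ι → Ω => (∑ i, (X i (ω i)).re - y.re) ^ 2) (Measure.pi P) :=
    ((memLp_two_sum_pi hre).sub (memLp_const _)).integrable_sq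
  have i2 : Integrable (fun ω : ι → Ω => (∑ i, (X i (ω i)).im - y.im) ^ 2) (Measure.pi P) :=
    ((memLp_two_sum_pi him).sub (memLp_const _)).integrable_sq
  rw [integral_add i1 i2]
  have h3 : ∀ i, ∫ z, (X i z).re ^ 2 + (X i z).im ^ 2 ∂(P i)
      = ∫ z, (X i z).re ^ 2 ∂(P i) + ∫ z, (X i z).im ^ 2 ∂(P i) := fun i =>
    integral_add (hre i).integrable_sq (him i).integrable_sq
  have h4 : ∀ i, (∫ z, X i z ∂(P i)).re = ∫ z, (X i z).re ∂(P i) := fun i =>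
    (integral_re ((hX i).integrable one_le_two)).symm
  have h5 : ∀ i, (∫ z, X i z ∂(P i)).im = ∫ z, (X i z).im ∂(P i) := fun i =>
    (integral_im ((hX i).integrable one_le_two)).symm
  simp only [h3, h4, h5, Finset.sum_add_distrib]
  linarith

end SumOfIndependent

/-! ### Moments of the difference between an expectation and a sample mean. -/

section Gap

variable {Ω : Type*} [MeasurableSpace Ω]

/-- The difference of the expected value and the empirical mean of `φ`. -/
noncomputable def gap (P : Measure Ω) {J : ℕ} (D : Fin J → Ω) (φ : Ω → ℂ) : ℂ :=
  ∫ z, φ z ∂P - (J : ℂ)⁻¹ * ∑ j, φ (D j)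

variable {P : Measure Ω} {J : ℕ}

theorem measurable_gap {φ : Ω → ℂ} (hφ : Measurable φ) :
    Measurable fun D : Fin J → Ω => gap P D φ := by
  unfold gap
  fun_prop

theorem gap_sub {D : Fin J → Ω} {φ ψ : Ω → ℂ} (hφ : Integrable φ P) (hψ : Integrable ψ P) :
    gap P D (fun z => φ z - ψ z) = gap P D φ - gap P D ψ := by
  unfold gap
  rw [integral_sub hφ hψ, Finset.sum_sub_distrib]
  ring

theorem gap_add {D : Fin J → Ω} {φ ψ : Ω → ℂ} (hφ : Integrable φ P) (hψ : Integrable ψ P) :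
    gap P D (fun z => φ z + ψ z) = gap P D φ + gap P D ψ := by
  unfold gap
  rw [integral_add hφ hψ, Finset.sum_add_distrib]
  ring

theorem gap_const_mul {D : Fin J → Ω} {φ : Ω → ℂ} (c : ℂ) :
    gap P D (fun z => c * φ z) = c * gap P D φ := by
  unfold gap
  rw [integral_const_mul, ← Finset.mul_sum]
  ring

theorem gap_sum {D : Fin J → Ω} {κ : Type*} (s : Finset κ) {φ : κ → Ω → ℂ}
    (hφ : ∀ i ∈ s, Integrable (φ i) P) :
    gap P D (fun z => ∑ i ∈ s, φ i z) = ∑ i ∈ s, gap P D (φ i) := by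
  unfold gap
  rw [integral_finsetSum _ hφ, Finset.sum_comm, Finset.mul_sum, ← Finset.sum_sub_distrib]

theorem gap_conj {D : Fin J → Ω} {φ : Ω → ℂ} :
    gap P D (fun z => (starRingEnd ℂ) (φ z)) = (starRingEnd ℂ) (gap P D φ) := by
  unfold gap
  rw [integral_conj]
  simp

theorem norm_gap_le (D : Fin J → Ω) (φ : Ω → ℂ) :
    ‖gap P D φ‖ ≤ ∫ z, ‖φ z‖ ∂P + (J : ℝ)⁻¹ * ∑ j, ‖φ (D j)‖ := by
  unfold gap
  refine (norm_sub_le _ _).trans (add_le_add (norm_integral_le_integral_norm _) ?_)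
  rw [norm_mul, norm_inv, Complex.norm_natCast]
  gcongr
  exact norm_sum_le _ _

variable [IsProbabilityMeasure P]

theorem gap_one (hJ : 0 < J) (D : Fin J → Ω) : gap P D (fun _ => 1) = 0 := by
  have : (J : ℂ) ≠ 0 := by exact_mod_cast hJ.ne'
  simp [gap, this]

/-- The sample mean is unbiased for the integral, so only the variance term survives. -/
theorem lintegral_norm_gap_sq_le (hJ : 0 < J) {φ : Ω → ℂ} (hφ : MemLp φ 2 P) :
    ∫⁻ D, ENNReal.ofReal (‖gap P D φ‖ ^ 2) ∂(Measure.pi fun _ : Fin J => P)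
      ≤ ENNReal.ofReal ((∫ z, ‖φ z‖ ^ 2 ∂P) / J) := by
  have hJ' : (J : ℂ) ≠ 0 := by exact_mod_cast hJ.ne'
  have hJr : (0 : ℝ) < J := by exact_mod_cast hJ
  have hm : ∀ i : Fin J, MemLp (fun z => (J : ℂ)⁻¹ * φ z) 2 P := fun _ => hφ.const_mul _
  have h := integral_norm_sq_sum_sub_le (P := fun _ : Fin J => P) hm (∫ z, φ z ∂P)
  have hi : Integrable (fun D : Fin J → Ω =>
      ‖∑ i, (J : ℂ)⁻¹ * φ (D i) - ∫ z, φ z ∂P‖ ^ 2) (Measure.pi fun _ : Fin J => P) :=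
    ((memLp_two_sum_pi hm).sub (memLp_const _)).integrable_norm_pow two_ne_zero
  have heq : ∀ D : Fin J → Ω, ‖gap P D φ‖ ^ 2 = ‖∑ i, (J : ℂ)⁻¹ * φ (D i) - ∫ z, φ z ∂P‖ ^ 2 := by
    intro D
    rw [gap, Finset.mul_sum, norm_sub_rev]
  simp only [heq]
  rw [← ofReal_integral_eq_lintegral_ofReal hi (Filter.Eventually.of_forall fun _ => by positivity)]
  refine ENNReal.ofReal_le_ofReal (h.trans (le_of_eq ?_))
  have h0 : ∑ i : Fin J, ∫ z, (J : ℂ)⁻¹ * φ z ∂P - ∫ z, φ z ∂P = 0 := by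
    rw [Finset.sum_const, Finset.card_univ, Fintype.card_fin, integral_const_mul, nsmul_eq_mul,
      mul_inv_cancel_left₀ hJ', sub_self]
  have h1 : ∀ z, ‖(J : ℂ)⁻¹ * φ z‖ ^ 2 = (J : ℝ)⁻¹ ^ 2 * ‖φ z‖ ^ 2 := fun z => by
    rw [norm_mul, mul_pow, norm_inv, Complex.norm_natCast]
  rw [h0]
  simp only [h1, integral_const_mul, Finset.sum_const, Finset.card_univ, Fintype.card_fin]
  simp only [nsmul_eq_mul, norm_zero]
  field_simp
  simp

/-- Taylor's bound covers |y| ≤ 1. For y > 1 the last term alone exceeds exp y, and for y < -1 one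
has exp y ≤ 1 ≤ 1 + y + y². -/
theorem exp_le_one_add_add_sq {b y : ℝ} (hy : |y| ≤ b) :
    Real.exp y ≤ 1 + y + y ^ 2 * Real.exp b := by
  have hb : 1 ≤ Real.exp b := Real.one_le_exp ((abs_nonneg y).trans hy)
  by_cases h1 : |y| ≤ 1
  · have := (abs_le.1 (Real.abs_exp_sub_one_sub_id_le h1)).2
    nlinarith [sq_nonneg y]
  · push Not at h1
    rcases le_or_gt 0 y with h0 | h0
    · rw [abs_of_nonneg h0] at hy h1
      have : Real.exp y ≤ Real.exp b := Real.exp_le_exp.2 hy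
      have h2 : Real.exp b ≤ y ^ 2 * Real.exp b :=
        le_mul_of_one_le_left (Real.exp_pos b).le (by nlinarith)
      linarith
    · rw [abs_of_neg h0] at h1
      have : Real.exp y ≤ 1 := Real.exp_le_one_iff.2 h0.le
      nlinarith

/-- One term of the exponential series at |x|; it turns exponential moments into moments of every
even order. -/
theorem pow_two_mul_le_exp (m : ℕ) (x : ℝ) :
    x ^ (2 * m) ≤ (2 * m).factorial * (Real.exp x + Real.exp (-x)) := by
  have h := Real.pow_div_factorial_le_exp |x| (abs_nonneg x) (2 * m)
  rw [div_le_iff₀ (by positivity), Even.pow_abs ⟨m, by ring⟩] at h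
  have h2 : Real.exp |x| ≤ Real.exp x + Real.exp (-x) := by
    rcases abs_cases x with ⟨h, _⟩ | ⟨h, _⟩ <;> rw [h] <;>
      linarith [Real.exp_pos x, Real.exp_pos (-x)]
  calc x ^ (2 * m) ≤ Real.exp |x| * (2 * m).factorial := h
    _ ≤ (Real.exp x + Real.exp (-x)) * (2 * m).factorial := by gcongr
    _ = _ := mul_comm _ _

/-- Exponential moments of a normalized sum of centred bounded independent variables. -/
theorem integral_exp_sum_le (hJ : 0 < J) {ψ : Ω → ℝ} (hψ : Measurable ψ) {b v : ℝ}
    (hb : ∀ z, |ψ z| ≤ b) (h0 : ∫ z, ψ z ∂P = 0) (hv : ∫ z, ψ z ^ 2 ∂P ≤ v / J) :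
    Integrable (fun D : Fin J → Ω => Real.exp (∑ j, ψ (D j))) (Measure.pi fun _ : Fin J => P) ∧
    ∫ D : Fin J → Ω, Real.exp (∑ j, ψ (D j)) ∂(Measure.pi fun _ : Fin J => P)
      ≤ Real.exp (v * Real.exp b) := by
  have hJr : (0 : ℝ) < J := by exact_mod_cast hJ
  constructor
  · refine Integrable.of_bound (C := Real.exp (J * b)) ?_ ?_
    · exact (by fun_prop : Measurable _).aestronglyMeasurable
    · refine Filter.Eventually.of_forall fun D => ?_
      rw [Real.norm_of_nonneg (Real.exp_pos _).le, Real.exp_le_exp]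
      calc ∑ j, ψ (D j) ≤ ∑ j : Fin J, b := Finset.sum_le_sum fun j _ => (le_abs_self _).trans (hb _)
        _ = J * b := by simp
  · simp only [Real.exp_sum]
    have := integral_fintype_prod_eq_pow (𝕜 := ℝ) (ι := Fin J) (μ := P) (fun z => Real.exp (ψ z))
    rw [this, Fintype.card_fin]
    have hint : Integrable ψ P := Integrable.of_bound hψ.aestronglyMeasurable b
      (Filter.Eventually.of_forall hb)
    have hint2 : Integrable (fun z => ψ z ^ 2) P :=
      Integrable.of_bound (by fun_prop) (b ^ 2) (Filter.Eventually.of_forall fun z => by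
        rw [norm_pow]; exact pow_le_pow_left₀ (norm_nonneg _) (hb z) 2)
    have hinte : Integrable (fun z => Real.exp (ψ z)) P :=
      Integrable.of_bound (by fun_prop) (Real.exp b) (Filter.Eventually.of_forall fun z => by
        rw [Real.norm_of_nonneg (Real.exp_pos _).le, Real.exp_le_exp]
        exact (le_abs_self _).trans (hb z))
    -- Each factor of the product exceeds 1 by at most O(1/J), so its J-th power is bounded
    -- independently of J.
    have h1 : ∫ z, Real.exp (ψ z) ∂P ≤ Real.exp (v * Real.exp b / J) := by
      calc ∫ z, Real.exp (ψ z) ∂P ≤ ∫ z, (1 + ψ z + ψ z ^ 2 * Real.exp b) ∂P :=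
            integral_mono hinte (((integrable_const _).add hint).add (hint2.mul_const _))
              fun z => exp_le_one_add_add_sq (hb z)
        _ = 1 + (∫ z, ψ z ^ 2 ∂P) * Real.exp b := by
            have h3 : Integrable (fun z => 1 + ψ z) P := (integrable_const _).add hint
            rw [integral_add h3 (hint2.mul_const _),
              integral_add (integrable_const _) hint, h0, integral_mul_const]
            simp
        _ ≤ 1 + v / J * Real.exp b := by gcongr
        _ ≤ Real.exp (v / J * Real.exp b) := by
            linarith [Real.add_one_le_exp (v / J * Real.exp b)]
        _ = _ := by rw [div_mul_eq_mul_div]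
    calc (∫ z, Real.exp (ψ z) ∂P) ^ J ≤ Real.exp (v * Real.exp b / J) ^ J := by
          gcongr
      _ = Real.exp (v * Real.exp b) := by
          rw [← Real.exp_nat_mul]
          field_simp

theorem lintegral_sum_pow_le (hJ : 0 < J) {ψ : Ω → ℝ} (hψ : Measurable ψ) {b v : ℝ}
    (hb : ∀ z, |ψ z| ≤ b) (h0 : ∫ z, ψ z ∂P = 0) (hv : ∫ z, ψ z ^ 2 ∂P ≤ v / J) (m : ℕ) :
    ∫⁻ D : Fin J → Ω, ENNReal.ofReal ((∑ j, ψ (D j)) ^ (2 * m)) ∂(Measure.pi fun _ : Fin J => P)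
      ≤ ENNReal.ofReal ((2 * m).factorial * (2 * Real.exp (v * Real.exp b))) := by
  obtain ⟨i1, h1⟩ := integral_exp_sum_le hJ hψ hb h0 hv
  obtain ⟨i2, h2⟩ := integral_exp_sum_le (P := P) (v := v) hJ hψ.neg (b := b)
    (fun z => by simpa using hb z) (by simp [integral_neg, h0]) (by simpa using hv)
  simp only [Pi.neg_apply, Finset.sum_neg_distrib] at i2 h2
  calc _ ≤ ∫⁻ D : Fin J → Ω, ENNReal.ofReal ((2 * m).factorial *
        (Real.exp (∑ j, ψ (D j)) + Real.exp (-∑ j, ψ (D j)))) ∂(Measure.pi fun _ : Fin J => P) :=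
        lintegral_mono fun D => ENNReal.ofReal_le_ofReal (pow_two_mul_le_exp m _)
    _ = ENNReal.ofReal (∫ D : Fin J → Ω, ((2 * m).factorial *
        (Real.exp (∑ j, ψ (D j)) + Real.exp (-∑ j, ψ (D j)))) ∂(Measure.pi fun _ : Fin J => P)) :=
        (ofReal_integral_eq_lintegral_ofReal ((i1.add i2).const_mul _)
          (Filter.Eventually.of_forall fun D => mul_nonneg (Nat.cast_nonneg _)
            (add_pos (Real.exp_pos _) (Real.exp_pos _)).le)).symm
    _ ≤ _ := by
        refine ENNReal.ofReal_le_ofReal ?_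
        rw [integral_const_mul, integral_add i1 i2]
        gcongr
        linarith

/-- The constant in the moment bound `lintegral_gap_pow_le`. -/
noncomputable def momentConst (m : ℕ) (c : ℝ) : ℝ :=
  2 ^ (m - 1) * (2 * ((2 * m).factorial * (2 * Real.exp (c * Real.exp (2 * c)))))

theorem momentConst_nonneg (m : ℕ) (c : ℝ) : 0 ≤ momentConst m c := by
  unfold momentConst
  positivity

/-- All moments of the normalized gap are bounded for functions of size at most `√J`. -/
theorem lintegral_gap_pow_le (hJ : 0 < J) {φ : Ω → ℂ} (hφ : Measurable φ) {c : ℝ}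
    (hc : ∀ z, ‖φ z‖ ≤ c * Real.sqrt J) (hv : ∫ z, ‖φ z‖ ^ 2 ∂P ≤ c) (m : ℕ) :
    ∫⁻ D, ENNReal.ofReal ((J * ‖gap P D φ‖ ^ 2) ^ m) ∂(Measure.pi fun _ : Fin J => P)
      ≤ ENNReal.ofReal (momentConst m c) := by
  have hJr : (0 : ℝ) < J := by exact_mod_cast hJ
  have hsJ : 0 < Real.sqrt J := Real.sqrt_pos.2 hJr
  have hss : Real.sqrt J ^ 2 = J := Real.sq_sqrt hJr.le
  have hφi : Integrable φ P := Integrable.of_bound hφ.aestronglyMeasurable _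
    (Filter.Eventually.of_forall hc)
  -- Real and imaginary parts are treated separately. The centred summands divided by √J are bounded
  -- by 2c and have second moment at most c/J, as `lintegral_sum_pow_le` requires.
  have key : ∀ θ : Ω → ℝ, Measurable θ → (∀ z, |θ z| ≤ ‖φ z‖) →
      ∫⁻ D : Fin J → Ω, ENNReal.ofReal ((∑ j, (∫ z, θ z ∂P - θ (D j)) / Real.sqrt J) ^ (2 * m))
        ∂(Measure.pi fun _ : Fin J => P)
      ≤ ENNReal.ofReal ((2 * m).factorial * (2 * Real.exp (c * Real.exp (2 * c)))) := by
    intro θ hθ hle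
    have hθb : ∀ z, |θ z| ≤ c * Real.sqrt J := fun z => (hle z).trans (hc z)
    have hθi : Integrable θ P := Integrable.of_bound hθ.aestronglyMeasurable _
      (Filter.Eventually.of_forall hθb)
    have hθi2 : Integrable (fun z => θ z ^ 2) P :=
      Integrable.of_bound (by fun_prop) ((c * Real.sqrt J) ^ 2)
        (Filter.Eventually.of_forall fun z => by
          rw [norm_pow]; exact pow_le_pow_left₀ (norm_nonneg _) (hθb z) 2)
    have hm : |∫ z, θ z ∂P| ≤ c * Real.sqrt J := by
      have := norm_integral_le_of_norm_le_const (μ := P) (f := θ) (Filter.Eventually.of_forall hθb)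
      simpa using this
    refine lintegral_sum_pow_le hJ (ψ := fun z => (∫ z, θ z ∂P - θ z) / Real.sqrt J)
      (by fun_prop) (fun z => ?_) ?_ ?_ m
    · rw [abs_div, abs_of_pos hsJ, div_le_iff₀ hsJ]
      calc |∫ z, θ z ∂P - θ z| ≤ |∫ z, θ z ∂P| + |θ z| := abs_sub _ _
        _ ≤ _ := by linarith [hθb z]
    · rw [integral_div, integral_sub (integrable_const _) hθi]
      simp
    · have h1 : ∫ z, ((∫ z, θ z ∂P - θ z) / Real.sqrt J) ^ 2 ∂P
          = (∫ z, θ z ^ 2 ∂P - (∫ z, θ z ∂P) ^ 2) / J := by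
        simp only [div_pow, hss]
        rw [integral_div]
        congr 1
        have h3 : Integrable (fun z => (∫ z, θ z ∂P) ^ 2 - 2 * (∫ z, θ z ∂P) * θ z) P :=
          (integrable_const _).sub (hθi.const_mul _)
        calc ∫ z, (∫ z, θ z ∂P - θ z) ^ 2 ∂P
            = ∫ z, ((∫ z, θ z ∂P) ^ 2 - 2 * (∫ z, θ z ∂P) * θ z + θ z ^ 2) ∂P := by
              congr 1; ext z; ring
          _ = _ := by
              rw [integral_add h3 hθi2, integral_sub (integrable_const _) (hθi.const_mul _),
                integral_const_mul]
              simp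
              ring
      rw [h1]
      have h2 : ∫ z, θ z ^ 2 ∂P ≤ c := by
        refine (integral_mono hθi2 ?_ fun z => ?_).trans hv
        · exact Integrable.of_bound (by fun_prop) ((c * Real.sqrt J) ^ 2)
            (Filter.Eventually.of_forall fun z => by
              rw [norm_pow, norm_norm]; exact pow_le_pow_left₀ (norm_nonneg _) (hc z) 2)
        · rw [← sq_abs]
          exact pow_le_pow_left₀ (abs_nonneg _) (hle z) 2
      gcongr
      linarith [sq_nonneg (∫ z, θ z ∂P)]
  have hre := key (fun z => (φ z).re) (by fun_prop) fun z => Complex.abs_re_le_norm _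
  have him := key (fun z => (φ z).im) (by fun_prop) fun z => Complex.abs_im_le_norm _
  have hid : ∀ D : Fin J → Ω, (J * ‖gap P D φ‖ ^ 2)
      = (∑ j, (∫ z, (φ z).re ∂P - (φ (D j)).re) / Real.sqrt J) ^ 2
        + (∑ j, (∫ z, (φ z).im ∂P - (φ (D j)).im) / Real.sqrt J) ^ 2 := by
    intro D
    have hre : (gap P D φ).re = (J : ℝ)⁻¹ * ∑ j, (∫ z, (φ z).re ∂P - (φ (D j)).re) := by
      have h1 : (∫ z, φ z ∂P).re = ∫ z, (φ z).re ∂P := (integral_re hφi).symm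
      have h2 : ((J : ℂ)⁻¹ * ∑ j, φ (D j)).re = (J : ℝ)⁻¹ * ∑ j, (φ (D j)).re := by
        rw [← Complex.ofReal_natCast, ← Complex.ofReal_inv, Complex.re_ofReal_mul, Complex.re_sum]
      rw [gap, Complex.sub_re, h1, h2, Finset.sum_sub_distrib]
      simp only [Finset.sum_const, Finset.card_univ, Fintype.card_fin, nsmul_eq_mul]
      field_simp
    have him : (gap P D φ).im = (J : ℝ)⁻¹ * ∑ j, (∫ z, (φ z).im ∂P - (φ (D j)).im) := by
      have h1 : (∫ z, φ z ∂P).im = ∫ z, (φ z).im ∂P := (integral_im hφi).symm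
      have h2 : ((J : ℂ)⁻¹ * ∑ j, φ (D j)).im = (J : ℝ)⁻¹ * ∑ j, (φ (D j)).im := by
        rw [← Complex.ofReal_natCast, ← Complex.ofReal_inv, Complex.im_ofReal_mul, Complex.im_sum]
      rw [gap, Complex.sub_im, h1, h2, Finset.sum_sub_distrib]
      simp only [Finset.sum_const, Finset.card_univ, Fintype.card_fin, nsmul_eq_mul]
      field_simp
    rw [Complex.sq_norm, Complex.normSq_apply, hre, him, ← Finset.sum_div, ← Finset.sum_div,
      div_pow, div_pow, hss]
    field_simp
  have hle : ∀ D : Fin J → Ω, ENNReal.ofReal ((J * ‖gap P D φ‖ ^ 2) ^ m) ≤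
      ENNReal.ofReal (2 ^ (m - 1)) *
      (ENNReal.ofReal ((∑ j, (∫ z, (φ z).re ∂P - (φ (D j)).re) / Real.sqrt J) ^ (2 * m)) +
      ENNReal.ofReal ((∑ j, (∫ z, (φ z).im ∂P - (φ (D j)).im) / Real.sqrt J) ^ (2 * m))) := by
    intro D
    have he : ∀ x : ℝ, 0 ≤ x ^ (2 * m) := fun x => by rw [pow_mul]; positivity
    rw [← ENNReal.ofReal_add (he _) (he _), ← ENNReal.ofReal_mul (by positivity), hid D, pow_mul,
      pow_mul]
    exact ENNReal.ofReal_le_ofReal (add_pow_le (sq_nonneg _) (sq_nonneg _) m)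
  have hB : 0 ≤ (2 * m).factorial * (2 * Real.exp (c * Real.exp (2 * c))) := by positivity
  refine (lintegral_mono hle).trans ?_
  rw [lintegral_const_mul _ (by fun_prop), lintegral_add_left (by fun_prop), momentConst,
    ENNReal.ofReal_mul (by positivity),
    two_mul (((2 * m).factorial : ℝ) * (2 * Real.exp (c * Real.exp (2 * c)))),
    ENNReal.ofReal_add hB hB]
  gcongr

end Gap

end RFF

open MeasureTheory ProbabilityTheory
open scoped ENNReal ComplexConjugate

namespace RFF

/-! ### Expansion of the gap of a squared error into gaps of single modes. -/

section CauchySchwarz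

theorem norm_sum_mul_le {α : Type*} (s : Finset α) (x g : α → ℂ) :
    ‖∑ i ∈ s, x i * g i‖ ≤ Real.sqrt (∑ i ∈ s, ‖x i‖ ^ 2) * Real.sqrt (∑ i ∈ s, ‖g i‖ ^ 2) := by
  refine (norm_sum_le _ _).trans ?_
  simp only [norm_mul]
  exact Real.sum_mul_le_sqrt_mul_sqrt s _ _

/-- A sesquilinear form is bounded by the Hilbert-Schmidt norm of its matrix, which is a sum of
squared gaps and so has computable expectation. -/
theorem norm_sum_sum_mul_le {α β : Type*} (s : Finset α) (t : Finset β) (x : α → ℂ) (y : β → ℂ)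
    (g : α → β → ℂ) :
    ‖∑ i ∈ s, ∑ j ∈ t, x i * conj (y j) * g i j‖
      ≤ Real.sqrt (∑ i ∈ s, ‖x i‖ ^ 2) * Real.sqrt (∑ j ∈ t, ‖y j‖ ^ 2)
        * Real.sqrt (∑ i ∈ s, ∑ j ∈ t, ‖g i j‖ ^ 2) := by
  have h := norm_sum_mul_le (s ×ˢ t) (fun p => x p.1 * conj (y p.2)) (fun p => g p.1 p.2)
  rw [Finset.sum_product, Finset.sum_product, Finset.sum_product] at h
  refine h.trans (le_of_eq ?_)
  congr 1
  rw [← Real.sqrt_mul (Finset.sum_nonneg fun _ _ => by positivity), Finset.sum_mul_sum]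
  simp only [norm_mul, RCLike.norm_conj, mul_pow]

end CauchySchwarz

section Expansion

variable {d : ℕ} {L : ℝ} {P : Measure ((Fin d → ℝ) × ℝ)} {J : ℕ}
  {D : Fin J → (Fin d → ℝ) × ℝ}

theorem measurable_mode_fst (n : Fin d → ℤ) :
    Measurable fun z : (Fin d → ℝ) × ℝ => mode L n z.1 :=
  (measurable_mode L n).comp measurable_fst

theorem integrable_mode_mul {E : (Fin d → ℝ) × ℝ → ℂ} (hE : Integrable E P) (n : Fin d → ℤ) :
    Integrable (fun z => mode L n z.1 * E z) P :=
  hE.bdd_mul (c := 1) (measurable_mode_fst n).aestronglyMeasurable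
    (Filter.Eventually.of_forall fun z => (norm_mode L n z.1).le)

/-- A mode times a conjugate mode is again a mode, so the quadratic part involves only gaps at
frequency differences. The rest is linear in the amplitudes, or free of them. -/
theorem gap_norm_sq_sub [IsProbabilityMeasure P] {κ : Type*} (s : Finset κ) (t : κ → ℂ) (n : κ → Fin d → ℤ)
    {Y : (Fin d → ℝ) × ℝ → ℂ} (hY : MemLp Y 2 P) :
    (gap P D fun z => ((‖∑ i ∈ s, t i * mode L (n i) z.1 - Y z‖ ^ 2 : ℝ) : ℂ)).re
      = (∑ i ∈ s, ∑ j ∈ s, t i * conj (t j) * gap P D fun z => mode L (n i - n j) z.1).re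
        - 2 * (∑ i ∈ s, t i * gap P D fun z => mode L (n i) z.1 * conj (Y z)).re
        + (gap P D fun z => ((‖Y z‖ ^ 2 : ℝ) : ℂ)).re := by
  have hYi : Integrable (fun z => conj (Y z)) P := by
    have := (hY.integrable one_le_two)
    exact (LinearIsometryEquiv.integrable_comp_iff (μ := P) Complex.conjLIE (φ := Y)).2 this
  have hY2 : Integrable (fun z => ((‖Y z‖ ^ 2 : ℝ) : ℂ)) P :=
    (hY.integrable_norm_pow two_ne_zero).ofReal
  have hm : ∀ m : Fin d → ℤ, Integrable (fun z : (Fin d → ℝ) × ℝ => mode L m z.1) P := fun m =>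
    Integrable.of_bound (measurable_mode_fst m).aestronglyMeasurable 1
      (Filter.Eventually.of_forall fun z => (norm_mode L m z.1).le)
  have h1 : ∀ z : (Fin d → ℝ) × ℝ, ((‖∑ i ∈ s, t i * mode L (n i) z.1 - Y z‖ ^ 2 : ℝ) : ℂ)
      = (∑ i ∈ s, ∑ j ∈ s, t i * conj (t j) * mode L (n i - n j) z.1
        - (∑ i ∈ s, t i * (mode L (n i) z.1 * conj (Y z))
          + conj (∑ i ∈ s, t i * (mode L (n i) z.1 * conj (Y z)))))
        + ((‖Y z‖ ^ 2 : ℝ) : ℂ) := by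
    intro z
    have h2 : ∑ i ∈ s, ∑ j ∈ s, t i * conj (t j) * mode L (n i - n j) z.1
        = (∑ i ∈ s, t i * mode L (n i) z.1) * conj (∑ i ∈ s, t i * mode L (n i) z.1) := by
      rw [map_sum, Finset.sum_mul_sum]
      refine Finset.sum_congr rfl fun i _ => Finset.sum_congr rfl fun j _ => ?_
      rw [mode_sub, map_mul]
      ring
    have h3 : ∑ i ∈ s, t i * (mode L (n i) z.1 * conj (Y z))
        = (∑ i ∈ s, t i * mode L (n i) z.1) * conj (Y z) := by
      rw [Finset.sum_mul]
      exact Finset.sum_congr rfl fun i _ => by ring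
    rw [h2, h3]
    set W := ∑ i ∈ s, t i * mode L (n i) z.1
    push_cast
    rw [← Complex.mul_conj', ← Complex.mul_conj']
    simp only [map_sub, map_mul, Complex.conj_conj]
    ring
  simp only [h1]
  have i1 : Integrable (fun z : (Fin d → ℝ) × ℝ =>
      ∑ i ∈ s, ∑ j ∈ s, t i * conj (t j) * mode L (n i - n j) z.1) P :=
    integrable_finsetSum _ fun i _ => integrable_finsetSum _ fun j _ => (hm _).const_mul _
  have i2 : Integrable (fun z : (Fin d → ℝ) × ℝ =>
      ∑ i ∈ s, t i * (mode L (n i) z.1 * conj (Y z))) P :=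
    integrable_finsetSum _ fun i _ => (integrable_mode_mul hYi _).const_mul _
  have i3 : Integrable (fun z : (Fin d → ℝ) × ℝ =>
      conj (∑ i ∈ s, t i * (mode L (n i) z.1 * conj (Y z)))) P :=
    (LinearIsometryEquiv.integrable_comp_iff (μ := P) Complex.conjLIE).2 i2
  have hcomb : ∀ {p q r w : (Fin d → ℝ) × ℝ → ℂ}, Integrable p P → Integrable q P →
      Integrable r P → Integrable w P → gap P D (fun z => p z - (q z + r z) + w z)
        = gap P D p - (gap P D q + gap P D r) + gap P D w := by
    intro p q r w hp hq hr hw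
    have hqr : Integrable (fun z => q z + r z) P := hq.add hr
    have hpqr : Integrable (fun z => p z - (q z + r z)) P := hp.sub hqr
    rw [gap_add hpqr hw, gap_sub hp hqr, gap_add hq hr]
  rw [hcomb i1 i2 i3 hY2, gap_conj, gap_sum s fun i _ => (integrable_mode_mul hYi _).const_mul _,
    gap_sum s fun i _ => integrable_finsetSum _ fun j _ => (hm _).const_mul _]
  simp only [gap_const_mul]
  have h5 : ∀ i, (gap P D fun z => ∑ j ∈ s, t i * conj (t j) * mode L (n i - n j) z.1)
      = ∑ j ∈ s, t i * conj (t j) * gap P D fun z => mode L (n i - n j) z.1 := fun i => by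
    rw [gap_sum s fun j _ => (hm _).const_mul _]
    simp only [gap_const_mul]
  simp only [h5, Complex.add_re, Complex.sub_re, Complex.conj_re]
  ring

theorem norm_gap_mode_neg (n : Fin d → ℤ) :
    ‖gap P D fun z => mode L (-n) z.1‖ = ‖gap P D fun z => mode L n z.1‖ := by
  simp only [mode_neg]
  rw [gap_conj, RCLike.norm_conj]

end Expansion

end RFF

/-! ### The target function with its data law, and the decomposition of its risk. -/

open MeasureTheory ProbabilityTheory
open scoped ENNReal ComplexConjugate

namespace RFF

/-- A target function with summable Fourier coefficients, together with the law `μ` of the data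
points and the law `N` of the noise. The constant `β` controls the mean square over the fundamental
cube by the mean square with respect to `μ`. -/
structure Target (d : ℕ) where
  L : ℝ
  f : (Fin d → ℝ) → ℂ
  μ : Measure (Fin d → ℝ)
  N : Measure ℝ
  s : ℝ
  β : ℝ
  L_pos : 0 < L
  continuous_f : Continuous f
  periodic_f : ∀ (x : Fin d → ℝ) (n : Fin d → ℤ), f (fun i => x i + 2 * L * (n i : ℝ)) = f x
  summable_norm_coeff : Summable fun n => ‖coeff L f n‖
  exists_coeff_ne_zero : ∃ n, coeff L f n ≠ 0
  isProbabilityMeasure_μ : IsProbabilityMeasure μ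
  isProbabilityMeasure_N : IsProbabilityMeasure N
  memLp_noise : MemLp (fun ξ : ℝ => ξ) 2 N
  mean_noise : ∫ ξ, ξ ∂N = 0
  variance_noise : ∫ ξ, ξ ^ 2 ∂N = s ^ 2
  β_pos : 0 < β
  integral_cube_le : ∀ g : (Fin d → ℝ) → ℝ, Continuous g → (∀ x, 0 ≤ g x) →
    ((2 * L) ^ d)⁻¹ * ∫ x in cube d L, g x ≤ β * ∫ x, g x ∂μ

namespace Target

attribute [instance] isProbabilityMeasure_μ isProbabilityMeasure_N

variable {d : ℕ} (T : Target d)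

/-- The Fourier coefficients of the target. -/
noncomputable def a (n : Fin d → ℤ) : ℂ := coeff T.L T.f n

/-- The `ℓ¹` norm of the Fourier coefficients. -/
noncomputable def S : ℝ := ∑' n, ‖T.a n‖

/-- The law of one data pair. -/
noncomputable def P : Measure ((Fin d → ℝ) × ℝ) := T.μ.prod T.N

instance : IsProbabilityMeasure T.P := inferInstanceAs (IsProbabilityMeasure (T.μ.prod T.N))

theorem summable_a : Summable fun n => ‖T.a n‖ := T.summable_norm_coeff

theorem hasSum_f (x : Fin d → ℝ) : HasSum (fun n => T.a n * mode T.L n x) (T.f x) :=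
  hasSum_coeff_mul_mode T.L_pos T.continuous_f T.periodic_f T.summable_norm_coeff.of_norm x

theorem S_pos : 0 < T.S := by
  obtain ⟨n, hn⟩ := T.exists_coeff_ne_zero
  exact T.summable_a.tsum_pos (fun _ => norm_nonneg _) n (norm_pos_iff.2 hn)

theorem norm_f_le (x : Fin d → ℝ) : ‖T.f x‖ ≤ T.S := by
  have h := T.hasSum_f x
  rw [← h.tsum_eq]
  refine (norm_tsum_le_tsum_norm ?_).trans (le_of_eq ?_) <;> simp only [norm_mul, norm_mode, mul_one]
  · exact T.summable_a
  · rfl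

/-- The bound is uniform in the number of frequencies and in A. It serves both to absorb the gaps on
A and to show that a small first-stage risk makes every collected amplitude accurate. -/
theorem bessel {ι : Type} [Fintype ι] (ω : ι → Fin d → ℤ) (v : ι → ℂ) (A : Finset (Fin d → ℤ)) :
    ∑ n ∈ A, ‖collected ω v n - T.a n‖ ^ 2
      ≤ T.β * ∫ x, ‖network T.L ω v x - T.f x‖ ^ 2 ∂T.μ :=
  (sum_sq_collected_sub_le T.L_pos T.continuous_f T.periodic_f ω v A).trans
    (T.integral_cube_le _ (((continuous_network ω v).sub T.continuous_f).norm.pow 2)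
      fun _ => by positivity)

/-- The noisy value of the part of the target outside the modes in `A`. -/
noncomputable def resid (A : Finset (Fin d → ℤ)) (z : (Fin d → ℝ) × ℝ) : ℂ :=
  T.f z.1 - ∑ n ∈ A, T.a n * mode T.L n z.1 + (z.2 : ℂ)

/-- The gap of a mode. -/
noncomputable def γ {J : ℕ} (D : Fin J → (Fin d → ℝ) × ℝ) (n : Fin d → ℤ) : ℂ :=
  gap T.P D fun z => mode T.L n z.1

/-- The gap of a mode against the residual. -/
noncomputable def lin (A : Finset (Fin d → ℤ)) {J : ℕ} (D : Fin J → (Fin d → ℝ) × ℝ)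
    (n : Fin d → ℤ) : ℂ :=
  gap T.P D fun z => mode T.L n z.1 * conj (T.resid A z)

/-- The gap of the squared residual, without the squared noise. -/
noncomputable def sqGap (A : Finset (Fin d → ℤ)) {J : ℕ} (D : Fin J → (Fin d → ℝ) × ℝ) : ℂ :=
  gap T.P D fun z => ((‖T.resid A z‖ ^ 2 - z.2 ^ 2 : ℝ) : ℂ)

/-- The generalization error. -/
noncomputable def risk (α : (Fin d → ℝ) → ℂ) : ℝ := ∫ x, ‖α x - T.f x‖ ^ 2 ∂T.μ

/-- The empirical error in excess of the mean squared noise. -/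
noncomputable def excess {J : ℕ} (D : Fin J → (Fin d → ℝ) × ℝ) (α : (Fin d → ℝ) → ℂ) : ℝ :=
  (J : ℝ)⁻¹ * ∑ j, (‖α (D j).1 - noisyValues T.f D j‖ ^ 2 - (D j).2 ^ 2)

theorem risk_nonneg (α : (Fin d → ℝ) → ℂ) : 0 ≤ T.risk α :=
  integral_nonneg fun _ => by positivity

theorem memLp_noise_snd : MemLp (fun z : (Fin d → ℝ) × ℝ => z.2) 2 T.P :=
  T.memLp_noise.comp_snd _

theorem memLp_of_bounded {E : (Fin d → ℝ) × ℝ → ℂ} (hE : Measurable E) {c : ℝ}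
    (hc : ∀ z, ‖E z‖ ≤ c) : MemLp E 2 T.P :=
  MemLp.of_bound hE.aestronglyMeasurable c (Filter.Eventually.of_forall hc)

theorem measurable_f : Measurable T.f := T.continuous_f.measurable

theorem measurable_resid (A : Finset (Fin d → ℤ)) : Measurable (T.resid A) := by
  unfold resid
  refine Measurable.add (Measurable.sub (T.measurable_f.comp measurable_fst) ?_)
    (Complex.measurable_ofReal.comp measurable_snd)
  exact Finset.measurable_fun_sum _ fun n _ => (measurable_mode_fst n).const_mul _

/-- The part of the target outside the modes in `A`. -/
noncomputable def rest (A : Finset (Fin d → ℤ)) (x : Fin d → ℝ) : ℂ :=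
  T.f x - ∑ n ∈ A, T.a n * mode T.L n x

theorem resid_eq (A : Finset (Fin d → ℤ)) (z : (Fin d → ℝ) × ℝ) :
    T.resid A z = T.rest A z.1 + (z.2 : ℂ) := rfl

theorem continuous_rest (A : Finset (Fin d → ℤ)) : Continuous (T.rest A) := by
  unfold rest
  exact T.continuous_f.sub (continuous_finsetSum _ fun n _ =>
    continuous_const.mul (continuous_mode _ n))

/-- The remainder is the Fourier series over the complement of A, whose total mass is the right-hand
side. -/
theorem norm_rest_le (A : Finset (Fin d → ℤ)) (x : Fin d → ℝ) :
    ‖T.rest A x‖ ≤ T.S - ∑ n ∈ A, ‖T.a n‖ := by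
  have h1 := T.hasSum_f x
  have h2 : HasSum (fun n : {n // n ∉ A} => T.a n * mode T.L n x) (T.rest A x) :=
    (Finset.hasSum_compl_iff (f := fun n => T.a n * mode T.L n x) A).2 (by
      simpa only [rest, sub_add_cancel] using h1)
  have h3 : HasSum (fun n : {n // n ∉ A} => ‖T.a n‖) (T.S - ∑ n ∈ A, ‖T.a n‖) :=
    (Finset.hasSum_compl_iff (f := fun n => ‖T.a n‖) A).2 (by
      simpa only [sub_add_cancel, S] using T.summable_a.hasSum)
  rw [← h2.tsum_eq, ← h3.tsum_eq]
  refine (norm_tsum_le_tsum_norm ?_).trans (le_of_eq ?_) <;> simp only [norm_mul, norm_mode, mul_one]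
  exact h3.summable

theorem norm_rest_le_S (A : Finset (Fin d → ℤ)) (x : Fin d → ℝ) : ‖T.rest A x‖ ≤ T.S :=
  (T.norm_rest_le A x).trans (sub_le_self _ (Finset.sum_nonneg fun _ _ => norm_nonneg _))

theorem memLp_resid (A : Finset (Fin d → ℤ)) : MemLp (T.resid A) 2 T.P :=
  (T.memLp_of_bounded ((T.continuous_rest A).measurable.comp measurable_fst)
    fun z => T.norm_rest_le_S A z.1).add T.memLp_noise_snd.ofReal

theorem integral_noise_mul (g : (Fin d → ℝ) → ℂ) : ∫ z, g z.1 * (z.2 : ℂ) ∂T.P = 0 := by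
  unfold P
  rw [integral_prod_mul (f := g) (g := fun ξ : ℝ => (ξ : ℂ)), integral_complex_ofReal, T.mean_noise]
  simp

theorem integral_noise_sq : ∫ z, z.2 ^ 2 ∂T.P = T.s ^ 2 := by
  rw [← T.variance_noise]
  exact integral_fun_snd (μ := T.μ) (ν := T.N) (fun ξ : ℝ => ξ ^ 2) |>.trans (by simp)

/-- The risk is the excess plus a gap. -/
theorem risk_eq_excess_add_gap {J : ℕ} (D : Fin J → (Fin d → ℝ) × ℝ)
    {α : (Fin d → ℝ) → ℂ} (hα : Continuous α) {c : ℝ} (hc : ∀ x, ‖α x‖ ≤ c) :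
    T.risk α = T.excess D α
      + (gap T.P D fun z => ((‖α z.1 - T.f z.1 - z.2‖ ^ 2 - z.2 ^ 2 : ℝ) : ℂ)).re := by
  -- Subtracting the squared noise leaves only a cross term, which has mean zero. The noise is
  -- assumed to have two moments only, so the gap of its square could not be bounded in mean square.
  have hid : ∀ z : (Fin d → ℝ) × ℝ, (‖α z.1 - T.f z.1 - z.2‖ ^ 2 - z.2 ^ 2 : ℝ)
      = ‖α z.1 - T.f z.1‖ ^ 2 - 2 * ((α z.1 - T.f z.1) * (z.2 : ℂ)).re := by
    intro z
    simp only [Complex.sq_norm, Complex.normSq_apply, Complex.sub_re, Complex.sub_im,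
      Complex.ofReal_re, Complex.ofReal_im, Complex.mul_re]
    ring
  have hint : ∫ z, (‖α z.1 - T.f z.1 - z.2‖ ^ 2 - z.2 ^ 2 : ℝ) ∂T.P = T.risk α := by
    simp only [hid]
    have hb : ∀ x, ‖α x - T.f x‖ ≤ c + T.S := fun x =>
      (norm_sub_le _ _).trans (add_le_add (hc x) (T.norm_f_le x))
    have hm : Measurable fun z : (Fin d → ℝ) × ℝ => α z.1 - T.f z.1 :=
      (hα.measurable.sub T.measurable_f).comp measurable_fst
    have i1 : Integrable (fun z : (Fin d → ℝ) × ℝ => ‖α z.1 - T.f z.1‖ ^ 2) T.P :=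
      (T.memLp_of_bounded hm fun z => hb z.1).integrable_norm_pow two_ne_zero
    have i2 : Integrable (fun z : (Fin d → ℝ) × ℝ => (α z.1 - T.f z.1) * (z.2 : ℂ)) T.P :=
      (T.memLp_noise_snd.ofReal.integrable one_le_two).bdd_mul hm.aestronglyMeasurable
        (Filter.Eventually.of_forall fun z => hb z.1)
    have h0 : ∫ z : (Fin d → ℝ) × ℝ, ((α z.1 - T.f z.1) * (z.2 : ℂ)).re ∂T.P = 0 := by
      have := integral_re i2
      rw [T.integral_noise_mul fun x => α x - T.f x] at this
      simpa using this
    have i3 : Integrable (fun z : (Fin d → ℝ) × ℝ => 2 * ((α z.1 - T.f z.1) * (z.2 : ℂ)).re) T.P :=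
      i2.re.const_mul 2
    rw [integral_sub i1 i3, integral_const_mul, h0, risk]
    have := integral_fun_fst (μ := T.μ) (ν := T.N) (fun x => ‖α x - T.f x‖ ^ 2)
    rw [P, this]
    simp
  have h2 : (gap T.P D fun z => ((‖α z.1 - T.f z.1 - z.2‖ ^ 2 - z.2 ^ 2 : ℝ) : ℂ)).re
      = T.risk α - T.excess D α := by
    rw [gap, integral_complex_ofReal, hint, excess, ← Complex.ofReal_natCast, ← Complex.ofReal_inv,
      ← Complex.ofReal_sum, ← Complex.ofReal_mul, ← Complex.ofReal_sub, Complex.ofReal_re]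
    simp only [noisyValues, sub_sub]
  rw [h2]
  ring

end Target

end RFF

/-! ### The deterministic risk bound for the minimizer. -/

open MeasureTheory ProbabilityTheory
open scoped ENNReal ComplexConjugate

namespace RFF

/-- Absorption of the gap terms into the risk and the regularization. -/
theorem absorb_gap {r R g V l₁ l₂ τ β X U Γ₁ Γ₂ Γ₃ Λ₁ Λ₂ Θ : ℝ} (hl₁ : 0 < l₁) (hl₂ : 0 < l₂)
    (hτ : 0 < τ) (hβ : 0 < β) (hX : X ^ 2 ≤ β * r) (hU : U ^ 2 ≤ V) (hΓ₁ : 0 ≤ Γ₁)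
    (hΓ : β * Γ₁ ≤ τ / 4) (hr0 : 0 ≤ r)
    (hr : r ≤ R - l₁ * V - l₂ * V ^ 2 + g)
    (hg : g ≤ X ^ 2 * Γ₁ + 2 * (X * U * Γ₂) + U ^ 2 * Γ₃ + 2 * (X * Λ₁ + U * Λ₂) + Θ) :
    (1 - 3 * τ / 4) * r + l₁ / 2 * V ≤ R + 4 * β / τ * Λ₁ ^ 2 + 8 * β ^ 2 / (τ ^ 2 * l₂) * (Γ₂ ^ 2) ^ 2
      + 1 / (2 * l₂) * Γ₃ ^ 2 + 2 / l₁ * Λ₂ ^ 2 + Θ := by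
  have hV : 0 ≤ V := (sq_nonneg U).trans hU
  have h1 : X ^ 2 * Γ₁ ≤ τ / 4 * r := by
    calc X ^ 2 * Γ₁ ≤ β * r * Γ₁ := by gcongr
      _ = β * Γ₁ * r := by ring
      _ ≤ τ / 4 * r := by gcongr
  have hXr : τ / (4 * β) * X ^ 2 ≤ τ / 4 * r := by
    calc τ / (4 * β) * X ^ 2 ≤ τ / (4 * β) * (β * r) := by gcongr
      _ = τ / 4 * r := by field_simp
  -- The weight is chosen so that each application costs τ/4 of the risk. It is used twice, and with
  -- `h1` this makes the total loss of 3τ/4.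
  have young : ∀ y : ℝ, 2 * (X * y) ≤ τ / 4 * r + 4 * β / τ * y ^ 2 := by
    intro y
    refine le_trans ?_ (add_le_add_left hXr _)
    have : τ / (4 * β) * X ^ 2 + 4 * β / τ * y ^ 2 - 2 * (X * y)
      = τ / (4 * β) * (X - 4 * β / τ * y) ^ 2 := by
      field_simp
      ring
    have h2 : 0 ≤ τ / (4 * β) * (X - 4 * β / τ * y) ^ 2 := by positivity
    linarith
  have h2 := young Λ₁
  have h3 := young (U * Γ₂)
  have hU4 : (U ^ 2) ^ 2 ≤ V ^ 2 := pow_le_pow_left₀ (sq_nonneg _) hU 2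
  -- The leftover of Young's inequality is quadratic in U, that is linear in U², so half of the
  -- quartic penalty absorbs it. The other half is spent on Γ₃.
  have h4 : 4 * β / τ * (U * Γ₂) ^ 2 ≤ l₂ / 2 * V ^ 2 + 8 * β ^ 2 / (τ ^ 2 * l₂) * (Γ₂ ^ 2) ^ 2 := by
    have h5 : l₂ / 2 * (U ^ 2) ^ 2 ≤ l₂ / 2 * V ^ 2 := by gcongr
    have : l₂ / 2 * (U ^ 2) ^ 2 + 8 * β ^ 2 / (τ ^ 2 * l₂) * (Γ₂ ^ 2) ^ 2 - 4 * β / τ * (U * Γ₂) ^ 2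
      = l₂ / 2 * (U ^ 2 - 4 * β / (τ * l₂) * Γ₂ ^ 2) ^ 2 := by
      field_simp
      ring
    have h6 : 0 ≤ l₂ / 2 * (U ^ 2 - 4 * β / (τ * l₂) * Γ₂ ^ 2) ^ 2 := by positivity
    linarith
  have h5 : U ^ 2 * Γ₃ ≤ l₂ / 2 * V ^ 2 + 1 / (2 * l₂) * Γ₃ ^ 2 := by
    have h5 : l₂ / 2 * (U ^ 2) ^ 2 ≤ l₂ / 2 * V ^ 2 := by gcongr
    have : l₂ / 2 * (U ^ 2) ^ 2 + 1 / (2 * l₂) * Γ₃ ^ 2 - U ^ 2 * Γ₃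
      = l₂ / 2 * (U ^ 2 - 1 / l₂ * Γ₃) ^ 2 := by
      field_simp
      ring
    have h6 : 0 ≤ l₂ / 2 * (U ^ 2 - 1 / l₂ * Γ₃) ^ 2 := by positivity
    linarith
  have h6 : 2 * (U * Λ₂) ≤ l₁ / 2 * V + 2 / l₁ * Λ₂ ^ 2 := by
    have h5 : l₁ / 2 * U ^ 2 ≤ l₁ / 2 * V := by gcongr
    have : l₁ / 2 * U ^ 2 + 2 / l₁ * Λ₂ ^ 2 - 2 * (U * Λ₂) = l₁ / 2 * (U - 2 / l₁ * Λ₂) ^ 2 := by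
      field_simp
      ring
    have h6 : 0 ≤ l₁ / 2 * (U - 2 / l₁ * Λ₂) ^ 2 := by positivity
    linarith
  have h7 : 2 * (X * U * Γ₂) = 2 * (X * (U * Γ₂)) := by ring
  linarith

namespace Target

variable {d : ℕ} (T : Target d)

section GapTerms

variable (A : Finset (Fin d → ℤ)) {J : ℕ} (D : Fin J → (Fin d → ℝ) × ℝ) {ι : Type} [Fintype ι]
  (ω : ι → Fin d → ℤ)

/-- The gaps between modes in `A`. -/
noncomputable def gapInner : ℝ := ∑ n ∈ A, ∑ m ∈ A, ‖T.γ D (n - m)‖ ^ 2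

open Classical in
/-- The gaps between the modes in `A` and the sampled modes outside `A`. -/
noncomputable def gapCross : ℝ :=
  ∑ n ∈ A, ∑ k, if ω k ∈ A then 0 else ‖T.γ D (n - ω k)‖ ^ 2

open Classical in
/-- The gaps between the sampled modes outside `A`. -/
noncomputable def gapOuter : ℝ :=
  ∑ k, ∑ l, if ω k ∈ A ∨ ω l ∈ A then 0 else ‖T.γ D (ω k - ω l)‖ ^ 2

/-- The gaps of the modes in `A` against the residual. -/
noncomputable def linInner : ℝ := ∑ n ∈ A, ‖T.lin A D n‖ ^ 2

open Classical in
/-- The gaps of the sampled modes outside `A` against the residual. -/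
noncomputable def linOuter : ℝ := ∑ k, if ω k ∈ A then 0 else ‖T.lin A D (ω k)‖ ^ 2

/-- The total of the gap terms that bound the risk. -/
noncomputable def gapTotal (τ l₁ l₂ : ℝ) : ℝ :=
  4 * T.β / τ * T.linInner A D + 8 * T.β ^ 2 / (τ ^ 2 * l₂) * T.gapCross A D ω ^ 2
    + 1 / (2 * l₂) * T.gapOuter A D ω + 2 / l₁ * T.linOuter A D ω + ‖T.sqGap A D‖

theorem gapInner_nonneg : 0 ≤ T.gapInner A D :=
  Finset.sum_nonneg fun _ _ => Finset.sum_nonneg fun _ _ => by positivity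

theorem gapCross_nonneg : 0 ≤ T.gapCross A D ω :=
  Finset.sum_nonneg fun _ _ => Finset.sum_nonneg fun _ _ => by split_ifs <;> positivity

theorem gapOuter_nonneg : 0 ≤ T.gapOuter A D ω :=
  Finset.sum_nonneg fun _ _ => Finset.sum_nonneg fun _ _ => by split_ifs <;> positivity

theorem linInner_nonneg : 0 ≤ T.linInner A D := Finset.sum_nonneg fun _ _ => by positivity

theorem linOuter_nonneg : 0 ≤ T.linOuter A D ω :=
  Finset.sum_nonneg fun _ _ => by split_ifs <;> positivity

theorem gapTotal_nonneg {τ l₁ l₂ : ℝ} (hτ : 0 < τ) (h₁ : 0 < l₁) (h₂ : 0 < l₂) :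
    0 ≤ T.gapTotal A D ω τ l₁ l₂ := by
  have := T.gapOuter_nonneg A D ω
  have := T.linInner_nonneg A D
  have := T.linOuter_nonneg A D ω
  have := T.β_pos
  unfold gapTotal
  positivity

open Classical in
/-- The gap of the squared error of a network is bounded by the gap terms. -/
theorem re_gap_network_le (v : ι → ℂ) :
    ∃ X U : ℝ, X ^ 2 ≤ T.β * T.risk (network T.L ω v) ∧ U ^ 2 ≤ ∑ k, ‖v k‖ ^ 2 ∧
    (gap T.P D fun z =>
      ((‖network T.L ω v z.1 - T.f z.1 - z.2‖ ^ 2 - z.2 ^ 2 : ℝ) : ℂ)).re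
      ≤ X ^ 2 * Real.sqrt (T.gapInner A D) + 2 * (X * U * Real.sqrt (T.gapCross A D ω))
        + U ^ 2 * Real.sqrt (T.gapOuter A D ω)
        + 2 * (X * Real.sqrt (T.linInner A D) + U * Real.sqrt (T.linOuter A D ω))
        + ‖T.sqGap A D‖ := by
  -- On A only the errors of the collected amplitudes matter, so frequencies sampled in A may repeat
  -- at no cost; `u` keeps the amplitudes of the frequencies outside A.
  let c : (Fin d → ℤ) → ℂ := fun n => collected ω v n - T.a n
  let u : ι → ℂ := fun k => if ω k ∈ A then 0 else v k
  let X := Real.sqrt (∑ n ∈ A, ‖c n‖ ^ 2)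
  let U := Real.sqrt (∑ k, ‖u k‖ ^ 2)
  have hX0 : 0 ≤ X := Real.sqrt_nonneg _
  have hU0 : 0 ≤ U := Real.sqrt_nonneg _
  have hX2 : X ^ 2 = ∑ n ∈ A, ‖c n‖ ^ 2 := Real.sq_sqrt (Finset.sum_nonneg fun _ _ => by positivity)
  have hU2 : U ^ 2 = ∑ k, ‖u k‖ ^ 2 := Real.sq_sqrt (Finset.sum_nonneg fun _ _ => by positivity)
  refine ⟨X, U, ?_, ?_, ?_⟩
  · rw [hX2]
    exact T.bessel ω v A
  · rw [hU2]
    refine Finset.sum_le_sum fun k _ => ?_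
    by_cases h : ω k ∈ A <;> simp [u, h]
  -- the error as a combination of modes and the residual
  let s : Finset ((Fin d → ℤ) ⊕ ι) := A.disjSum Finset.univ
  have hH : ∀ z : (Fin d → ℝ) × ℝ, network T.L ω v z.1 - T.f z.1 - z.2
      = ∑ i ∈ s, Sum.elim c u i * mode T.L (Sum.elim id ω i) z.1 - T.resid A z := by
    intro z
    have h1 : ∑ n ∈ A, collected ω v n * mode T.L n z.1
        = ∑ k, (if ω k ∈ A then v k else 0) * mode T.L (ω k) z.1 := by
      simp only [collected, Finset.sum_mul]
      rw [Finset.sum_comm]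
      refine Finset.sum_congr rfl fun k _ => ?_
      simp only [ite_mul, zero_mul, Finset.sum_ite_eq]
    simp only [s, Finset.sum_disjSum, Sum.elim_inl, Sum.elim_inr, id, c, sub_mul,
      Finset.sum_sub_distrib, resid, h1, network]
    have h2 : ∑ k, v k * mode T.L (ω k) z.1
        = ∑ k, (if ω k ∈ A then v k else 0) * mode T.L (ω k) z.1
          + ∑ k, u k * mode T.L (ω k) z.1 := by
      rw [← Finset.sum_add_distrib]
      refine Finset.sum_congr rfl fun k _ => ?_
      by_cases h : ω k ∈ A <;> simp [u, h]
    rw [h2]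
    ring
  have hY := T.memLp_resid A
  have hexp := gap_norm_sq_sub (L := T.L) (D := D) s (Sum.elim c u) (Sum.elim id ω) hY
  have hsplit : (gap T.P D fun z =>
      ((‖network T.L ω v z.1 - T.f z.1 - z.2‖ ^ 2 - z.2 ^ 2 : ℝ) : ℂ)).re
      = (gap T.P D fun z => ((‖∑ i ∈ s, Sum.elim c u i * mode T.L (Sum.elim id ω i) z.1
          - T.resid A z‖ ^ 2 : ℝ) : ℂ)).re - (gap T.P D fun z => ((‖T.resid A z‖ ^ 2 : ℝ) : ℂ)).re
        + (T.sqGap A D).re := by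
    have i0 : Integrable (fun z : (Fin d → ℝ) × ℝ => ((z.2 ^ 2 : ℝ) : ℂ)) T.P :=
      T.memLp_noise_snd.integrable_sq.ofReal
    have i1 : Integrable (fun z => ((‖T.resid A z‖ ^ 2 : ℝ) : ℂ)) T.P :=
      (hY.integrable_norm_pow two_ne_zero).ofReal
    have i2 : Integrable (fun z => ((‖∑ i ∈ s, Sum.elim c u i * mode T.L (Sum.elim id ω i) z.1
          - T.resid A z‖ ^ 2 : ℝ) : ℂ)) T.P := by
      refine MemLp.integrable_norm_pow (MemLp.sub ?_ hY) two_ne_zero |>.ofReal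
      refine memLp_finsetSum _ fun i _ => ?_
      refine MemLp.const_mul ?_ _
      exact T.memLp_of_bounded (measurable_mode_fst _) fun z => (norm_mode T.L _ z.1).le
    simp only [hH, sqGap, Complex.ofReal_sub]
    rw [gap_sub i2 i0, gap_sub i1 i0]
    simp only [Complex.sub_re]
    ring
  rw [hsplit, hexp]
  -- bounds for the three kinds of terms
  have hquad : (∑ i ∈ s, ∑ j ∈ s, Sum.elim c u i * conj (Sum.elim c u j)
      * gap T.P D fun z => mode T.L (Sum.elim id ω i - Sum.elim id ω j) z.1).re
      ≤ X ^ 2 * Real.sqrt (T.gapInner A D) + 2 * (X * U * Real.sqrt (T.gapCross A D ω))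
        + U ^ 2 * Real.sqrt (T.gapOuter A D ω) := by
    refine (Complex.re_le_norm _).trans ?_
    have e1 : ∑ i ∈ s, ∑ j ∈ s, Sum.elim c u i * conj (Sum.elim c u j)
        * (gap T.P D fun z => mode T.L (Sum.elim id ω i - Sum.elim id ω j) z.1)
        = ∑ n ∈ A, ∑ m ∈ A, c n * conj (c m) * T.γ D (n - m)
        + ∑ n ∈ A, ∑ k, c n * conj (u k) * (if ω k ∈ A then 0 else T.γ D (n - ω k))
        + ∑ k, ∑ n ∈ A, u k * conj (c n) * (if ω k ∈ A then 0 else T.γ D (ω k - n))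
        + ∑ k, ∑ l, u k * conj (u l) * (if ω k ∈ A ∨ ω l ∈ A then 0 else T.γ D (ω k - ω l)) := by
      have q2 : ∑ n ∈ A, ∑ k, c n * conj (u k) * (gap T.P D fun z => mode T.L (n - ω k) z.1)
          = ∑ n ∈ A, ∑ k, c n * conj (u k) * (if ω k ∈ A then 0 else T.γ D (n - ω k)) := by
        refine Finset.sum_congr rfl fun n _ => Finset.sum_congr rfl fun k _ => ?_
        by_cases h : ω k ∈ A <;> simp [u, h, γ]
      have q3 : ∑ k, ∑ n ∈ A, u k * conj (c n) * (gap T.P D fun z => mode T.L (ω k - n) z.1)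
          = ∑ k, ∑ n ∈ A, u k * conj (c n) * (if ω k ∈ A then 0 else T.γ D (ω k - n)) := by
        refine Finset.sum_congr rfl fun k _ => Finset.sum_congr rfl fun n _ => ?_
        by_cases h : ω k ∈ A <;> simp [u, h, γ]
      have q4 : ∑ k, ∑ l, u k * conj (u l) * (gap T.P D fun z => mode T.L (ω k - ω l) z.1)
          = ∑ k, ∑ l, u k * conj (u l)
            * (if ω k ∈ A ∨ ω l ∈ A then 0 else T.γ D (ω k - ω l)) := by
        refine Finset.sum_congr rfl fun k _ => Finset.sum_congr rfl fun l _ => ?_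
        by_cases h : ω k ∈ A <;> by_cases h' : ω l ∈ A <;> simp [u, h, h', γ]
      rw [← q2, ← q3, ← q4]
      simp only [s, Finset.sum_disjSum, Sum.elim_inl, Sum.elim_inr, id, Finset.sum_add_distrib, γ]
      ring
    rw [e1]
    have b1 := norm_sum_sum_mul_le A A c c fun n m => T.γ D (n - m)
    have b2 := norm_sum_sum_mul_le A Finset.univ c u
      fun n k => if ω k ∈ A then 0 else T.γ D (n - ω k)
    have b3 := norm_sum_sum_mul_le Finset.univ A u c
      fun k n => if ω k ∈ A then 0 else T.γ D (ω k - n)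
    have b4 := norm_sum_sum_mul_le Finset.univ Finset.univ u u
      fun k l => if ω k ∈ A ∨ ω l ∈ A then 0 else T.γ D (ω k - ω l)
    have g2 : ∑ n ∈ A, ∑ k, ‖if ω k ∈ A then 0 else T.γ D (n - ω k)‖ ^ 2 = T.gapCross A D ω := by
      refine Finset.sum_congr rfl fun n _ => Finset.sum_congr rfl fun k _ => ?_
      by_cases h : ω k ∈ A <;> simp [h]
    have g3 : ∑ k, ∑ n ∈ A, ‖if ω k ∈ A then 0 else T.γ D (ω k - n)‖ ^ 2 = T.gapCross A D ω := by
      rw [Finset.sum_comm]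
      refine Finset.sum_congr rfl fun n _ => Finset.sum_congr rfl fun k _ => ?_
      by_cases h : ω k ∈ A
      · simp [h]
      · simp only [h, if_false, γ]
        rw [← neg_sub n (ω k), norm_gap_mode_neg]
    have g4 : ∑ k, ∑ l, ‖if ω k ∈ A ∨ ω l ∈ A then 0 else T.γ D (ω k - ω l)‖ ^ 2
        = T.gapOuter A D ω := by
      refine Finset.sum_congr rfl fun k _ => Finset.sum_congr rfl fun l _ => ?_
      by_cases h : ω k ∈ A <;> by_cases h' : ω l ∈ A <;> simp [h, h']
    rw [g2] at b2
    rw [g3] at b3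
    rw [g4] at b4
    change _ ≤ X * X * Real.sqrt (T.gapInner A D) at b1
    change _ ≤ X * U * Real.sqrt (T.gapCross A D ω) at b2
    change _ ≤ U * X * Real.sqrt (T.gapCross A D ω) at b3
    change _ ≤ U * U * Real.sqrt (T.gapOuter A D ω) at b4
    refine (norm_add_le _ _).trans ?_
    refine (add_le_add_left ((norm_add_le _ _).trans (add_le_add_left (norm_add_le _ _) _)) _).trans ?_
    nlinarith [b1, b2, b3, b4]
  have hlin : -(∑ i ∈ s, Sum.elim c u i * gap T.P D fun z =>
      mode T.L (Sum.elim id ω i) z.1 * conj (T.resid A z)).re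
      ≤ X * Real.sqrt (T.linInner A D) + U * Real.sqrt (T.linOuter A D ω) := by
    rw [← Complex.neg_re]
    refine (Complex.re_le_norm _).trans ?_
    rw [norm_neg]
    have e1 : ∑ i ∈ s, Sum.elim c u i * (gap T.P D fun z =>
        mode T.L (Sum.elim id ω i) z.1 * conj (T.resid A z))
        = ∑ n ∈ A, c n * T.lin A D n
          + ∑ k, u k * (if ω k ∈ A then 0 else T.lin A D (ω k)) := by
      simp only [s, Finset.sum_disjSum, Sum.elim_inl, Sum.elim_inr, id]
      congr 1
      refine Finset.sum_congr rfl fun k _ => ?_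
      by_cases h : ω k ∈ A <;> simp [u, h, lin]
    rw [e1]
    have b1 := norm_sum_mul_le A c fun n => T.lin A D n
    have b2 := norm_sum_mul_le Finset.univ u fun k => if ω k ∈ A then 0 else T.lin A D (ω k)
    have g2 : ∑ k, ‖if ω k ∈ A then 0 else T.lin A D (ω k)‖ ^ 2 = T.linOuter A D ω := by
      refine Finset.sum_congr rfl fun k _ => ?_
      by_cases h : ω k ∈ A <;> simp [h]
    rw [g2] at b2
    exact (norm_add_le _ _).trans (add_le_add b1 b2)
  have hsq : (T.sqGap A D).re ≤ ‖T.sqGap A D‖ := Complex.re_le_norm _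
  linarith

/-- The mean squared noise does not depend on the amplitudes, so it cancels when two values of the
loss are compared. -/
theorem loss_eq {l₁ l₂ : ℝ} (v : ι → ℂ) :
    loss T.L l₁ l₂ ω (fun j => (D j).1) (noisyValues T.f D) v
      = T.excess D (network T.L ω v) + l₁ * ∑ k, ‖v k‖ ^ 2 + l₂ * (∑ k, ‖v k‖ ^ 2) ^ 2
        + (J : ℝ)⁻¹ * ∑ j, (D j).2 ^ 2 := by
  simp only [loss, excess, Finset.sum_sub_distrib]
  ring

theorem norm_network_le (v : ι → ℂ) (x : Fin d → ℝ) : ‖network T.L ω v x‖ ≤ ∑ k, ‖v k‖ := by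
  unfold network
  refine (norm_sum_le _ _).trans (Finset.sum_le_sum fun k _ => ?_)
  rw [norm_mul, norm_mode, mul_one]

/-- The generalization bound for the minimizer, for arbitrary frequencies and any comparison
amplitudes `w`. -/
theorem risk_amplitudes_le {l₁ l₂ τ : ℝ} (hl₁ : 0 < l₁) (hl₂ : 0 < l₂) (hτ : 0 < τ)
    (hA : T.β * Real.sqrt (T.gapInner A D) ≤ τ / 4) (w : ι → ℂ) :
    let v := amplitudes T.L l₁ l₂ ω (fun j => (D j).1) (noisyValues T.f D)
    (1 - 3 * τ / 4) * T.risk (network T.L ω v) + l₁ / 2 * ∑ k, ‖v k‖ ^ 2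
      ≤ T.excess D (network T.L ω w) + l₁ * ∑ k, ‖w k‖ ^ 2 + l₂ * (∑ k, ‖w k‖ ^ 2) ^ 2
        + T.gapTotal A D ω τ l₁ l₂ := by
  intro v
  have hmin := amplitudes_spec T.L hl₁ hl₂.le ω (fun j => (D j).1) (noisyValues T.f D) w
  rw [loss_eq, loss_eq] at hmin
  have hrisk := T.risk_eq_excess_add_gap D (continuous_network ω v) (T.norm_network_le ω v)
  obtain ⟨X, U, hX, hU, hg⟩ := T.re_gap_network_le A D ω v
  have := absorb_gap (R := T.excess D (network T.L ω w) + l₁ * ∑ k, ‖w k‖ ^ 2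
    + l₂ * (∑ k, ‖w k‖ ^ 2) ^ 2) hl₁ hl₂ hτ T.β_pos hX hU (Real.sqrt_nonneg _) hA
    (T.risk_nonneg _) (by linarith) hg
  rw [Real.sq_sqrt (T.linInner_nonneg A D), Real.sq_sqrt (T.gapCross_nonneg A D ω),
    Real.sq_sqrt (T.gapOuter_nonneg A D ω), Real.sq_sqrt (T.linOuter_nonneg A D ω)] at this
  unfold gapTotal
  linarith

end GapTerms

end Target

end RFF

open MeasureTheory ProbabilityTheory
open scoped ENNReal ComplexConjugate

namespace RFF

/-! ### Marginals of product laws of frequencies. -/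

section FrequencyLaws

variable {ι : Type} [Fintype ι] {Λ : Type} [MeasurableSpace Λ]

/-- The regularized excess may be negative, so `ENNReal.ofReal` is not additive pointwise.
Nonnegativity of the sum is enough when F is integrable, and an infinite integral of G makes the
claim trivial. -/
theorem lintegral_ofReal_add_le {Ω : Type*} [MeasurableSpace Ω] {m : Measure Ω} {F G : Ω → ℝ}
    (hF : Integrable F m) (hG : Measurable G) (hG0 : ∀ x, 0 ≤ G x) (hFG : ∀ x, 0 ≤ F x + G x) :
    ∫⁻ x, ENNReal.ofReal (F x + G x) ∂m
      ≤ ENNReal.ofReal (∫ x, F x ∂m) + ∫⁻ x, ENNReal.ofReal (G x) ∂m := by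
  by_cases hfin : ∫⁻ x, ENNReal.ofReal (G x) ∂m = ∞
  · rw [hfin, add_top]
    exact le_top
  have hGi : Integrable G m := by
    refine ⟨hG.aestronglyMeasurable, ?_⟩
    rw [hasFiniteIntegral_iff_ofReal (Filter.Eventually.of_forall hG0)]
    exact lt_top_iff_ne_top.2 hfin
  have hi : Integrable (fun x => F x + G x) m := hF.add hGi
  rw [← ofReal_integral_eq_lintegral_ofReal hi (Filter.Eventually.of_forall hFG),
    ← ofReal_integral_eq_lintegral_ofReal hGi (Filter.Eventually.of_forall hG0),
    integral_add hF hGi]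
  exact ENNReal.ofReal_add_le

theorem lintegral_pi_eval (Q : ι → Measure Λ) [∀ k, IsProbabilityMeasure (Q k)] (k : ι)
    {φ : Λ → ℝ≥0∞} (hφ : Measurable φ) :
    ∫⁻ ω, φ (ω k) ∂(Measure.pi Q) = ∫⁻ n, φ n ∂(Q k) :=
  (measurePreserving_eval Q k).lintegral_comp hφ

theorem lintegral_pi_eval_pair (Q : ι → Measure Λ) [∀ k, IsProbabilityMeasure (Q k)] {k l : ι}
    (hkl : k ≠ l) {φ : Λ → Λ → ℝ≥0∞} (hφ : Measurable (Function.uncurry φ)) :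
    ∫⁻ ω, φ (ω k) (ω l) ∂(Measure.pi Q) = ∫⁻ n, ∫⁻ m, φ n m ∂(Q l) ∂(Q k) := by
  have hind : IndepFun (fun ω : ι → Λ => ω k) (fun ω => ω l) (Measure.pi Q) :=
    (iIndepFun_pi (X := fun _ : ι => (id : Λ → Λ)) fun i => aemeasurable_id).indepFun hkl
  have hmap := (indepFun_iff_map_prod_eq_prod_map_map (measurable_pi_apply k).aemeasurable
    (measurable_pi_apply l).aemeasurable).1 hind
  have e1 := (measurePreserving_eval Q k).map_eq
  have e2 := (measurePreserving_eval Q l).map_eq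
  have h1 : ∫⁻ ω, φ (ω k) (ω l) ∂(Measure.pi Q)
      = ∫⁻ p, Function.uncurry φ p ∂((Measure.pi Q).map fun ω => (ω k, ω l)) := by
    rw [lintegral_map hφ (by fun_prop)]
    rfl
  rw [h1, hmap]
  change ∫⁻ p, Function.uncurry φ p ∂(((Measure.pi Q).map (Function.eval k)).prod
    ((Measure.pi Q).map (Function.eval l))) = _
  rw [e1, e2, lintegral_prod _ hφ.aemeasurable]
  rfl

end FrequencyLaws

namespace Target

variable {d : ℕ} (T : Target d)

/-! ### Mean of the risk bound over independent frequencies, for fixed data. -/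

section ConditionalRisk

variable {J : ℕ} (D : Fin J → (Fin d → ℝ) × ℝ) {ι : Type} [Fintype ι]

/-- The regularized excess of the network with amplitudes `W k (ω k)`. -/
noncomputable def regExcess (l₁ l₂ : ℝ) (W : ι → (Fin d → ℤ) → ℂ) (ω : ι → Fin d → ℤ) : ℝ :=
  T.excess D (network T.L ω fun k => W k (ω k)) + l₁ * ∑ k, ‖W k (ω k)‖ ^ 2
    + l₂ * (∑ k, ‖W k (ω k)‖ ^ 2) ^ 2

/-- The bound for the expected regularized excess in terms of the second and fourth moments of the
amplitudes. -/
noncomputable def approxBound (l₁ l₂ S₁ S₂ : ℝ) : ℝ := S₁ + l₁ * S₁ + l₂ * (S₁ ^ 2 + S₂)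

variable {Q : ι → PMF (Fin d → ℤ)} {W : ι → (Fin d → ℤ) → ℂ} {c : ℝ}

/-- At each data point the network has mean f(x_j), which misses y_j exactly by the noise.
Subtracting the squared noise leaves the variance, at most S₁. This holds for every fixed data set,
so the laws Q k may depend on the data. -/
theorem integral_regExcess_le (hJ : 0 < J) {l₁ l₂ : ℝ} (hl₂ : 0 ≤ l₂)
    (hW : ∀ k n, ‖W k n‖ ≤ c)
    (hunb : ∀ x, ∑ k, ∫ n, W k n * mode T.L n x ∂(Q k).toMeasure = T.f x) :
    Integrable (T.regExcess D l₁ l₂ W) (Measure.pi fun k => (Q k).toMeasure) ∧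
    ∫ ω, T.regExcess D l₁ l₂ W ω ∂(Measure.pi fun k => (Q k).toMeasure)
      ≤ approxBound l₁ l₂ (∑ k, ∫ n, ‖W k n‖ ^ 2 ∂(Q k).toMeasure)
        (∑ k, ∫ n, ‖W k n‖ ^ 4 ∂(Q k).toMeasure) := by
  set S₁ := ∑ k, ∫ n, ‖W k n‖ ^ 2 ∂(Q k).toMeasure
  set S₂ := ∑ k, ∫ n, ‖W k n‖ ^ 4 ∂(Q k).toMeasure
  have hJr : (0 : ℝ) < J := by exact_mod_cast hJ
  have hc4 : ∀ k, MemLp (fun n => ‖W k n‖ ^ 2) 2 (Q k).toMeasure := fun k =>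
    MemLp.of_bound Measurable.of_discrete.aestronglyMeasurable (c ^ 2)
      (Filter.Eventually.of_forall fun n => by
        rw [norm_pow, norm_norm]
        exact pow_le_pow_left₀ (norm_nonneg _) (hW k n) 2)
  have hc2 : ∀ x k, MemLp (fun n => W k n * mode T.L n x) 2 (Q k).toMeasure := fun x k =>
    MemLp.of_bound Measurable.of_discrete.aestronglyMeasurable c
      (Filter.Eventually.of_forall fun n => by
        rw [norm_mul, norm_mode, mul_one]
        exact hW k n)
  -- the empirical error
  have hemp : ∀ (x : Fin d → ℝ) (y : ℂ),
      Integrable (fun ω => ‖network T.L ω (fun k => W k (ω k)) x - y‖ ^ 2)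
        (Measure.pi fun k => (Q k).toMeasure) ∧
      ∫ ω, ‖network T.L ω (fun k => W k (ω k)) x - y‖ ^ 2 ∂(Measure.pi fun k => (Q k).toMeasure)
        ≤ ‖T.f x - y‖ ^ 2 + S₁ := by
    intro x y
    refine ⟨((memLp_two_sum_pi (hc2 x)).sub (memLp_const y)).integrable_norm_pow two_ne_zero, ?_⟩
    refine (integral_norm_sq_sum_sub_le (hc2 x) y).trans (le_of_eq ?_)
    rw [hunb x]
    simp only [norm_mul, norm_mode, mul_one]
    rfl
  have hexc_int : Integrable (fun ω => T.excess D (network T.L ω fun k => W k (ω k)))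
      (Measure.pi fun k => (Q k).toMeasure) := by
    unfold excess
    refine Integrable.const_mul (integrable_finsetSum _ fun j _ => ?_) _
    exact (hemp _ _).1.sub (integrable_const _)
  have hexc : ∫ ω, T.excess D (network T.L ω fun k => W k (ω k))
      ∂(Measure.pi fun k => (Q k).toMeasure) ≤ S₁ := by
    unfold excess
    have hi : ∀ j, Integrable (fun ω => ‖network T.L ω (fun k => W k (ω k)) (D j).1
        - noisyValues T.f D j‖ ^ 2 - (D j).2 ^ 2) (Measure.pi fun k => (Q k).toMeasure) :=
      fun j => (hemp _ _).1.sub (integrable_const _)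
    rw [integral_const_mul, integral_finsetSum _ fun j _ => hi j, inv_mul_le_iff₀ hJr]
    calc _ ≤ ∑ j : Fin J, S₁ := by
          refine Finset.sum_le_sum fun j _ => ?_
          rw [integral_sub (hemp _ _).1 (integrable_const _)]
          have h := (hemp (D j).1 (noisyValues T.f D j)).2
          have h2 : ‖T.f (D j).1 - noisyValues T.f D j‖ ^ 2 = (D j).2 ^ 2 := by
            simp [noisyValues]
          rw [h2] at h
          simp only [integral_const, probReal_univ, one_smul]
          linarith
      _ = J * S₁ := by simp
  have hsum_int : Integrable (fun ω : ι → Fin d → ℤ => ∑ k, ‖W k (ω k)‖ ^ 2)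
      (Measure.pi fun k => (Q k).toMeasure) := (memLp_two_sum_pi hc4).integrable one_le_two
  have hsum : ∫ ω : ι → Fin d → ℤ, ∑ k, ‖W k (ω k)‖ ^ 2 ∂(Measure.pi fun k => (Q k).toMeasure)
      = S₁ := by
    rw [integral_finsetSum _ fun k _ => ?_]
    · exact Finset.sum_congr rfl fun k _ => integral_comp_eval
        (P := fun k => (Q k).toMeasure) (hc4 k).1
    · exact ((hc4 k).comp_measurePreserving
        (measurePreserving_eval (fun k => (Q k).toMeasure) k)).integrable one_le_two
  have hsq_int : Integrable (fun ω : ι → Fin d → ℤ => (∑ k, ‖W k (ω k)‖ ^ 2) ^ 2)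
      (Measure.pi fun k => (Q k).toMeasure) := (memLp_two_sum_pi hc4).integrable_sq
  have hsq : ∫ ω : ι → Fin d → ℤ, (∑ k, ‖W k (ω k)‖ ^ 2) ^ 2
      ∂(Measure.pi fun k => (Q k).toMeasure) ≤ S₁ ^ 2 + S₂ := by
    have := integral_sq_sum_sub_le_real hc4 0
    simpa only [sub_zero, ← pow_mul] using this
  have h12 : Integrable (fun ω : ι → Fin d → ℤ => T.excess D (network T.L ω fun k => W k (ω k))
      + l₁ * ∑ k, ‖W k (ω k)‖ ^ 2) (Measure.pi fun k => (Q k).toMeasure) :=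
    hexc_int.add (hsum_int.const_mul _)
  refine ⟨h12.add (hsq_int.const_mul _), ?_⟩
  unfold regExcess approxBound
  rw [integral_add h12 (hsq_int.const_mul _), integral_add hexc_int (hsum_int.const_mul _),
    integral_const_mul, integral_const_mul, hsum]
  have := mul_le_mul_of_nonneg_left hsq hl₂
  linarith

open Classical in
/-- The expected gap terms for frequencies sampled independently from the distributions `Q k`. -/
noncomputable def expGap (A : Finset (Fin d → ℤ)) (Q : ι → PMF (Fin d → ℤ)) (τ l₁ l₂ : ℝ) : ℝ≥0∞ :=
  ENNReal.ofReal (4 * T.β / τ * T.linInner A D)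
    + ENNReal.ofReal (8 * T.β ^ 2 / (τ ^ 2 * l₂) * (A.card * Fintype.card ι))
      * (∑ n ∈ A, ∑ k, ∫⁻ m, (if m ∈ A then 0 else ENNReal.ofReal (‖T.γ D (n - m)‖ ^ 4))
          ∂(Q k).toMeasure)
    + ENNReal.ofReal (1 / (2 * l₂))
      * (∑ k, ∑ l, ∫⁻ n, ∫⁻ m, (if n ∈ A ∨ m ∈ A then 0 else
          ENNReal.ofReal (‖T.γ D (n - m)‖ ^ 2)) ∂(Q l).toMeasure ∂(Q k).toMeasure)
    + ENNReal.ofReal (2 / l₁)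
      * (∑ k, ∫⁻ n, (if n ∈ A then 0 else ENNReal.ofReal (‖T.lin A D n‖ ^ 2)) ∂(Q k).toMeasure)
    + ENNReal.ofReal ‖T.sqGap A D‖

theorem γ_zero (hJ : 0 < J) : T.γ D 0 = 0 := by
  simp only [γ, mode_zero]
  exact gap_one hJ D

/-- `gapCross` enters squared; Cauchy-Schwarz replaces it by a sum of fourth powers times the number
of terms, so that only marginal laws are needed. -/
theorem lintegral_gapTotal_le (hJ : 0 < J) (A : Finset (Fin d → ℤ)) (Q : ι → PMF (Fin d → ℤ))
    {τ l₁ l₂ : ℝ} (hτ : 0 < τ) (hl₁ : 0 < l₁) (hl₂ : 0 < l₂) :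
    ∫⁻ ω, ENNReal.ofReal (T.gapTotal A D ω τ l₁ l₂) ∂(Measure.pi fun k => (Q k).toMeasure)
      ≤ T.expGap D A Q τ l₁ l₂ := by
  classical
  have hβ := T.β_pos
  have hcross : ∀ ω : ι → Fin d → ℤ, ENNReal.ofReal (T.gapCross A D ω ^ 2)
      ≤ ENNReal.ofReal (A.card * Fintype.card ι) * ∑ n ∈ A, ∑ k,
        (if ω k ∈ A then 0 else ENNReal.ofReal (‖T.γ D (n - ω k)‖ ^ 4)) := by
    intro ω
    have h1 : T.gapCross A D ω ^ 2 ≤ (A.card * Fintype.card ι) * ∑ n ∈ A, ∑ k,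
        (if ω k ∈ A then 0 else ‖T.γ D (n - ω k)‖ ^ 4) := by
      have h := sq_sum_le_card_mul_sum_sq (s := A ×ˢ (Finset.univ : Finset ι))
        (f := fun p => if ω p.2 ∈ A then 0 else ‖T.γ D (p.1 - ω p.2)‖ ^ 2)
      rw [Finset.sum_product, Finset.sum_product, Finset.card_product, Finset.card_univ] at h
      push_cast at h
      refine h.trans (le_of_eq ?_)
      congr 1
      refine Finset.sum_congr rfl fun n _ => Finset.sum_congr rfl fun k _ => ?_
      by_cases h : ω k ∈ A <;> simp [h, ← pow_mul]
    refine (ENNReal.ofReal_le_ofReal h1).trans (le_of_eq ?_)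
    have h0 : ∀ n k, 0 ≤ (if ω k ∈ A then 0 else ‖T.γ D (n - ω k)‖ ^ 4) := fun n k => by
      split_ifs <;> positivity
    rw [ENNReal.ofReal_mul (by positivity), ENNReal.ofReal_sum_of_nonneg
      fun n _ => Finset.sum_nonneg fun k _ => h0 n k]
    congr 1
    refine Finset.sum_congr rfl fun n _ => ?_
    rw [ENNReal.ofReal_sum_of_nonneg fun k _ => h0 n k]
    refine Finset.sum_congr rfl fun k _ => ?_
    split_ifs <;> simp
  have houter : ∀ ω : ι → Fin d → ℤ, ENNReal.ofReal (T.gapOuter A D ω)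
      = ∑ k, ∑ l, (if ω k ∈ A ∨ ω l ∈ A then 0 else
          ENNReal.ofReal (‖T.γ D (ω k - ω l)‖ ^ 2)) := by
    intro ω
    have h0 : ∀ k l, 0 ≤ (if ω k ∈ A ∨ ω l ∈ A then 0 else ‖T.γ D (ω k - ω l)‖ ^ 2) :=
      fun k l => by split_ifs <;> positivity
    rw [gapOuter, ENNReal.ofReal_sum_of_nonneg fun k _ => Finset.sum_nonneg fun l _ => h0 k l]
    refine Finset.sum_congr rfl fun k _ => ?_
    rw [ENNReal.ofReal_sum_of_nonneg fun l _ => h0 k l]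
    refine Finset.sum_congr rfl fun l _ => ?_
    split_ifs <;> simp
  have hlin : ∀ ω : ι → Fin d → ℤ, ENNReal.ofReal (T.linOuter A D ω)
      = ∑ k, (if ω k ∈ A then 0 else ENNReal.ofReal (‖T.lin A D (ω k)‖ ^ 2)) := by
    intro ω
    rw [linOuter, ENNReal.ofReal_sum_of_nonneg fun k _ => by split_ifs <;> positivity]
    refine Finset.sum_congr rfl fun k _ => ?_
    split_ifs <;> simp
  have hpt : ∀ ω : ι → Fin d → ℤ, ENNReal.ofReal (T.gapTotal A D ω τ l₁ l₂)
      ≤ ENNReal.ofReal (4 * T.β / τ * T.linInner A D)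
        + ENNReal.ofReal (8 * T.β ^ 2 / (τ ^ 2 * l₂) * (A.card * Fintype.card ι))
          * (∑ n ∈ A, ∑ k, (if ω k ∈ A then 0 else ENNReal.ofReal (‖T.γ D (n - ω k)‖ ^ 4)))
        + ENNReal.ofReal (1 / (2 * l₂)) * (∑ k, ∑ l, (if ω k ∈ A ∨ ω l ∈ A then 0 else
          ENNReal.ofReal (‖T.γ D (ω k - ω l)‖ ^ 2)))
        + ENNReal.ofReal (2 / l₁)
          * (∑ k, (if ω k ∈ A then 0 else ENNReal.ofReal (‖T.lin A D (ω k)‖ ^ 2)))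
        + ENNReal.ofReal ‖T.sqGap A D‖ := by
    intro ω
    unfold gapTotal
    refine ENNReal.ofReal_add_le.trans (add_le_add_left ?_ _)
    refine ENNReal.ofReal_add_le.trans (add_le_add ?_ ?_)
    · refine ENNReal.ofReal_add_le.trans (add_le_add ?_ ?_)
      · refine ENNReal.ofReal_add_le.trans (add_le_add le_rfl ?_)
        rw [ENNReal.ofReal_mul (by positivity), ENNReal.ofReal_mul (by positivity), mul_assoc]
        gcongr
        exact hcross ω
      · rw [ENNReal.ofReal_mul (by positivity), houter ω]
    · rw [ENNReal.ofReal_mul (by positivity), hlin ω]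
  refine (lintegral_mono hpt).trans ?_
  have hmeas : ∀ F : (ι → Fin d → ℤ) → ℝ≥0∞, Measurable F := fun F => Measurable.of_discrete
  rw [lintegral_add_left (hmeas _), lintegral_add_left (hmeas _), lintegral_add_left (hmeas _),
    lintegral_add_left (hmeas _), lintegral_const_mul _ (hmeas _), lintegral_const_mul _ (hmeas _),
    lintegral_const_mul _ (hmeas _), lintegral_const, lintegral_const, measure_univ, mul_one,
    mul_one]
  unfold expGap
  gcongr
  · rw [lintegral_finsetSum _ fun n _ => hmeas _]
    refine Finset.sum_le_sum fun n _ => ?_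
    rw [lintegral_finsetSum _ fun k _ => hmeas _]
    refine Finset.sum_le_sum fun k _ => ?_
    exact (lintegral_pi_eval (fun k => (Q k).toMeasure) k
      (φ := fun m => if m ∈ A then 0 else ENNReal.ofReal (‖T.γ D (n - m)‖ ^ 4))
      Measurable.of_discrete).le
  · rw [lintegral_finsetSum _ fun n _ => hmeas _]
    refine Finset.sum_le_sum fun k _ => ?_
    rw [lintegral_finsetSum _ fun k _ => hmeas _]
    refine Finset.sum_le_sum fun l _ => ?_
    -- Diagonal terms are not independent pairs, but they are gaps of the constant mode and vanish.
    by_cases hkl : k = l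
    · subst hkl
      simp [T.γ_zero D hJ]
    · exact (lintegral_pi_eval_pair (fun k => (Q k).toMeasure) hkl
        (φ := fun n m => if n ∈ A ∨ m ∈ A then 0 else ENNReal.ofReal (‖T.γ D (n - m)‖ ^ 2))
        Measurable.of_discrete).le
  · rw [lintegral_finsetSum _ fun n _ => hmeas _]
    refine Finset.sum_le_sum fun k _ => ?_
    exact (lintegral_pi_eval (fun k => (Q k).toMeasure) k
      (φ := fun m => if m ∈ A then 0 else ENNReal.ofReal (‖T.lin A D m‖ ^ 2))
      Measurable.of_discrete).le

/-- The expected bound for the risk of the minimizer over independently sampled frequencies. -/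
theorem lintegral_regExcess_add_gapTotal_le (hJ : 0 < J) (A : Finset (Fin d → ℤ))
    {τ l₁ l₂ : ℝ} (hτ : 0 < τ) (hτ1 : τ ≤ 1) (hl₁ : 0 < l₁) (hl₂ : 0 < l₂)
    (hA : T.β * Real.sqrt (T.gapInner A D) ≤ τ / 4)
    (hW : ∀ k n, ‖W k n‖ ≤ c)
    (hunb : ∀ x, ∑ k, ∫ n, W k n * mode T.L n x ∂(Q k).toMeasure = T.f x) :
    ∫⁻ ω, ENNReal.ofReal (T.regExcess D l₁ l₂ W ω + T.gapTotal A D ω τ l₁ l₂)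
        ∂(Measure.pi fun k => (Q k).toMeasure)
      ≤ ENNReal.ofReal (approxBound l₁ l₂ (∑ k, ∫ n, ‖W k n‖ ^ 2 ∂(Q k).toMeasure)
        (∑ k, ∫ n, ‖W k n‖ ^ 4 ∂(Q k).toMeasure)) + T.expGap D A Q τ l₁ l₂ := by
  obtain ⟨h1, h2⟩ := T.integral_regExcess_le D (l₁ := l₁) hJ hl₂.le hW hunb
  refine (lintegral_ofReal_add_le h1 Measurable.of_discrete
    (fun ω => T.gapTotal_nonneg A D ω hτ hl₁ hl₂) fun ω => ?_).trans
    (add_le_add (ENNReal.ofReal_le_ofReal h2) (T.lintegral_gapTotal_le D hJ A Q hτ hl₁ hl₂))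
  -- The sum is nonnegative because it bounds the nonnegative risk and penalty of the minimizer.
  have h := T.risk_amplitudes_le A D ω hl₁ hl₂ hτ hA fun k => W k (ω k)
  refine le_trans ?_ h
  have := T.risk_nonneg (network T.L ω
    (amplitudes T.L l₁ l₂ ω (fun j => (D j).1) (noisyValues T.f D)))
  have h3 : 0 ≤ 1 - 3 * τ / 4 := by linarith
  positivity

end ConditionalRisk

end Target

end RFF

open MeasureTheory ProbabilityTheory
open scoped ENNReal ComplexConjugate

namespace RFF

/-! ### The two independent samples of the second stage as one product law. -/

section NestedSampling

variable {d : ℕ}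

theorem lintegral_freqLaw_freqLaw (p r : PMF (Fin d → ℤ)) (m n : ℕ)
    (F : (Fin m ⊕ Fin n → Fin d → ℤ) → ℝ≥0∞) :
    ∫⁻ ν, ∫⁻ ν', F (Sum.elim ν ν') ∂(freqLaw p n) ∂(freqLaw r m)
      = ∫⁻ ω, F ω ∂(Measure.pi fun k => (Sum.elim (fun _ => r) (fun _ => p) k : PMF _).toMeasure) := by
  have h := measurePreserving_sumPiEquivProdPi_symm (X := fun _ : Fin m ⊕ Fin n => Fin d → ℤ)
    (fun k => (Sum.elim (fun _ => r) (fun _ => p) k : PMF _).toMeasure)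
  rw [← h.lintegral_comp Measurable.of_discrete, lintegral_prod _ Measurable.of_discrete.aemeasurable]
  refine lintegral_congr fun ν => lintegral_congr fun ν' => ?_
  congr 1
theorem lintegral_enorm_sq_eq {Ω : Type*} [MeasurableSpace Ω] {m : Measure Ω} {g : Ω → ℂ}
    (hg : MemLp g 2 m) : ∫⁻ z, ‖g z‖ₑ ^ 2 ∂m = ENNReal.ofReal (∫ z, ‖g z‖ ^ 2 ∂m) := by
  rw [ofReal_integral_eq_lintegral_ofReal (hg.integrable_norm_pow two_ne_zero)
    (Filter.Eventually.of_forall fun _ => by positivity)]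
  refine lintegral_congr fun z => ?_
  rw [ENNReal.ofReal_pow (norm_nonneg _), ofReal_norm]

end NestedSampling

/-! ### Importance weights on a set of modes and their moments. -/

section ImportanceWeights

variable {Λ : Type}

open Classical in
/-- The amplitudes `aₙ / (M r(n))` on a set `E` of modes. -/
noncomputable def impWeight (a : Λ → ℂ) (r : PMF Λ) (E : Set Λ) (M : ℝ) (n : Λ) : ℂ :=
  if n ∈ E then a n / (M * (r n).toReal : ℝ) else 0

variable {a : Λ → ℂ} {r : PMF Λ} {E : Set Λ} {M c : ℝ}

/-- Division by r(n) = 0 yields the default value 0, which is harmless because the coefficient is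
then zero as well. -/
theorem toReal_mul_impWeight (hM : 0 < M) (hr : ∀ n ∈ E, r n = 0 → a n = 0) (n : Λ) :
    ((r n).toReal : ℂ) * (M * impWeight a r E M n) = E.indicator a n := by
  classical
  by_cases hn : n ∈ E
  · rw [Set.indicator_of_mem hn, impWeight, if_pos hn]
    by_cases h0 : r n = 0
    · simp [h0, hr n hn h0]
    · have h1 : ((r n).toReal : ℂ) ≠ 0 := by
        exact_mod_cast (ENNReal.toReal_ne_zero.2 ⟨h0, r.apply_ne_top n⟩)
      have h2 : (M : ℂ) ≠ 0 := by exact_mod_cast hM.ne'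
      push_cast
      field_simp
  · rw [Set.indicator_of_notMem hn, impWeight, if_neg hn]
    simp

theorem norm_impWeight_le {C : ℝ} (hM : 0 < M) (hC : 0 ≤ C)
    (h : ∀ n ∈ E, ‖a n‖ ≤ C * (r n).toReal) (n : Λ) : ‖impWeight a r E M n‖ ≤ C / M := by
  classical
  rw [impWeight]
  split_ifs with hn
  · rw [norm_div, Complex.norm_real, Real.norm_of_nonneg (by positivity)]
    refine div_le_of_le_mul₀ (by positivity) (by positivity) ?_
    calc ‖a n‖ ≤ C * (r n).toReal := h n hn
      _ = C / M * (M * (r n).toReal) := by field_simp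
  · simp only [norm_zero]
    positivity

variable [Countable Λ] [MeasurableSpace Λ] [MeasurableSingletonClass Λ]

theorem integrable_of_norm_le {m : Measure Λ} [IsFiniteMeasure m] {F : Type*}
    [NormedAddCommGroup F] {g : Λ → F} {c : ℝ} (hg : ∀ n, ‖g n‖ ≤ c) : Integrable g m :=
  Integrable.of_bound (StronglyMeasurable.of_discrete).aestronglyMeasurable c
    (Filter.Eventually.of_forall hg)

theorem integral_impWeight_mul (hM : 0 < M) (hr : ∀ n ∈ E, r n = 0 → a n = 0)
    (hc : ∀ n, ‖impWeight a r E M n‖ ≤ c) {g : Λ → ℂ} (hg : ∀ n, ‖g n‖ = 1) :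
    M * ∫ n, impWeight a r E M n * g n ∂r.toMeasure = ∑' n, E.indicator (fun n => a n * g n) n := by
  rw [PMF.integral_eq_tsum _ _ (integrable_of_norm_le (c := c) fun n => by
    rw [norm_mul, hg, mul_one]; exact hc n), ← tsum_mul_left]
  refine tsum_congr fun n => ?_
  have h := toReal_mul_impWeight hM hr n
  have h2 : E.indicator (fun n => a n * g n) n = E.indicator a n * g n := by
    by_cases hn : n ∈ E <;> simp [hn]
  rw [h2, ← h, Complex.real_smul]
  ring

theorem integral_norm_impWeight (hM : 0 < M) (hr : ∀ n ∈ E, r n = 0 → a n = 0)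
    (hc : ∀ n, ‖impWeight a r E M n‖ ≤ c) :
    M * ∫ n, ‖impWeight a r E M n‖ ∂r.toMeasure = ∑' n, E.indicator (fun n => ‖a n‖) n := by
  rw [PMF.integral_eq_tsum _ _ (integrable_of_norm_le (c := c) fun n => by
    rw [norm_norm]; exact hc n), ← tsum_mul_left]
  refine tsum_congr fun n => ?_
  have h := congrArg norm (toReal_mul_impWeight hM hr n)
  rw [norm_mul, norm_mul, Complex.norm_real, Complex.norm_real, Real.norm_of_nonneg (by positivity),
    Real.norm_of_nonneg hM.le, norm_indicator_eq_indicator_norm] at h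
  rw [← h, smul_eq_mul]
  ring

/-- All but one of the factors are bounded by c, and the first moment is the coefficient mass on E.
The cases j = 1 and j = 3 give the second and fourth moments. -/
theorem integral_norm_impWeight_pow_le (hM : 0 < M) (hr : ∀ n ∈ E, r n = 0 → a n = 0)
    (hc : ∀ n, ‖impWeight a r E M n‖ ≤ c) (j : ℕ) :
    M * ∫ n, ‖impWeight a r E M n‖ ^ (j + 1) ∂r.toMeasure
      ≤ c ^ j * ∑' n, E.indicator (fun n => ‖a n‖) n := by
  rw [← integral_norm_impWeight hM hr hc, mul_left_comm]
  refine mul_le_mul_of_nonneg_left ?_ hM.le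
  rw [← integral_const_mul]
  refine integral_mono (integrable_of_norm_le (c := c ^ (j + 1)) fun n => ?_)
    (integrable_of_norm_le (c := c ^ j * c) fun n => ?_) fun n => ?_
  · rw [norm_pow, norm_norm]
    exact pow_le_pow_left₀ (norm_nonneg _) (hc n) _
  · have hc0 : 0 ≤ c := (norm_nonneg _).trans (hc n)
    rw [norm_mul, norm_norm, Real.norm_of_nonneg (by positivity)]
    exact mul_le_mul_of_nonneg_left (hc n) (by positivity)
  · change ‖impWeight a r E M n‖ ^ (j + 1) ≤ c ^ j * ‖impWeight a r E M n‖
    rw [pow_succ]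
    gcongr
    exact hc n

end ImportanceWeights

/-! ### The resampling law: a crude bound in general, near optimality for accurate amplitudes. -/

section Resampling

variable {d : ℕ} {p : PMF (Fin d → ℤ)} {ε : ℝ} {ι : Type} [Fintype ι] (ν : ι → Fin d → ℤ)
  (v : ι → ℂ)

/-- Cauchy-Schwarz with the multiplicity of n in the sample. A mode that passes the cutoff thus has
multiplicity times ∑|v|² at least ε², which is how the empirical law dominates the resampling law.
-/
theorem norm_collected_sq_le (n : Fin d → ℤ) :
    ‖collected ν v n‖ ^ 2 ≤ (∑ k, if ν k = n then 1 else 0) * ∑ k, ‖v k‖ ^ 2 := by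
  have h := norm_sum_mul_le Finset.univ (fun k => v k) (fun k => if ν k = n then (1 : ℂ) else 0)
  have h1 : collected ν v n = ∑ k, v k * (if ν k = n then (1 : ℂ) else 0) := by
    simp [collected]
  have h2 : ∑ k, ‖(if ν k = n then (1 : ℂ) else 0)‖ ^ 2 = ∑ k, if ν k = n then (1 : ℝ) else 0 := by
    refine Finset.sum_congr rfl fun k _ => ?_
    split_ifs <;> simp
  rw [h1]
  refine (pow_le_pow_left₀ (norm_nonneg _) h 2).trans (le_of_eq ?_)
  rw [mul_pow, Real.sq_sqrt (Finset.sum_nonneg fun _ _ => by positivity),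
    Real.sq_sqrt (Finset.sum_nonneg fun _ _ => by positivity), h2, mul_comm]

theorem resampleDist_le (b : (Fin d → ℤ) → ℂ) (n : Fin d → ℤ) :
    resampleDist p ε b n ≤ p n + (if ε ≤ ‖b n‖ then 1 else 0) := by
  unfold resampleDist
  split_ifs with h h1 h1
  · exact (PMF.coe_le_one _ n).trans le_add_self
  · rw [PMF.normalize_apply]
    simp [keptWeight, h1]
  · exact le_self_add
  · exact le_self_add

/-- The resampling distribution is dominated by the initial one and the empirical distribution of
the initial frequencies. -/
theorem resampleDist_toMeasure_le (hε : 0 < ε) :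
    (resampleDist p ε (collected ν v)).toMeasure
      ≤ p.toMeasure + ENNReal.ofReal ((∑ k, ‖v k‖ ^ 2) / ε ^ 2) • ∑ k, Measure.dirac (ν k) := by
  classical
  have hsing : ∀ n, (resampleDist p ε (collected ν v)).toMeasure {n}
      ≤ (p.toMeasure + ENNReal.ofReal ((∑ k, ‖v k‖ ^ 2) / ε ^ 2) • ∑ k, Measure.dirac (ν k)) {n} := by
    intro n
    rw [PMF.toMeasure_apply_singleton _ _ (measurableSet_singleton n), Measure.add_apply,
      PMF.toMeasure_apply_singleton _ _ (measurableSet_singleton n)]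
    refine (resampleDist_le _ n).trans (add_le_add_right ?_ _)
    split_ifs with h
    · rw [Measure.smul_apply, Measure.finsetSum_apply]
      have h1 : ∑ k, Measure.dirac (ν k) ({n} : Set (Fin d → ℤ))
          = ENNReal.ofReal (∑ k, if ν k = n then 1 else 0) := by
        rw [ENNReal.ofReal_sum_of_nonneg fun k _ => by split_ifs <;> positivity]
        refine Finset.sum_congr rfl fun k _ => ?_
        rw [Measure.dirac_apply' _ (measurableSet_singleton n)]
        by_cases hk : ν k = n <;> simp [hk]
      have hs : 0 ≤ ∑ k, ‖v k‖ ^ 2 := Finset.sum_nonneg fun _ _ => by positivity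
      rw [h1, smul_eq_mul, ← ENNReal.ofReal_mul (by positivity), ENNReal.one_le_ofReal]
      have h2 : ε ^ 2 ≤ (∑ k, if ν k = n then 1 else 0) * ∑ k, ‖v k‖ ^ 2 :=
        (pow_le_pow_left₀ hε.le h 2).trans (norm_collected_sq_le ν v n)
      rw [div_mul_eq_mul_div, one_le_div (by positivity), mul_comm]
      exact h2
    · exact zero_le
  refine Measure.le_iff.2 fun s _ => ?_
  rw [← Measure.tsum_indicator_apply_singleton _ s s.to_countable.measurableSet,
    ← Measure.tsum_indicator_apply_singleton
      (p.toMeasure + ENNReal.ofReal ((∑ k, ‖v k‖ ^ 2) / ε ^ 2) • ∑ k, Measure.dirac (ν k)) s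
      s.to_countable.measurableSet]
  exact ENNReal.tsum_le_tsum fun n => Set.indicator_le_indicator (hsing n)

/-- The resampling distribution when the amplitudes are close to the coefficients `a`. -/
theorem resampleDist_of_close {a b : (Fin d → ℤ) → ℂ} {c : ℝ} (hε : 0 < ε) (hc0 : 0 ≤ c)
    (hc : c ≤ 1 / 2) (ha : Summable fun n => ‖a n‖) (hclose : ∀ n, ‖b n - a n‖ ≤ c * ε)
    (hbig : ∃ n, 2 * ε ≤ ‖a n‖) :
    (∀ n, ‖b n‖ < ε → resampleDist p ε b n = 0) ∧
    ∀ n, ε ≤ ‖b n‖ → resampleDist p ε b n ≠ 0 ∧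
      ‖a n‖ ≤ (1 + c) / (1 - c) * (∑' n, ‖a n‖) * (resampleDist p ε b n).toReal := by
  have hab : ∀ n, ‖b n‖ ≤ ‖a n‖ + c * ε := fun n => by
    have := norm_add_le (a n) (b n - a n)
    rw [add_sub_cancel] at this
    linarith [hclose n]
  have hba : ∀ n, ‖a n‖ ≤ ‖b n‖ + c * ε := fun n => by
    have := norm_sub_le (b n) (b n - a n)
    rw [sub_sub_cancel] at this
    linarith [hclose n]
  have hkw : ∀ n, keptWeight ε b n ≤ ENNReal.ofReal (‖a n‖ / (1 - c)) := by
    intro n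
    rw [keptWeight]
    split_ifs with h
    -- A kept mode has ε ≤ |b|, so |b| ≤ |a| + cε ≤ |a| + c|b|.
    · refine ENNReal.ofReal_le_ofReal ?_
      rw [le_div_iff₀ (by linarith)]
      nlinarith [hab n]
    · exact zero_le
  have hsum : ∑' n, keptWeight ε b n ≤ ENNReal.ofReal ((∑' n, ‖a n‖) / (1 - c)) := by
    refine (ENNReal.tsum_le_tsum hkw).trans (le_of_eq ?_)
    have h1 : 0 < 1 - c := by linarith
    rw [← ENNReal.ofReal_tsum_of_nonneg (fun n => by positivity) (ha.div_const _), tsum_div_const]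
  have hfin : ∑' n, keptWeight ε b n ≠ ∞ := (hsum.trans_lt ENNReal.ofReal_lt_top).ne
  have hne : ∑' n, keptWeight ε b n ≠ 0 := by
    -- This mode survives the cutoff since |b| ≥ 2ε - cε ≥ ε; hence the normalization is not zero.
    obtain ⟨n, hn⟩ := hbig
    intro h0
    have h1 := ENNReal.tsum_eq_zero.1 h0 n
    have h2 : ε ≤ ‖b n‖ := by nlinarith [hba n]
    rw [keptWeight, if_pos h2, ENNReal.ofReal_eq_zero] at h1
    linarith
  have hres : ∀ n, resampleDist p ε b n = keptWeight ε b n * (∑' n, keptWeight ε b n)⁻¹ := by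
    intro n
    rw [resampleDist, dif_pos ⟨hne, hfin⟩, PMF.normalize_apply]
  refine ⟨fun n hn => ?_, fun n hn => ?_⟩
  · rw [hres, keptWeight, if_neg (not_le.2 hn), zero_mul]
  · have hb : 0 < ‖b n‖ := hε.trans_le hn
    have hkn : keptWeight ε b n = ENNReal.ofReal ‖b n‖ := by rw [keptWeight, if_pos hn]
    constructor
    · rw [hres, hkn]
      exact mul_ne_zero (by simpa using hb.ne') (ENNReal.inv_ne_zero.2 hfin)
    · rw [hres, hkn, ENNReal.toReal_mul, ENNReal.toReal_ofReal hb.le, ENNReal.toReal_inv]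
      set Z := (∑' n, keptWeight ε b n).toReal
      have hZ0 : 0 < Z := ENNReal.toReal_pos hne hfin
      have h1 : 0 < 1 - c := by linarith
      have hZ : Z ≤ (∑' n, ‖a n‖) / (1 - c) := by
        refine ENNReal.toReal_le_of_le_ofReal ?_ hsum
        exact div_nonneg (tsum_nonneg fun _ => norm_nonneg _) h1.le
      have h2 : ‖a n‖ ≤ (1 + c) * ‖b n‖ := by nlinarith [hba n]
      calc ‖a n‖ ≤ (1 + c) * ‖b n‖ := h2
        _ = (1 + c) * Z * (‖b n‖ * Z⁻¹) := by field_simp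
        _ ≤ (1 + c) * ((∑' n, ‖a n‖) / (1 - c)) * (‖b n‖ * Z⁻¹) := by gcongr
        _ = _ := by ring

end Resampling

end RFF

/-! ### Second and higher moments of the gap terms. -/

open MeasureTheory ProbabilityTheory
open scoped ENNReal ComplexConjugate

namespace RFF

/-- Thresholding: values up to t are kept, and larger ones are paid for by a high moment. -/
theorem self_le_add_pow_div {u t : ℝ} (hu : 0 ≤ u) (ht : 0 < t) (m : ℕ) :
    u ≤ t + u ^ (m + 1) / t ^ m := by
  rcases le_total u t with h | h
  · have : 0 ≤ u ^ (m + 1) / t ^ m := by positivity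
    linarith
  · have h1 : u * t ^ m ≤ u ^ (m + 1) := by
      rw [pow_succ, mul_comm]
      gcongr
    have h2 : u ≤ u ^ (m + 1) / t ^ m := by rwa [le_div_iff₀ (by positivity)]
    linarith

namespace Target

variable {d : ℕ} (T : Target d)

/-- A bound for the second moments of the residual. -/
noncomputable def V : ℝ := 2 * T.S ^ 2 + 8 * T.s ^ 2

theorem V_nonneg : 0 ≤ T.V := by
  unfold V
  positivity

theorem integrable_noise_sq : Integrable (fun z : (Fin d → ℝ) × ℝ => z.2 ^ 2) T.P :=
  T.memLp_noise_snd.integrable_sq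

theorem integral_const_add_noise_sq (a b : ℝ) :
    ∫ z : (Fin d → ℝ) × ℝ, (a + b * z.2 ^ 2) ∂T.P = a + b * T.s ^ 2 := by
  rw [integral_add (integrable_const _) (T.integrable_noise_sq.const_mul _), integral_const_mul,
    T.integral_noise_sq]
  simp

theorem integrable_const_add_noise_sq (a b : ℝ) :
    Integrable (fun z : (Fin d → ℝ) × ℝ => a + b * z.2 ^ 2) T.P :=
  (integrable_const _).add (T.integrable_noise_sq.const_mul _)

theorem norm_sq_resid_le (A : Finset (Fin d → ℤ)) (z : (Fin d → ℝ) × ℝ) :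
    ‖T.resid A z‖ ^ 2 ≤ 2 * T.S ^ 2 + 2 * z.2 ^ 2 := by
  have h1 : ‖T.resid A z‖ ≤ T.S + |z.2| := by
    rw [resid_eq]
    refine (norm_add_le _ _).trans (add_le_add (T.norm_rest_le_S A z.1) ?_)
    rw [Complex.norm_real, Real.norm_eq_abs]
  calc ‖T.resid A z‖ ^ 2 ≤ (T.S + |z.2|) ^ 2 := by gcongr
    _ ≤ 2 * T.S ^ 2 + 2 * |z.2| ^ 2 := by nlinarith [sq_nonneg (T.S - |z.2|)]
    _ = _ := by rw [sq_abs]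

theorem integral_norm_sq_resid_le (A : Finset (Fin d → ℤ)) :
    ∫ z, ‖T.resid A z‖ ^ 2 ∂T.P ≤ T.V := by
  have h := integral_mono ((T.memLp_resid A).integrable_norm_pow two_ne_zero)
    (T.integrable_const_add_noise_sq _ _) (T.norm_sq_resid_le A)
  refine h.trans ?_
  rw [integral_const_add_noise_sq, V]
  nlinarith [sq_nonneg T.s]

theorem measurable_γ {J : ℕ} (n : Fin d → ℤ) :
    Measurable fun D : Fin J → (Fin d → ℝ) × ℝ => T.γ D n := measurable_gap (measurable_mode_fst n)

theorem measurable_lin {J : ℕ} (A : Finset (Fin d → ℤ)) (n : Fin d → ℤ) :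
    Measurable fun D : Fin J → (Fin d → ℝ) × ℝ => T.lin A D n :=
  measurable_gap ((measurable_mode_fst n).mul
    (Complex.continuous_conj.measurable.comp (T.measurable_resid A)))

theorem measurable_sqGap {J : ℕ} (A : Finset (Fin d → ℤ)) :
    Measurable fun D : Fin J → (Fin d → ℝ) × ℝ => T.sqGap A D := by
  have := T.measurable_resid A
  exact measurable_gap (by fun_prop)

theorem measurable_gapInner {J : ℕ} (A : Finset (Fin d → ℤ)) :
    Measurable fun D : Fin J → (Fin d → ℝ) × ℝ => T.gapInner A D :=
  Finset.measurable_fun_sum _ fun _ _ => Finset.measurable_fun_sum _ fun _ _ =>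
    (T.measurable_γ _).norm.pow_const 2

section Moments

variable {J : ℕ} (hJ : 0 < J)

include hJ

theorem lintegral_γ_sq_le (n : Fin d → ℤ) :
    ∫⁻ D, ENNReal.ofReal (‖T.γ D n‖ ^ 2) ∂(dataLaw T.μ T.N J) ≤ ENNReal.ofReal (1 / J) := by
  have hb : ∀ z : (Fin d → ℝ) × ℝ, ‖mode T.L n z.1‖ ≤ 1 := fun z => by rw [norm_mode]
  refine (lintegral_norm_gap_sq_le hJ (P := T.P)
    (T.memLp_of_bounded (measurable_mode_fst n) hb)).trans (le_of_eq ?_)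
  simp only [norm_mode, one_pow, integral_const, probReal_univ, smul_eq_mul, mul_one]

theorem lintegral_γ_pow_le (n : Fin d → ℤ) (m : ℕ) :
    ∫⁻ D, ENNReal.ofReal ((J * ‖T.γ D n‖ ^ 2) ^ m) ∂(dataLaw T.μ T.N J)
      ≤ ENNReal.ofReal (momentConst m 1) := by
  refine lintegral_gap_pow_le hJ (P := T.P) (measurable_mode_fst n) (fun z => ?_) ?_ m
  · rw [norm_mode, one_mul, Real.one_le_sqrt]
    exact_mod_cast hJ
  · simp [norm_mode]

theorem lintegral_lin_sq_le (A : Finset (Fin d → ℤ)) (n : Fin d → ℤ) :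
    ∫⁻ D, ENNReal.ofReal (‖T.lin A D n‖ ^ 2) ∂(dataLaw T.μ T.N J) ≤ ENNReal.ofReal (T.V / J) := by
  have hm : MemLp (fun z => mode T.L n z.1 * conj (T.resid A z)) 2 T.P := by
    refine (T.memLp_resid A).of_le ((measurable_mode_fst n).mul (Complex.continuous_conj.measurable.comp
      (T.measurable_resid A))).aestronglyMeasurable (Filter.Eventually.of_forall fun z => ?_)
    rw [norm_mul, norm_mode, one_mul, RCLike.norm_conj]
  refine (lintegral_norm_gap_sq_le hJ hm).trans (ENNReal.ofReal_le_ofReal ?_)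
  gcongr
  simp only [norm_mul, norm_mode, one_mul, RCLike.norm_conj]
  exact T.integral_norm_sq_resid_le A

theorem lintegral_gapInner_le (A : Finset (Fin d → ℤ)) :
    ∫⁻ D, ENNReal.ofReal (T.gapInner A D) ∂(dataLaw T.μ T.N J)
      ≤ ENNReal.ofReal (A.card ^ 2 / J) := by
  have h1 : ∀ D : Fin J → (Fin d → ℝ) × ℝ, ENNReal.ofReal (T.gapInner A D)
      = ∑ n ∈ A, ∑ m ∈ A, ENNReal.ofReal (‖T.γ D (n - m)‖ ^ 2) := fun D => by
    rw [gapInner, ENNReal.ofReal_sum_of_nonneg fun _ _ => Finset.sum_nonneg fun _ _ => by positivity]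
    exact Finset.sum_congr rfl fun _ _ => ENNReal.ofReal_sum_of_nonneg fun _ _ => by positivity
  have hm : ∀ n, Measurable fun D : Fin J → (Fin d → ℝ) × ℝ => ENNReal.ofReal (‖T.γ D n‖ ^ 2) :=
    fun n => ((T.measurable_γ n).norm.pow_const 2).ennreal_ofReal
  simp only [h1]
  rw [lintegral_finsetSum _ fun n _ => Finset.measurable_fun_sum _ fun m _ => hm _]
  calc _ ≤ ∑ n ∈ A, ∑ m ∈ A, ENNReal.ofReal (1 / J) := by
        refine Finset.sum_le_sum fun n _ => ?_
        rw [lintegral_finsetSum _ fun m _ => hm _]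
        exact Finset.sum_le_sum fun m _ => T.lintegral_γ_sq_le hJ _
    _ = _ := by
        rw [Finset.sum_const, Finset.sum_const, nsmul_eq_mul, nsmul_eq_mul, ← ENNReal.ofReal_natCast,
          ← ENNReal.ofReal_mul (by positivity), ← ENNReal.ofReal_mul (by positivity)]
        congr 1
        ring

/-- Writing the residual as r + ξ, |r + ξ|² - ξ² = |r|² + 2 Re(r) ξ. One factor |r| ≤ t comes out,
and what remains needs only two moments of the noise. -/
theorem lintegral_sqGap_sq_le (A : Finset (Fin d → ℤ)) {t : ℝ}
    (hA : T.S - ∑ n ∈ A, ‖T.a n‖ ≤ t) :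
    ∫⁻ D, ENNReal.ofReal (‖T.sqGap A D‖ ^ 2) ∂(dataLaw T.μ T.N J)
      ≤ ENNReal.ofReal (t ^ 2 * T.V / J) := by
  have hb : ∀ z : (Fin d → ℝ) × ℝ, ‖((‖T.resid A z‖ ^ 2 - z.2 ^ 2 : ℝ) : ℂ)‖
      ≤ t * (T.S + 2 * |z.2|) := by
    intro z
    have h0 : 0 ≤ ‖T.rest A z.1‖ := norm_nonneg _
    have h1 := T.norm_rest_le A z.1
    have h2 := T.norm_rest_le_S A z.1
    have h3 : (‖T.resid A z‖ ^ 2 - z.2 ^ 2 : ℝ)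
        = ‖T.rest A z.1‖ ^ 2 + 2 * ((T.rest A z.1).re * z.2) := by
      rw [resid_eq]
      simp only [Complex.sq_norm, Complex.normSq_apply, Complex.add_re, Complex.add_im,
        Complex.ofReal_re, Complex.ofReal_im]
      ring
    rw [Complex.norm_real, Real.norm_eq_abs, h3]
    have h4 : |(T.rest A z.1).re| ≤ ‖T.rest A z.1‖ := Complex.abs_re_le_norm _
    calc _ ≤ |‖T.rest A z.1‖ ^ 2| + |2 * ((T.rest A z.1).re * z.2)| := abs_add_le _ _
      _ = ‖T.rest A z.1‖ * ‖T.rest A z.1‖ + 2 * (|(T.rest A z.1).re| * |z.2|) := by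
          rw [abs_mul, abs_mul, abs_of_nonneg (sq_nonneg _), abs_two]
          ring
      _ ≤ ‖T.rest A z.1‖ * T.S + 2 * (‖T.rest A z.1‖ * |z.2|) := by gcongr
      _ = ‖T.rest A z.1‖ * (T.S + 2 * |z.2|) := by ring
      _ ≤ _ := by
          have := T.S_pos
          gcongr
          linarith
  have hmeas : Measurable fun z : (Fin d → ℝ) × ℝ => ((‖T.resid A z‖ ^ 2 - z.2 ^ 2 : ℝ) : ℂ) := by
    have := T.measurable_resid A
    fun_prop
  have hm : MemLp (fun z : (Fin d → ℝ) × ℝ => ((‖T.resid A z‖ ^ 2 - z.2 ^ 2 : ℝ) : ℂ)) 2 T.P := by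
    have h1 : MemLp (fun z : (Fin d → ℝ) × ℝ => 2 * |z.2|) 2 T.P :=
      MemLp.const_mul T.memLp_noise_snd.abs 2
    have h2 : MemLp (fun z : (Fin d → ℝ) × ℝ => T.S + 2 * |z.2|) 2 T.P :=
      MemLp.add (memLp_const T.S) h1
    have h : MemLp (fun z : (Fin d → ℝ) × ℝ => t * (T.S + 2 * |z.2|)) 2 T.P := MemLp.const_mul h2 t
    exact h.mono' hmeas.aestronglyMeasurable (Filter.Eventually.of_forall hb)
  refine (lintegral_norm_gap_sq_le hJ hm).trans (ENNReal.ofReal_le_ofReal ?_)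
  gcongr
  have hi : Integrable (fun z : (Fin d → ℝ) × ℝ => t ^ 2 * (2 * T.S ^ 2 + 8 * z.2 ^ 2)) T.P :=
    (T.integrable_const_add_noise_sq _ _).const_mul _
  refine (integral_mono (hm.integrable_norm_pow two_ne_zero) hi fun z => ?_).trans (le_of_eq ?_)
  · calc _ ≤ (t * (T.S + 2 * |z.2|)) ^ 2 := pow_le_pow_left₀ (norm_nonneg _) (hb z) 2
      _ = t ^ 2 * (T.S + 2 * |z.2|) ^ 2 := by ring
      _ ≤ t ^ 2 * (2 * T.S ^ 2 + 8 * |z.2| ^ 2) := by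
          gcongr
          nlinarith [sq_nonneg (T.S - 2 * |z.2|)]
      _ = _ := by rw [sq_abs]
  · rw [integral_const_mul, integral_const_add_noise_sq, V]

/-- The threshold t/√J matches the size given by the second moment, so both contributions are of
that order. -/
theorem lintegral_sqGap_le (A : Finset (Fin d → ℤ)) {t : ℝ} (ht : 0 < t)
    (hA : T.S - ∑ n ∈ A, ‖T.a n‖ ≤ t) :
    ∫⁻ D, ENNReal.ofReal ‖T.sqGap A D‖ ∂(dataLaw T.μ T.N J)
      ≤ ENNReal.ofReal (t * (1 + T.V) / Real.sqrt J) := by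
  have hJr : (0 : ℝ) < J := by exact_mod_cast hJ
  have hs : 0 < Real.sqrt J := Real.sqrt_pos.2 hJr
  have hV := T.V_nonneg
  have : IsProbabilityMeasure (dataLaw T.μ T.N J) := by unfold dataLaw; infer_instance
  have hpt : ∀ D : Fin J → (Fin d → ℝ) × ℝ, ENNReal.ofReal ‖T.sqGap A D‖
      ≤ ENNReal.ofReal (t / Real.sqrt J)
        + ENNReal.ofReal (Real.sqrt J / t) * ENNReal.ofReal (‖T.sqGap A D‖ ^ 2) := by
    intro D
    rw [← ENNReal.ofReal_mul (by positivity), ← ENNReal.ofReal_add (by positivity) (by positivity)]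
    refine ENNReal.ofReal_le_ofReal ?_
    have := self_le_add_pow_div (norm_nonneg (T.sqGap A D)) (t := t / Real.sqrt J) (by positivity) 1
    refine this.trans (le_of_eq ?_)
    field_simp
  refine (lintegral_mono hpt).trans ?_
  rw [lintegral_add_left measurable_const, lintegral_const, measure_univ, mul_one,
    lintegral_const_mul' _ _ ENNReal.ofReal_ne_top]
  refine (add_le_add le_rfl (mul_le_mul' le_rfl (T.lintegral_sqGap_sq_le hJ A hA))).trans ?_
  rw [← ENNReal.ofReal_mul (by positivity), ← ENNReal.ofReal_add (by positivity) (by positivity)]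
  refine ENNReal.ofReal_le_ofReal (le_of_eq ?_)
  have : Real.sqrt J ^ 2 = J := Real.sq_sqrt hJr.le
  generalize Real.sqrt J = r at this hs
  rw [← this]
  field_simp

end Moments

/-! ### Truncation of the noise at height √J. -/

section HeavyNoise

/-- The second moment of the noise outside `[-t, t]`. -/
noncomputable def noiseTail (t : ℝ) : ℝ := ∫ ξ, (if t < |ξ| then ξ ^ 2 else 0) ∂T.N

theorem integrable_ite_noise (t : ℝ) : Integrable (fun ξ : ℝ => if t < |ξ| then ξ ^ 2 else 0) T.N := by
  refine T.memLp_noise.integrable_sq.mono ?_ (Filter.Eventually.of_forall fun ξ => ?_)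
  · exact (Measurable.ite (measurableSet_lt measurable_const measurable_id.abs)
      (measurable_id.pow_const 2) measurable_const).aestronglyMeasurable
  · split_ifs <;> simp [sq_nonneg]

theorem noiseTail_nonneg (t : ℝ) : 0 ≤ T.noiseTail t :=
  integral_nonneg fun _ => by dsimp only; split_ifs <;> positivity

theorem noiseTail_le (t : ℝ) : T.noiseTail t ≤ T.s ^ 2 := by
  rw [← T.variance_noise]
  refine integral_mono (T.integrable_ite_noise t) T.memLp_noise.integrable_sq fun ξ => ?_
  dsimp only
  split_ifs
  · rfl
  · positivity

/-- Dominated convergence. With finite variance only, this gives no rate: the truncated part of the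
noise is negligible but not by a power. -/
theorem tendsto_noiseTail : Filter.Tendsto T.noiseTail Filter.atTop (nhds 0) := by
  have h : Filter.Tendsto (fun t => ∫ ξ, (if t < |ξ| then ξ ^ 2 else 0) ∂T.N) Filter.atTop
      (nhds (∫ _, (0 : ℝ) ∂T.N)) := by
    refine tendsto_integral_filter_of_dominated_convergence (fun ξ => ξ ^ 2)
      (Filter.Eventually.of_forall fun t => (T.integrable_ite_noise t).aestronglyMeasurable)
      (Filter.Eventually.of_forall fun t => Filter.Eventually.of_forall fun ξ => ?_)
      T.memLp_noise.integrable_sq (Filter.Eventually.of_forall fun ξ => ?_)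
    · split_ifs <;> simp [sq_nonneg]
    · refine tendsto_const_nhds.congr' ?_
      filter_upwards [Filter.eventually_ge_atTop |ξ|] with t ht
      rw [if_neg (not_lt.2 ht)]
  rw [integral_zero] at h
  exact h

/-- The noise truncated at height `t`. -/
noncomputable def cut (t ξ : ℝ) : ℝ := if t < |ξ| then 0 else ξ

/-- The gap of a mode against the target with truncated noise. -/
noncomputable def linCut {J : ℕ} (D : Fin J → (Fin d → ℝ) × ℝ) (n : Fin d → ℤ) : ℂ :=
  gap T.P D fun z => mode T.L n z.1 * conj (T.resid ∅ (z.1, cut (Real.sqrt J) z.2))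

/-- The gap of the absolute values of the truncated part of the noise. -/
noncomputable def heavyGap {J : ℕ} (D : Fin J → (Fin d → ℝ) × ℝ) : ℂ :=
  gap T.P D fun z => ((|z.2 - cut (Real.sqrt J) z.2| : ℝ) : ℂ)

end HeavyNoise

end Target

theorem measurable_cut (t : ℝ) : Measurable (Target.cut t) :=
  Measurable.ite (measurableSet_lt measurable_const measurable_id.abs) measurable_const measurable_id

theorem abs_cut_le {t : ℝ} (ht : 0 ≤ t) (ξ : ℝ) : |Target.cut t ξ| ≤ t := by
  unfold Target.cut
  split_ifs with h
  · simpa using ht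
  · exact not_lt.1 h

theorem abs_cut_le_abs (t ξ : ℝ) : |Target.cut t ξ| ≤ |ξ| := by
  unfold Target.cut
  split_ifs <;> simp

theorem sq_sub_cut (t ξ : ℝ) : (ξ - Target.cut t ξ) ^ 2 = if t < |ξ| then ξ ^ 2 else 0 := by
  unfold Target.cut
  split_ifs <;> simp

theorem abs_sub_cut_le {t : ℝ} (ht : 0 < t) (ξ : ℝ) :
    |ξ - Target.cut t ξ| ≤ (if t < |ξ| then ξ ^ 2 else 0) / t := by
  unfold Target.cut
  split_ifs with h
  · rw [sub_zero, le_div_iff₀ ht, ← sq_abs, sq]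
    gcongr
  · simp

namespace Target

variable {d : ℕ} (T : Target d) {J : ℕ} (hJ : 0 < J)

theorem memLp_sub_cut (t : ℝ) :
    MemLp (fun z : (Fin d → ℝ) × ℝ => z.2 - cut t z.2) 2 T.P := by
  refine T.memLp_noise_snd.of_le (measurable_snd.sub ((measurable_cut t).comp
    measurable_snd)).aestronglyMeasurable (Filter.Eventually.of_forall fun z => ?_)
  unfold cut
  split_ifs <;> simp

theorem integral_snd (g : ℝ → ℝ) : ∫ z, g z.2 ∂T.P = ∫ ξ, g ξ ∂T.N := by
  have := integral_fun_snd (μ := T.μ) (ν := T.N) g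
  rw [P, this]
  simp

include hJ

theorem integral_abs_sub_cut_le :
    ∫ z, |z.2 - cut (Real.sqrt J) z.2| ∂T.P ≤ T.noiseTail (Real.sqrt J) / Real.sqrt J := by
  have hs : 0 < Real.sqrt J := Real.sqrt_pos.2 (by exact_mod_cast hJ)
  rw [T.integral_snd fun ξ => |ξ - cut (Real.sqrt J) ξ|, noiseTail, ← integral_div]
  refine integral_mono_of_nonneg (Filter.Eventually.of_forall fun _ => abs_nonneg _)
    ((T.integrable_ite_noise _).div_const _) (Filter.Eventually.of_forall fun ξ =>
      abs_sub_cut_le hs ξ)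

/-- The removed part of the noise is bounded through absolute values, hence uniformly in n, so a
data-dependent choice of n cannot enlarge it. The truncated part has all moments. -/
theorem norm_sq_lin_le (D : Fin J → (Fin d → ℝ) × ℝ) (n : Fin d → ℤ) :
    ‖T.lin ∅ D n‖ ^ 2 ≤ 2 * ‖T.linCut D n‖ ^ 2
      + (16 * (T.noiseTail (Real.sqrt J) / Real.sqrt J) ^ 2 + 4 * ‖T.heavyGap D‖ ^ 2) := by
  have hJr : (0 : ℝ) < J := by exact_mod_cast hJ
  have hcut : Measurable fun z : (Fin d → ℝ) × ℝ => (z.1, cut (Real.sqrt J) z.2) :=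
    measurable_fst.prodMk ((measurable_cut _).comp measurable_snd)
  have hm : MemLp (fun z : (Fin d → ℝ) × ℝ => ((z.2 - cut (Real.sqrt J) z.2 : ℝ) : ℂ)) 2 T.P :=
    (T.memLp_sub_cut _).ofReal
  have hi : Integrable (fun z : (Fin d → ℝ) × ℝ => |z.2 - cut (Real.sqrt J) z.2|) T.P :=
    ((T.memLp_sub_cut _).integrable one_le_two).abs
  have i1 : Integrable (fun z : (Fin d → ℝ) × ℝ =>
      mode T.L n z.1 * ((z.2 - cut (Real.sqrt J) z.2 : ℝ) : ℂ)) T.P :=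
    (hm.integrable one_le_two).bdd_mul (c := 1) (measurable_mode_fst n).aestronglyMeasurable
      (Filter.Eventually.of_forall fun z => by rw [norm_mode])
  have i2 : Integrable (fun z : (Fin d → ℝ) × ℝ =>
      mode T.L n z.1 * conj (T.resid ∅ (z.1, cut (Real.sqrt J) z.2))) T.P := by
    refine Integrable.of_bound (C := T.S + Real.sqrt J) ((measurable_mode_fst n).mul
      (Complex.continuous_conj.measurable.comp
        ((T.measurable_resid ∅).comp hcut))).aestronglyMeasurable
      (Filter.Eventually.of_forall fun z => ?_)
    rw [norm_mul, norm_mode, one_mul, RCLike.norm_conj, resid_eq]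
    refine (norm_add_le _ _).trans (add_le_add (T.norm_rest_le_S _ _) ?_)
    rw [Complex.norm_real, Real.norm_eq_abs]
    exact abs_cut_le (Real.sqrt_nonneg _) _
  have hsplit : T.lin ∅ D n = T.linCut D n
      + gap T.P D fun z => mode T.L n z.1 * ((z.2 - cut (Real.sqrt J) z.2 : ℝ) : ℂ) := by
    rw [lin, linCut, ← gap_add i2 i1]
    congr 1
    ext z
    simp only [resid_eq, map_add, Complex.conj_ofReal]
    push_cast
    ring
  have hE := T.integral_abs_sub_cut_le hJ
  set E := ∫ z, |z.2 - cut (Real.sqrt J) z.2| ∂T.P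
  have hE0 : 0 ≤ E := integral_nonneg fun _ => abs_nonneg _
  have hgap : ‖gap T.P D fun z => mode T.L n z.1 * ((z.2 - cut (Real.sqrt J) z.2 : ℝ) : ℂ)‖
      ≤ 2 * E + ‖T.heavyGap D‖ := by
    have h1 := norm_gap_le (P := T.P) D
      fun z => mode T.L n z.1 * ((z.2 - cut (Real.sqrt J) z.2 : ℝ) : ℂ)
    simp only [norm_mul, norm_mode, one_mul, Complex.norm_real, Real.norm_eq_abs] at h1
    have h2 : T.heavyGap D
        = ((E - (J : ℝ)⁻¹ * ∑ j, |(D j).2 - cut (Real.sqrt J) (D j).2| : ℝ) : ℂ) := by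
      rw [heavyGap, gap, integral_complex_ofReal]
      push_cast
      rfl
    have h3 : (J : ℝ)⁻¹ * ∑ j, |(D j).2 - cut (Real.sqrt J) (D j).2| ≤ E + ‖T.heavyGap D‖ := by
      rw [h2, Complex.norm_real, Real.norm_eq_abs]
      have := neg_abs_le (E - (J : ℝ)⁻¹ * ∑ j, |(D j).2 - cut (Real.sqrt J) (D j).2|)
      linarith
    linarith
  rw [hsplit]
  set g := gap T.P D fun z => mode T.L n z.1 * ((z.2 - cut (Real.sqrt J) z.2 : ℝ) : ℂ)
  have h4 : ‖T.linCut D n + g‖ ^ 2 ≤ 2 * ‖T.linCut D n‖ ^ 2 + 2 * ‖g‖ ^ 2 := by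
    have := norm_add_le (T.linCut D n) g
    calc _ ≤ (‖T.linCut D n‖ + ‖g‖) ^ 2 := by gcongr
      _ ≤ _ := by nlinarith [sq_nonneg (‖T.linCut D n‖ - ‖g‖)]
  have h5 : ‖g‖ ^ 2 ≤ 8 * E ^ 2 + 2 * ‖T.heavyGap D‖ ^ 2 := by
    calc ‖g‖ ^ 2 ≤ (2 * E + ‖T.heavyGap D‖) ^ 2 := by gcongr
      _ ≤ _ := by nlinarith [sq_nonneg (2 * E - ‖T.heavyGap D‖)]
  have h6 : E ^ 2 ≤ (T.noiseTail (Real.sqrt J) / Real.sqrt J) ^ 2 := by gcongr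
  linarith

omit hJ in
theorem measurable_linCut (n : Fin d → ℤ) :
    Measurable fun D : Fin J → (Fin d → ℝ) × ℝ => T.linCut D n := by
  refine measurable_gap ((measurable_mode_fst n).mul (Complex.continuous_conj.measurable.comp
    ((T.measurable_resid ∅).comp (measurable_fst.prodMk ((measurable_cut _).comp measurable_snd)))))

omit hJ in
theorem measurable_heavyGap : Measurable fun D : Fin J → (Fin d → ℝ) × ℝ => T.heavyGap D := by
  have := measurable_cut (Real.sqrt J)
  exact measurable_gap (by fun_prop)

theorem lintegral_heavyGap_sq_le :
    ∫⁻ D, ENNReal.ofReal (‖T.heavyGap D‖ ^ 2) ∂(dataLaw T.μ T.N J)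
      ≤ ENNReal.ofReal (T.noiseTail (Real.sqrt J) / J) := by
  have hm : MemLp (fun z : (Fin d → ℝ) × ℝ => ((|z.2 - cut (Real.sqrt J) z.2| : ℝ) : ℂ)) 2 T.P :=
    (T.memLp_sub_cut _).abs.ofReal
  refine (lintegral_norm_gap_sq_le hJ hm).trans (ENNReal.ofReal_le_ofReal ?_)
  gcongr
  simp only [Complex.norm_real, Real.norm_eq_abs, abs_abs, sq_abs, sq_sub_cut]
  exact (T.integral_snd fun ξ => if Real.sqrt J < |ξ| then ξ ^ 2 else 0).le

/-- The truncated function is at most S + √J ≤ (S + 1)√J in modulus, with second moment at most V;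
one constant has to dominate both. -/
theorem lintegral_linCut_pow_le (n : Fin d → ℤ) (m : ℕ) :
    ∫⁻ D, ENNReal.ofReal ((J * ‖T.linCut D n‖ ^ 2) ^ m) ∂(dataLaw T.μ T.N J)
      ≤ ENNReal.ofReal (momentConst m (T.S + 1 + T.V)) := by
  have hs1 : 1 ≤ Real.sqrt J := by
    rw [Real.one_le_sqrt]
    exact_mod_cast hJ
  have hS := T.S_pos
  have hV := T.V_nonneg
  have hcut : Measurable fun z : (Fin d → ℝ) × ℝ => (z.1, cut (Real.sqrt J) z.2) :=
    measurable_fst.prodMk ((measurable_cut _).comp measurable_snd)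
  refine lintegral_gap_pow_le hJ (P := T.P)
    (φ := fun z => mode T.L n z.1 * conj (T.resid ∅ (z.1, cut (Real.sqrt J) z.2)))
    ((measurable_mode_fst n).mul
    (Complex.continuous_conj.measurable.comp ((T.measurable_resid ∅).comp hcut))) (fun z => ?_) ?_ m
  · rw [norm_mul, norm_mode, one_mul, RCLike.norm_conj, resid_eq]
    have h1 : ‖((cut (Real.sqrt J) z.2 : ℝ) : ℂ)‖ ≤ Real.sqrt J := by
      rw [Complex.norm_real, Real.norm_eq_abs]
      exact abs_cut_le (Real.sqrt_nonneg _) _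
    refine (norm_add_le _ _).trans ((add_le_add (T.norm_rest_le_S _ _) h1).trans ?_)
    nlinarith
  · simp only [norm_mul, norm_mode, one_mul, RCLike.norm_conj]
    have h := integral_mono_of_nonneg (Filter.Eventually.of_forall fun _ => by positivity)
      (T.integrable_const_add_noise_sq (2 * T.S ^ 2) 2)
      (Filter.Eventually.of_forall fun z => (T.norm_sq_resid_le ∅ (z.1, cut (Real.sqrt J) z.2)).trans
        (b := 2 * T.S ^ 2 + 2 * (cut (Real.sqrt J) z.2) ^ 2) (c := 2 * T.S ^ 2 + 2 * z.2 ^ 2)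
        (by
          have := sq_le_sq.2 (abs_cut_le_abs (Real.sqrt J) z.2)
          linarith))
    refine h.trans ?_
    rw [integral_const_add_noise_sq, V]
    nlinarith [sq_nonneg T.s]

end Target

end RFF

open MeasureTheory ProbabilityTheory
open scoped ENNReal ComplexConjugate

namespace RFF

/-! ### Iterated means over data and countably many frequency configurations. -/

section IteratedMeans

variable {X Y : Type*} [MeasurableSpace X] [MeasurableSpace Y] {P : Measure X} {Q : Measure Y} {F G : X → Y → ℝ≥0∞} {b c : ℝ}

variable (P Q) in
/-- The iterated mean of a nonnegative function of two variables is at most `b`. -/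
structure MeanLe (F : X → Y → ℝ≥0∞) (b : ℝ) : Prop where
  nonneg : 0 ≤ b
  -- Measurability is asked for each fixed y only; in the applications Y is countable, and this is
  -- all that the exchange of integrals needs.
  measurable : ∀ y, Measurable fun x => F x y
  le : ∫⁻ x, ∫⁻ y, F x y ∂Q ∂P ≤ ENNReal.ofReal b

namespace MeanLe

theorem const_mul (hF : MeanLe P Q F b) {r : ℝ} (hr : 0 ≤ r) :
    MeanLe P Q (fun x y => ENNReal.ofReal r * F x y) (r * b) where
  nonneg := mul_nonneg hr hF.nonneg
  measurable y := (hF.measurable y).const_mul _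
  le := by
    simp only [lintegral_const_mul' _ _ ENNReal.ofReal_ne_top]
    rw [ENNReal.ofReal_mul hr]
    exact mul_le_mul' le_rfl hF.le

theorem mono (hF : MeanLe P Q F b) (hG : ∀ y, Measurable fun x => G x y)
    (hGF : ∀ x y, G x y ≤ F x y) (hbc : b ≤ c) : MeanLe P Q G c where
  nonneg := hF.nonneg.trans hbc
  measurable := hG
  le := (lintegral_mono fun x => lintegral_mono fun y => hGF x y).trans
    (hF.le.trans (ENNReal.ofReal_le_ofReal hbc))

theorem of_left [IsProbabilityMeasure Q] (hb : 0 ≤ b) {F : X → ℝ≥0∞} (hF : Measurable F)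
    (h : ∫⁻ x, F x ∂P ≤ ENNReal.ofReal b) : MeanLe P Q (fun x _ => F x) b where
  nonneg := hb
  measurable _ := hF
  le := by simpa using h

theorem const [IsProbabilityMeasure P] [IsProbabilityMeasure Q] (hb : 0 ≤ b) : MeanLe P Q (fun _ _ => ENNReal.ofReal b) b where
  nonneg := hb
  measurable _ := measurable_const
  le := by simp

end MeanLe

variable [Countable Y] [MeasurableSingletonClass Y]

theorem measurable_lintegral_countable (hF : ∀ y, Measurable fun x => F x y) :
    Measurable fun x => ∫⁻ y, F x y ∂Q := by
  simp only [lintegral_countable']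
  exact Measurable.tsum fun y => (hF y).mul_const _

theorem lintegral_lintegral_countable_swap (hF : ∀ y, Measurable fun x => F x y) :
    ∫⁻ x, ∫⁻ y, F x y ∂Q ∂P = ∫⁻ y, ∫⁻ x, F x y ∂P ∂Q := by
  simp only [lintegral_countable' (μ := Q)]
  rw [lintegral_tsum fun y => ((hF y).mul_const _).aemeasurable]
  exact tsum_congr fun y => lintegral_mul_const _ (hF y)

/-- By Tonelli, a moment bound over the data for each fixed frequency carries over to a frequency
law that does not depend on the data. -/
theorem lintegral_lintegral_countable_le (hF : ∀ y, Measurable fun x => F x y) {B : ℝ≥0∞}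
    (hB : ∀ y, ∫⁻ x, F x y ∂P ≤ B) : ∫⁻ x, ∫⁻ y, F x y ∂Q ∂P ≤ B * Q Set.univ := by
  rw [lintegral_lintegral_countable_swap hF, ← lintegral_const]
  exact lintegral_mono hB

namespace MeanLe

theorem add (hF : MeanLe P Q F b) (hG : MeanLe P Q G c) :
    MeanLe P Q (fun x y => F x y + G x y) (b + c) where
  nonneg := add_nonneg hF.nonneg hG.nonneg
  measurable y := (hF.measurable y).add (hG.measurable y)
  le := by
    rw [ENNReal.ofReal_add hF.nonneg hG.nonneg]
    refine le_trans (le_of_eq ?_) (add_le_add hF.le hG.le)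
    rw [← lintegral_add_left (measurable_lintegral_countable hF.measurable)]
    exact lintegral_congr fun x => lintegral_add_left (measurable_of_countable _) _

theorem of_forall [IsProbabilityMeasure Q] (hb : 0 ≤ b) (hF : ∀ y, Measurable fun x => F x y)
    (h : ∀ y, ∫⁻ x, F x y ∂P ≤ ENNReal.ofReal b) : MeanLe P Q F b where
  nonneg := hb
  measurable := hF
  le := (lintegral_lintegral_countable_le hF h).trans (by simp)

end MeanLe

end IteratedMeans

namespace Target

variable {d : ℕ} (T : Target d)

/-! ### Gap terms when the data-dependent frequencies stay inside A. -/

section Pool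

variable {J : ℕ} (A : Finset (Fin d → ℤ)) (p : PMF (Fin d → ℤ)) (K k : ℕ)
  (D : Fin J → (Fin d → ℝ) × ℝ)

/-- The expected gap terms for `K` frequencies of which `k` are sampled from `p` and the others
belong to `A`. -/
noncomputable def poolGap (τ l₁ l₂ : ℝ) : ℝ≥0∞ :=
  ENNReal.ofReal (4 * T.β / τ * T.linInner A D)
    + ENNReal.ofReal (8 * T.β ^ 2 / (τ ^ 2 * l₂) * (A.card * K) * k)
      * (∑ n ∈ A, ∫⁻ m, ENNReal.ofReal (‖T.γ D (n - m)‖ ^ 4) ∂p.toMeasure)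
    + ENNReal.ofReal (1 / (2 * l₂) * k ^ 2)
      * (∫⁻ n, ∫⁻ m, ENNReal.ofReal (‖T.γ D (n - m)‖ ^ 2) ∂p.toMeasure ∂p.toMeasure)
    + ENNReal.ofReal (2 / l₁ * k) * (∫⁻ n, ENNReal.ofReal (‖T.lin A D n‖ ^ 2) ∂p.toMeasure)
    + ENNReal.ofReal ‖T.sqGap A D‖

/-- A law that charges only A contributes nothing to sums over frequencies outside A. The bound
therefore forgets the data-dependent laws and keeps only the samples from p. -/
theorem expGap_le_poolGap {ι : Type} [Fintype ι] (Q : ι → PMF (Fin d → ℤ)) (s : Finset ι)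
    (hs : ∀ i ∈ s, Q i = p) (hA : ∀ i ∉ s, ∀ m ∉ A, Q i m = 0) {τ l₁ l₂ : ℝ} (hτ : 0 < τ)
    (hl₁ : 0 < l₁) (hl₂ : 0 < l₂) :
    T.expGap D A Q τ l₁ l₂ ≤ T.poolGap A p (Fintype.card ι) s.card D τ l₁ l₂ := by
  classical
  have hβ := T.β_pos
  have hzero : ∀ i ∉ s, ∀ g : (Fin d → ℤ) → ℝ≥0∞,
      ∫⁻ m, (if m ∈ A then 0 else g m) ∂(Q i).toMeasure = 0 := by
    intro i hi g
    have h0 : (Q i).toMeasure ((A : Set (Fin d → ℤ))ᶜ) = 0 := by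
      rw [PMF.toMeasure_apply_eq_zero_iff _ A.finite_toSet.measurableSet.compl,
        Set.disjoint_left]
      intro m hm hmA
      exact (PMF.mem_support_iff _ _).1 hm (hA i hi m hmA)
    have h1 : ∀ᵐ m ∂(Q i).toMeasure, m ∈ A := h0
    rw [lintegral_congr_ae (g := fun _ => 0) (h1.mono fun m hm => if_pos hm), lintegral_zero]
  have hsum : ∀ g : (Fin d → ℤ) → ℝ≥0∞,
      ∑ i, ∫⁻ m, (if m ∈ A then 0 else g m) ∂(Q i).toMeasure
        ≤ ENNReal.ofReal s.card * ∫⁻ m, g m ∂p.toMeasure := by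
    intro g
    rw [← Finset.sum_subset s.subset_univ fun i _ hi => hzero i hi g, ENNReal.ofReal_natCast,
      ← nsmul_eq_mul]
    refine Finset.sum_le_card_nsmul _ _ _ fun i hi => ?_
    rw [hs i hi]
    refine lintegral_mono fun m => ?_
    split_ifs
    · exact zero_le
    · exact le_rfl
  unfold expGap poolGap
  refine add_le_add (add_le_add (add_le_add (add_le_add le_rfl ?_) ?_) ?_) le_rfl
  · refine (mul_le_mul' le_rfl (Finset.sum_le_sum fun n _ => hsum _)).trans (le_of_eq ?_)
    rw [← Finset.mul_sum, ← mul_assoc, ← ENNReal.ofReal_mul (by positivity)]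
  · have h2 : ∀ (j : ι) (n : Fin d → ℤ), ∫⁻ m, (if n ∈ A ∨ m ∈ A then 0 else
        ENNReal.ofReal (‖T.γ D (n - m)‖ ^ 2)) ∂(Q j).toMeasure
        = if n ∈ A then 0 else ∫⁻ m, (if m ∈ A then 0 else
          ENNReal.ofReal (‖T.γ D (n - m)‖ ^ 2)) ∂(Q j).toMeasure := by
      intro j n
      by_cases hn : n ∈ A <;> simp [hn]
    rw [ENNReal.ofReal_mul (by positivity), mul_assoc]
    refine mul_le_mul' le_rfl ?_
    calc _ = ∑ i, ∫⁻ n, (if n ∈ A then 0 else ∑ j, ∫⁻ m, (if m ∈ A then 0 else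
          ENNReal.ofReal (‖T.γ D (n - m)‖ ^ 2)) ∂(Q j).toMeasure) ∂(Q i).toMeasure := by
          refine Finset.sum_congr rfl fun i _ => ?_
          rw [← lintegral_finsetSum _ fun _ _ => Measurable.of_discrete]
          refine lintegral_congr fun n => ?_
          simp only [h2]
          by_cases hn : n ∈ A <;> simp [hn]
      _ ≤ ENNReal.ofReal s.card * ∫⁻ n, ∑ j, ∫⁻ m, (if m ∈ A then 0 else
          ENNReal.ofReal (‖T.γ D (n - m)‖ ^ 2)) ∂(Q j).toMeasure ∂p.toMeasure := hsum _
      _ ≤ ENNReal.ofReal s.card * ∫⁻ n, ENNReal.ofReal s.card * ∫⁻ m,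
          ENNReal.ofReal (‖T.γ D (n - m)‖ ^ 2) ∂p.toMeasure ∂p.toMeasure := by
          gcongr
          exact hsum _
      _ = _ := by
          rw [lintegral_const_mul' _ _ ENNReal.ofReal_ne_top, ← mul_assoc,
            ← ENNReal.ofReal_mul (by positivity), sq]
  · refine (mul_le_mul' le_rfl (hsum _)).trans (le_of_eq ?_)
    rw [← mul_assoc, ← ENNReal.ofReal_mul (by positivity)]

/-- A bound for the mean of `poolGap`. -/
noncomputable def poolBound (J : ℕ) (Acard : ℝ) (K k : ℕ) (τ l₁ l₂ t : ℝ) : ℝ :=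
  4 * T.β / τ * (Acard * (T.V / J))
    + 8 * T.β ^ 2 / (τ ^ 2 * l₂) * (Acard * K) * k * (Acard * (momentConst 2 1 / J ^ 2))
    + 1 / (2 * l₂) * k ^ 2 * (1 / J) + 2 / l₁ * k * (T.V / J) + t * (1 + T.V) / Real.sqrt J

theorem meanLe_poolGap {Y : Type*} [MeasurableSpace Y] [Countable Y] [MeasurableSingletonClass Y]
    {R : Measure Y} [IsProbabilityMeasure R] (hJ : 0 < J) {τ l₁ l₂ t : ℝ} (hτ : 0 < τ)
    (hl₁ : 0 < l₁) (hl₂ : 0 < l₂) (ht : 0 < t) (hA : T.S - ∑ n ∈ A, ‖T.a n‖ ≤ t) :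
    MeanLe (dataLaw T.μ T.N J) R (fun D _ => T.poolGap A p K k D τ l₁ l₂)
      (T.poolBound J A.card K k τ l₁ l₂ t) := by
  have hβ := T.β_pos
  have hV := T.V_nonneg
  have hmc := momentConst_nonneg 2 1
  have hJr : (0 : ℝ) < J := by exact_mod_cast hJ
  have hγ : ∀ n, Measurable fun D : Fin J → (Fin d → ℝ) × ℝ => T.γ D n := T.measurable_γ
  have hlin : ∀ n, Measurable fun D : Fin J → (Fin d → ℝ) × ℝ => T.lin A D n := T.measurable_lin A
  have hlin2 := fun n => ((hlin n).norm.pow_const 2).ennreal_ofReal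
  have hγ2 := fun n => ((hγ n).norm.pow_const 2).ennreal_ofReal
  have hγ4 := fun n => ((hγ n).norm.pow_const 4).ennreal_ofReal
  have e4 : ∀ n, ∫⁻ D, ENNReal.ofReal (‖T.γ D n‖ ^ 4) ∂(dataLaw T.μ T.N J)
      ≤ ENNReal.ofReal (momentConst 2 1 / J ^ 2) := by
    intro n
    have h := T.lintegral_γ_pow_le hJ n 2
    have h1 : ∀ D : Fin J → (Fin d → ℝ) × ℝ, ENNReal.ofReal (‖T.γ D n‖ ^ 4)
        = ENNReal.ofReal (1 / J ^ 2) * ENNReal.ofReal ((J * ‖T.γ D n‖ ^ 2) ^ 2) := fun D => by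
      rw [← ENNReal.ofReal_mul (by positivity)]
      congr 1
      field_simp
    simp only [h1]
    rw [lintegral_const_mul' _ _ ENNReal.ofReal_ne_top]
    refine (mul_le_mul' le_rfl h).trans (le_of_eq ?_)
    rw [← ENNReal.ofReal_mul (by positivity)]
    congr 1
    ring
  have hcard : ∀ b : ℝ, 0 ≤ b → ∀ F : (Fin d → ℤ) → (Fin J → (Fin d → ℝ) × ℝ) → ℝ≥0∞,
      (∀ n, Measurable (F n)) → (∀ n, ∫⁻ D, F n D ∂(dataLaw T.μ T.N J) ≤ ENNReal.ofReal b) →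
      ∫⁻ D, ∑ n ∈ A, F n D ∂(dataLaw T.μ T.N J) ≤ ENNReal.ofReal (A.card * b) := by
    intro b hb F hF h
    rw [lintegral_finsetSum _ fun n _ => hF n, ENNReal.ofReal_mul (by positivity),
      ENNReal.ofReal_natCast, ← nsmul_eq_mul]
    exact Finset.sum_le_card_nsmul _ _ _ fun n _ => h n
  have m1 : MeanLe (dataLaw T.μ T.N J) R (fun D _ => ENNReal.ofReal (4 * T.β / τ * T.linInner A D))
      (4 * T.β / τ * (A.card * (T.V / J))) := by
    have h := (MeanLe.of_left (Q := R) (b := A.card * (T.V / J)) (by positivity)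
      (Finset.measurable_fun_sum A fun n _ => hlin2 n)
      (hcard _ (by positivity) (fun n D => ENNReal.ofReal (‖T.lin A D n‖ ^ 2)) hlin2
        fun n => T.lintegral_lin_sq_le hJ A n)).const_mul (r := 4 * T.β / τ) (by positivity)
    refine h.mono (fun _ => ?_) (fun D _ => le_of_eq ?_) le_rfl
    · exact ((Finset.measurable_fun_sum _ fun n _ =>
        (hlin n).norm.pow_const 2).const_mul _).ennreal_ofReal
    · rw [linInner, ENNReal.ofReal_mul (by positivity),
        ENNReal.ofReal_sum_of_nonneg fun _ _ => by positivity]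
  have m2 := (MeanLe.of_left (Q := R) (b := A.card * (momentConst 2 1 / J ^ 2)) (by positivity)
    (Finset.measurable_fun_sum A fun n _ => measurable_lintegral_countable fun m => hγ4 (n - m))
    (hcard _ (by positivity)
      (fun n D => ∫⁻ m, ENNReal.ofReal (‖T.γ D (n - m)‖ ^ 4) ∂p.toMeasure)
      (fun n => measurable_lintegral_countable fun m => hγ4 (n - m))
      fun n => (lintegral_lintegral_countable_le (fun m => hγ4 (n - m))
        fun m => e4 (n - m)).trans (by simp))).const_mul
      (r := 8 * T.β ^ 2 / (τ ^ 2 * l₂) * (A.card * K) * k) (by positivity)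
  have m3 := (MeanLe.of_left (P := dataLaw T.μ T.N J) (Q := R) (b := 1 / J) (by positivity)
    (measurable_lintegral_countable (Q := p.toMeasure) fun n =>
      measurable_lintegral_countable (Q := p.toMeasure) fun m => hγ2 (n - m))
    ((lintegral_lintegral_countable_le
      (fun n => measurable_lintegral_countable fun m => hγ2 (n - m))
      fun n => (lintegral_lintegral_countable_le (fun m => hγ2 (n - m))
        fun m => T.lintegral_γ_sq_le hJ (n - m)).trans (le_of_eq (by
          rw [measure_univ, mul_one]))).trans (by simp))).const_mul
      (r := 1 / (2 * l₂) * k ^ 2) (by positivity)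
  have m4 := (MeanLe.of_left (P := dataLaw T.μ T.N J) (Q := R) (b := T.V / J) (by positivity)
    (measurable_lintegral_countable (Q := p.toMeasure) hlin2)
    ((lintegral_lintegral_countable_le hlin2 fun n => T.lintegral_lin_sq_le hJ A n).trans
      (by simp))).const_mul (r := 2 / l₁ * k) (by positivity)
  have m5 := MeanLe.of_left (P := dataLaw T.μ T.N J) (Q := R) (b := t * (1 + T.V) / Real.sqrt J)
    (by positivity) (T.measurable_sqGap A).norm.ennreal_ofReal (T.lintegral_sqGap_le hJ A ht hA)
  exact (((m1.add m2).add m3).add m4).add m5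

end Pool

/-! ### Gap terms when the frequency laws are only dominated. -/

section Dominated

variable {J : ℕ} (D : Fin J → (Fin d → ℝ) × ℝ)

/-- The square of the gap of a mode against the heavy part of the noise is at most this. -/
noncomputable def heavySq : ℝ :=
  16 * (T.noiseTail (Real.sqrt J) / Real.sqrt J) ^ 2 + 4 * ‖T.heavyGap D‖ ^ 2

/-- The expected gap terms for frequency laws that are dominated by `X • π`. -/
noncomputable def dominatedGap (π : Measure (Fin d → ℤ)) (K : ℕ) (X ε l₁ l₂ : ℝ) : ℝ≥0∞ :=
  ENNReal.ofReal (K ^ 2 / (2 * l₂ * J)) * (ENNReal.ofReal (1 / ε + ε ^ 3 * X) + ENNReal.ofReal ε *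
      ∫⁻ n, ∫⁻ m, ENNReal.ofReal ((J * ‖T.γ D (n - m)‖ ^ 2) ^ 10) ∂π ∂π)
    + ENNReal.ofReal (4 * K / (l₁ * J)) * (ENNReal.ofReal (1 / ε + ε ^ 3 * X) + ENNReal.ofReal ε *
      ∫⁻ n, ENNReal.ofReal ((J * ‖T.linCut D n‖ ^ 2) ^ 10) ∂π)
    + ENNReal.ofReal (2 * K / l₁) * ENNReal.ofReal (T.heavySq D)
    + ENNReal.ofReal ‖T.sqGap ∅ D‖

/-- The domination factor X multiplies only the tenth moment, which the power t⁹ discounts; below t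
the total mass 1 of q is used. -/
theorem lintegral_le_of_dominated {q : Measure (Fin d → ℤ)} [IsProbabilityMeasure q]
    {π : Measure (Fin d → ℤ)} {X t : ℝ} (ht : 0 < t) (hq : q ≤ ENNReal.ofReal X • π)
    {u : (Fin d → ℤ) → ℝ} (hu : ∀ n, 0 ≤ u n) :
    ∫⁻ n, ENNReal.ofReal (u n) ∂q
      ≤ ENNReal.ofReal t + ENNReal.ofReal (1 / t ^ 9) * (ENNReal.ofReal X *
        ∫⁻ n, ENNReal.ofReal (u n ^ 10) ∂π) := by
  have h1 : ∀ n, ENNReal.ofReal (u n)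
      ≤ ENNReal.ofReal t + ENNReal.ofReal (1 / t ^ 9) * ENNReal.ofReal (u n ^ 10) := fun n => by
    have h0 := hu n
    rw [← ENNReal.ofReal_mul (by positivity), ← ENNReal.ofReal_add ht.le (by positivity)]
    refine ENNReal.ofReal_le_ofReal ((self_le_add_pow_div (hu n) ht 9).trans (le_of_eq ?_))
    ring
  refine (lintegral_mono h1).trans ?_
  rw [lintegral_add_left measurable_const, lintegral_const, measure_univ, mul_one,
    lintegral_const_mul' _ _ ENNReal.ofReal_ne_top]
  refine add_le_add le_rfl (mul_le_mul' le_rfl ?_)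
  rw [← smul_eq_mul (a := ENNReal.ofReal X), ← lintegral_smul_measure]
  exact lintegral_mono' hq le_rfl

/-- Here t = 1/ε + ε³X. It is large enough that X²/t⁹ ≤ ε, with X² because two frequencies are
dominated at once, while X enters t itself only with the small coefficient ε³. -/
theorem threshold_pow_le {X ε : ℝ} (hX : 1 ≤ X) (hε : 0 < ε) :
    1 / ((1 / ε + ε ^ 3 * X)) ^ 9 * X ^ 2 ≤ ε := by
  have h1 : 1 / ε + ε ^ 3 * X = (1 + ε ^ 4 * X) / ε := by field_simp
  have h2 : (ε ^ 4 * X) ^ 2 ≤ (1 + ε ^ 4 * X) ^ 9 := by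
    have h0 : 0 ≤ ε ^ 4 * X := by positivity
    calc (ε ^ 4 * X) ^ 2 ≤ (1 + ε ^ 4 * X) ^ 2 := by gcongr; linarith
      _ ≤ (1 + ε ^ 4 * X) ^ 9 := pow_le_pow_right₀ (by linarith) (by norm_num)
  rw [h1, div_pow, one_div_div, div_mul_eq_mul_div, div_le_iff₀ (by positivity)]
  calc ε ^ 9 * X ^ 2 = ε * (ε ^ 4 * X) ^ 2 := by ring
    _ ≤ _ := by gcongr

theorem expGap_le_dominatedGap (hJ : 0 < J) {ι : Type} [Fintype ι] (Q : ι → PMF (Fin d → ℤ))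
    {π : Measure (Fin d → ℤ)} {X ε l₁ l₂ : ℝ} (hX : 1 ≤ X) (hε : 0 < ε) (hl₁ : 0 < l₁)
    (hl₂ : 0 < l₂) (hQ : ∀ i, (Q i).toMeasure ≤ ENNReal.ofReal X • π) :
    T.expGap D ∅ Q 1 l₁ l₂ ≤ T.dominatedGap D π (Fintype.card ι) X ε l₁ l₂ := by
  have hJr : (0 : ℝ) < J := by exact_mod_cast hJ
  have hX0 : 0 < X := by linarith
  -- The same threshold serves the quadratic terms, which pay X², and the linear ones, which pay X.
  set t := 1 / ε + ε ^ 3 * X with ht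
  have ht0 : 0 < t := by positivity
  have hthr := threshold_pow_le hX hε
  rw [← ht] at hthr
  have hthr1 : 1 / t ^ 9 * X ≤ ε := by
    refine le_trans ?_ hthr
    gcongr
    nlinarith
  have hlin : ∀ i, ∫⁻ n, ENNReal.ofReal (‖T.lin ∅ D n‖ ^ 2) ∂(Q i).toMeasure
      ≤ ENNReal.ofReal (2 / J) * (ENNReal.ofReal t + ENNReal.ofReal ε *
        ∫⁻ n, ENNReal.ofReal ((J * ‖T.linCut D n‖ ^ 2) ^ 10) ∂π) + ENNReal.ofReal (T.heavySq D) := by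
    intro i
    have h1 : ∀ n, ENNReal.ofReal (‖T.lin ∅ D n‖ ^ 2)
        ≤ ENNReal.ofReal (2 / J) * ENNReal.ofReal (J * ‖T.linCut D n‖ ^ 2)
          + ENNReal.ofReal (T.heavySq D) := fun n => by
      rw [← ENNReal.ofReal_mul (by positivity), ← ENNReal.ofReal_add (by positivity)
        (by unfold heavySq; positivity)]
      refine ENNReal.ofReal_le_ofReal ((T.norm_sq_lin_le hJ D n).trans (le_of_eq ?_))
      rw [heavySq]
      field_simp
    refine (lintegral_mono h1).trans ?_
    rw [lintegral_add_right _ measurable_const, lintegral_const, measure_univ, mul_one,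
      lintegral_const_mul' _ _ ENNReal.ofReal_ne_top]
    refine add_le_add (mul_le_mul' le_rfl ?_) le_rfl
    refine (lintegral_le_of_dominated ht0 (hQ i) fun n => by positivity).trans
      (add_le_add le_rfl ?_)
    rw [← mul_assoc, ← ENNReal.ofReal_mul (by positivity)]
    exact mul_le_mul' (ENNReal.ofReal_le_ofReal hthr1) le_rfl
  have hγ : ∀ i j, ∫⁻ n, ∫⁻ m, ENNReal.ofReal (‖T.γ D (n - m)‖ ^ 2) ∂(Q j).toMeasure
      ∂(Q i).toMeasure ≤ ENNReal.ofReal (1 / J) * (ENNReal.ofReal t + ENNReal.ofReal ε *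
        ∫⁻ n, ∫⁻ m, ENNReal.ofReal ((J * ‖T.γ D (n - m)‖ ^ 2) ^ 10) ∂π ∂π) := by
    intro i j
    have h1 : ∀ n, ∫⁻ m, ENNReal.ofReal (‖T.γ D (n - m)‖ ^ 2) ∂(Q j).toMeasure
        ≤ ENNReal.ofReal (1 / J) * (ENNReal.ofReal t + ENNReal.ofReal (1 / t ^ 9 * X) *
          ∫⁻ m, ENNReal.ofReal ((J * ‖T.γ D (n - m)‖ ^ 2) ^ 10) ∂π) := by
      intro n
      have h2 : ∀ m, ENNReal.ofReal (‖T.γ D (n - m)‖ ^ 2)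
          = ENNReal.ofReal (1 / J) * ENNReal.ofReal (J * ‖T.γ D (n - m)‖ ^ 2) := fun m => by
        rw [← ENNReal.ofReal_mul (by positivity)]
        congr 1
        field_simp
      simp only [h2]
      rw [lintegral_const_mul' _ _ ENNReal.ofReal_ne_top]
      refine mul_le_mul' le_rfl ?_
      refine (lintegral_le_of_dominated ht0 (hQ j) fun n => by positivity).trans
        (add_le_add le_rfl ?_)
      rw [← mul_assoc, ← ENNReal.ofReal_mul (by positivity)]
    refine (lintegral_mono h1).trans ?_
    rw [lintegral_const_mul' _ _ ENNReal.ofReal_ne_top, lintegral_add_left measurable_const,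
      lintegral_const, measure_univ, mul_one, lintegral_const_mul' _ _ ENNReal.ofReal_ne_top]
    refine mul_le_mul' le_rfl (add_le_add le_rfl ?_)
    calc _ ≤ ENNReal.ofReal (1 / t ^ 9 * X) * ∫⁻ n, ∫⁻ m,
          ENNReal.ofReal ((J * ‖T.γ D (n - m)‖ ^ 2) ^ 10) ∂π ∂(ENNReal.ofReal X • π) :=
          mul_le_mul' le_rfl (lintegral_mono' (hQ i) le_rfl)
      _ = ENNReal.ofReal (1 / t ^ 9 * X ^ 2) * ∫⁻ n, ∫⁻ m,
          ENNReal.ofReal ((J * ‖T.γ D (n - m)‖ ^ 2) ^ 10) ∂π ∂π := by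
          rw [lintegral_smul_measure, smul_eq_mul, ← mul_assoc, ← ENNReal.ofReal_mul (by positivity)]
          congr 2
          ring
      _ ≤ _ := mul_le_mul' (ENNReal.ofReal_le_ofReal hthr) le_rfl
  have hcard : ∀ (F : ι → ℝ≥0∞) (B : ℝ≥0∞), (∀ i, F i ≤ B) →
      ∑ i, F i ≤ ENNReal.ofReal (Fintype.card ι) * B := fun F B h => by
    rw [ENNReal.ofReal_natCast, ← nsmul_eq_mul]
    exact Finset.sum_le_card_nsmul _ _ _ fun i _ => h i
  have h1 := hcard _ _ fun i => hcard _ _ fun j => hγ i j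
  have h2 := hcard _ _ hlin
  unfold expGap dominatedGap
  simp only [linInner, Finset.sum_empty, mul_zero, ENNReal.ofReal_zero, zero_add,
    Finset.notMem_empty, or_self, if_false]
  refine add_le_add ?_ le_rfl
  rw [add_assoc]
  refine add_le_add ((mul_le_mul' le_rfl h1).trans (le_of_eq ?_))
    ((mul_le_mul' le_rfl h2).trans (le_of_eq ?_))
  · rw [← mul_assoc, ← mul_assoc, ← mul_assoc, ← ENNReal.ofReal_mul (by positivity),
      ← ENNReal.ofReal_mul (by positivity), ← ENNReal.ofReal_mul (by positivity)]
    congr 2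
    field_simp
  · rw [mul_add, mul_add, ← mul_assoc, ← mul_assoc, ← mul_assoc,
      ← ENNReal.ofReal_mul (by positivity), ← ENNReal.ofReal_mul (by positivity)]
    congr 3
    · field_simp
      ring
    · ring

end Dominated

end Target

end RFF

open MeasureTheory ProbabilityTheory
open scoped ENNReal ComplexConjugate

namespace RFF

namespace Target

variable {d : ℕ} (T : Target d)

theorem approxBound_mono {l₁ l₂ S₁ S₂ S₁' S₂' : ℝ} (hl₁ : 0 ≤ l₁) (hl₂ : 0 ≤ l₂) (h0 : 0 ≤ S₁)
    (h₁ : S₁ ≤ S₁') (h₂ : S₂ ≤ S₂') : approxBound l₁ l₂ S₁ S₂ ≤ approxBound l₁ l₂ S₁' S₂' := by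
  unfold approxBound
  gcongr

theorem sum_integral_impWeight_mode {r : PMF (Fin d → ℤ)} {E : Set (Fin d → ℤ)} {M : ℕ} {C : ℝ}
    (hM : 0 < M) (hr : ∀ n ∈ E, r n = 0 → T.a n = 0)
    (hC : ∀ n, ‖impWeight T.a r E M n‖ ≤ C) (x : Fin d → ℝ) :
    ∑ _k : Fin M, ∫ n, impWeight T.a r E M n * mode T.L n x ∂r.toMeasure
      = ∑' n, E.indicator (fun n => T.a n * mode T.L n x) n := by
  rw [Finset.sum_const, Finset.card_univ, Fintype.card_fin, nsmul_eq_mul]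
  exact integral_impWeight_mul (M := (M : ℝ)) (by exact_mod_cast hM) hr hC
    fun n => norm_mode _ n x

theorem sum_integral_impWeight_pow_le {r : PMF (Fin d → ℤ)} {E : Set (Fin d → ℤ)} {M : ℕ} {C : ℝ}
    (hM : 0 < M) (hr : ∀ n ∈ E, r n = 0 → T.a n = 0)
    (hC : ∀ n, ‖impWeight T.a r E M n‖ ≤ C) (j : ℕ) :
    ∑ _k : Fin M, ∫ n, ‖impWeight T.a r E M n‖ ^ (j + 1) ∂r.toMeasure
      ≤ C ^ j * ∑' n, E.indicator (fun n => ‖T.a n‖) n := by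
  rw [Finset.sum_const, Finset.card_univ, Fintype.card_fin, nsmul_eq_mul]
  exact integral_norm_impWeight_pow_le (M := (M : ℝ)) (by exact_mod_cast hM) hr hC j

theorem tsum_indicator_univ_norm : ∑' n, (Set.univ : Set (Fin d → ℤ)).indicator
    (fun n => ‖T.a n‖) n = T.S := by
  simp [S]

theorem summable_a_mul_mode (x : Fin d → ℝ) : Summable fun n => T.a n * mode T.L n x :=
  (T.hasSum_f x).summable

/-! ### First stage: a measurable bound and its mean. -/

section FirstStage

variable {J : ℕ} (D : Fin J → (Fin d → ℝ) × ℝ) (p : PMF (Fin d → ℤ)) {K : ℕ}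

/-- The bound for the first least squares problem obtained from importance sampling. -/
noncomputable def stageOne (l₁ l₂ : ℝ) (ν : Fin K → Fin d → ℤ) : ℝ :=
  T.regExcess D l₁ l₂ (fun _ => impWeight T.a p Set.univ K) ν + T.gapTotal ∅ D ν 1 l₁ l₂

variable {p} {l₁ l₂ : ℝ}

/-- With A empty and τ = 1 the hypothesis on the inner gaps is void and the factor of the risk is 1
- 3/4. The risk term later gives accuracy of the amplitudes, the penalty term the domination factor
of the resampling law. -/
theorem risk_add_le_stageOne (hl₁ : 0 < l₁) (hl₂ : 0 < l₂) (ν : Fin K → Fin d → ℤ) :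
    let v := amplitudes T.L l₁ l₂ ν (fun j => (D j).1) (noisyValues T.f D)
    1 / 4 * T.risk (network T.L ν v) + l₁ / 2 * ∑ k, ‖v k‖ ^ 2 ≤ T.stageOne D p l₁ l₂ ν := by
  have h := T.risk_amplitudes_le ∅ D ν hl₁ hl₂ one_pos (by simp [gapInner])
    (fun k => impWeight T.a p Set.univ K (ν k))
  norm_num at h
  exact h

theorem stageOne_nonneg (hl₁ : 0 < l₁) (hl₂ : 0 < l₂) (ν : Fin K → Fin d → ℤ) :
    0 ≤ T.stageOne D p l₁ l₂ ν := by
  refine le_trans ?_ (T.risk_add_le_stageOne D (p := p) hl₁ hl₂ ν)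
  have := T.risk_nonneg (network T.L ν
    (amplitudes T.L l₁ l₂ ν (fun j => (D j).1) (noisyValues T.f D)))
  positivity

/-- No measurability of the minimizer in the data is known; this explicit bound replaces it in all
averages. -/
theorem measurable_stageOne (ν : Fin K → Fin d → ℤ) :
    Measurable fun D : Fin J → (Fin d → ℝ) × ℝ => T.stageOne D p l₁ l₂ ν := by
  have hγ : ∀ n, Measurable fun D : Fin J → (Fin d → ℝ) × ℝ => T.γ D n := T.measurable_γ
  have hlin : ∀ n, Measurable fun D : Fin J → (Fin d → ℝ) × ℝ => T.lin ∅ D n := T.measurable_lin ∅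
  have hsq := T.measurable_sqGap (J := J) ∅
  have hnet : Measurable (network T.L ν fun k => impWeight T.a p Set.univ K (ν k)) :=
    (continuous_network _ _).measurable
  have hf := T.measurable_f
  unfold stageOne regExcess gapTotal excess noisyValues linInner gapCross gapOuter linOuter
  simp only [Finset.sum_empty, Finset.notMem_empty, or_self, if_false]
  fun_prop

theorem norm_impWeight_univ_le {C₀ : ℝ} (hC₀ : 0 ≤ C₀) (hp : ∀ n, ‖T.a n‖ ≤ C₀ * (p n).toReal)
    (hK : 0 < K) (E : Set (Fin d → ℤ)) (n : Fin d → ℤ) : ‖impWeight T.a p E K n‖ ≤ C₀ / K :=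
  norm_impWeight_le (by exact_mod_cast hK) hC₀ (fun n _ => hp n) n

theorem eq_zero_of_dist_eq_zero {C₀ : ℝ} (hp : ∀ n, ‖T.a n‖ ≤ C₀ * (p n).toReal) (n : Fin d → ℤ)
    (hn : p n = 0) : T.a n = 0 := by
  have := hp n
  rw [hn, ENNReal.toReal_zero, mul_zero] at this
  exact norm_le_zero_iff.1 this

/-- A bound for the mean of `stageOne`. -/
noncomputable def stageOneBound (J K : ℕ) (C₀ l₁ l₂ : ℝ) : ℝ :=
  approxBound l₁ l₂ (C₀ / K * T.S) ((C₀ / K) ^ 3 * T.S) + T.poolBound J 0 K K 1 l₁ l₂ T.S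

/-- The hypothesis |a| ≤ C₀p bounds every importance weight by C₀/K. The set A is empty, so all K
frequencies count as fresh and the remainder is the full function, whence t = S. -/
theorem meanLe_stageOne {C₀ : ℝ} (hC₀ : 0 ≤ C₀) (hp : ∀ n, ‖T.a n‖ ≤ C₀ * (p n).toReal)
    (hJ : 0 < J) (hK : 0 < K) (hl₁ : 0 < l₁) (hl₂ : 0 < l₂) :
    MeanLe (dataLaw T.μ T.N J) (freqLaw p K) (fun D ν => ENNReal.ofReal (T.stageOne D p l₁ l₂ ν))
      (T.stageOneBound J K C₀ l₁ l₂) := by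
  have hS := T.S_pos
  have hprob : IsProbabilityMeasure (dataLaw T.μ T.N J) := by unfold dataLaw; infer_instance
  have hprob' : IsProbabilityMeasure (freqLaw p K) := by unfold freqLaw; infer_instance
  have hW := T.norm_impWeight_univ_le hC₀ hp hK Set.univ
  have hr : ∀ n ∈ (Set.univ : Set (Fin d → ℤ)), p n = 0 → T.a n = 0 := fun n _ =>
    T.eq_zero_of_dist_eq_zero hp n
  have m1 : MeanLe (dataLaw T.μ T.N J) (freqLaw p K)
      (fun _ _ => ENNReal.ofReal (approxBound l₁ l₂ (C₀ / K * T.S) ((C₀ / K) ^ 3 * T.S)))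
      (approxBound l₁ l₂ (C₀ / K * T.S) ((C₀ / K) ^ 3 * T.S)) :=
    MeanLe.const (by unfold approxBound; positivity)
  have m2 := T.meanLe_poolGap ∅ p K K (R := freqLaw p K) hJ one_pos hl₁ hl₂ hS (by simp)
  rw [Finset.card_empty, Nat.cast_zero] at m2
  have m := m1.add m2
  refine ⟨m.nonneg, fun ν => (T.measurable_stageOne ν).ennreal_ofReal, le_trans ?_ m.le⟩
  refine lintegral_mono fun D => ?_
  have h := T.lintegral_regExcess_add_gapTotal_le D hJ ∅ (ι := Fin K) (Q := fun _ => p)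
    (W := fun _ => impWeight T.a p Set.univ K) (c := C₀ / K) one_pos le_rfl hl₁ hl₂
    (by simp [gapInner]) (fun _ n => hW n) fun x => by
      rw [T.sum_integral_impWeight_mode hK hr hW]
      simpa using (T.hasSum_f x).tsum_eq
  refine h.trans ?_
  rw [lintegral_const, measure_univ, mul_one]
  refine add_le_add (ENNReal.ofReal_le_ofReal (approxBound_mono hl₁.le hl₂.le ?_ ?_ ?_)) ?_
  · exact Finset.sum_nonneg fun _ _ => integral_nonneg fun _ => by positivity
  · have := T.sum_integral_impWeight_pow_le hK hr hW 1
    rwa [pow_one, tsum_indicator_univ_norm] at this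
  · have := T.sum_integral_impWeight_pow_le hK hr hW 3
    rwa [tsum_indicator_univ_norm] at this
  · have := T.expGap_le_poolGap ∅ p D (fun _ : Fin K => p) Finset.univ (fun _ _ => rfl)
      (fun i hi => absurd (Finset.mem_univ i) hi) one_pos hl₁ hl₂
    rwa [Finset.card_univ, Fintype.card_fin] at this

end FirstStage

/-! ### Second stage, with and without accurate first-stage amplitudes. -/

section SecondStage

variable {J : ℕ} (D : Fin J → (Fin d → ℝ) × ℝ) {p : PMF (Fin d → ℤ)} {K₁ K₂ : ℕ} {C₀ : ℝ}
  {m₁ m₂ : ℝ}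

/-- The expected risk for `K₁` frequencies from `r` and `K₂` frequencies from `p`. -/
noncomputable def mixedRisk (r p : PMF (Fin d → ℤ)) (K₁ K₂ : ℕ) (m₁ m₂ : ℝ) : ℝ≥0∞ :=
  ∫⁻ ω, ENNReal.ofReal (T.risk (network T.L ω
      (amplitudes T.L m₁ m₂ ω (fun j => (D j).1) (noisyValues T.f D))))
    ∂(Measure.pi fun k : Fin K₁ ⊕ Fin K₂ =>
      (Sum.elim (fun _ => r) (fun _ => p) k : PMF _).toMeasure)

theorem mul_mixedRisk_le {r : PMF (Fin d → ℤ)} {A : Finset (Fin d → ℤ)} {τ : ℝ} (hτ : 0 < τ)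
    (hτ1 : τ ≤ 1) (hm₁ : 0 < m₁) (hm₂ : 0 < m₂)
    (hA : T.β * Real.sqrt (T.gapInner A D) ≤ τ / 4)
    {W : Fin K₁ ⊕ Fin K₂ → (Fin d → ℤ) → ℂ} {B : ℝ≥0∞}
    (hB : ∫⁻ ω, ENNReal.ofReal (T.regExcess D m₁ m₂ W ω + T.gapTotal A D ω τ m₁ m₂)
      ∂(Measure.pi fun k => (Sum.elim (fun _ => r) (fun _ => p) k : PMF _).toMeasure) ≤ B) :
    ENNReal.ofReal (1 - 3 * τ / 4) * T.mixedRisk D r p K₁ K₂ m₁ m₂ ≤ B := by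
  refine le_trans ?_ hB
  rw [mixedRisk, ← lintegral_const_mul' _ _ ENNReal.ofReal_ne_top]
  refine lintegral_mono fun ω => ?_
  have h := T.risk_amplitudes_le A D ω hm₁ hm₂ hτ hA fun k => W k (ω k)
  rw [← ENNReal.ofReal_mul (by linarith)]
  refine ENNReal.ofReal_le_ofReal (le_trans ?_ h)
  have : 0 ≤ ∑ k, ‖amplitudes T.L m₁ m₂ ω (fun j => (D j).1) (noisyValues T.f D) k‖ ^ 2 :=
    Finset.sum_nonneg fun _ _ => by positivity
  have := mul_nonneg (half_pos hm₁).le this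
  linarith

/-- A kept mode has |b| ≥ ε, hence |a| ≥ ε/2, so it lies in A and its gaps are absorbed. A discarded
mode has |a| < 2ε. Only the K₂ fresh frequencies pay gap terms. -/
theorem mixedRisk_le_of_close (hC₀ : 0 ≤ C₀) (hp : ∀ n, ‖T.a n‖ ≤ C₀ * (p n).toReal)
    (hJ : 0 < J) (hK₁ : 0 < K₁) (hK₂ : 0 < K₂) (hm₁ : 0 < m₁) (hm₂ : 0 < m₂) {τ c ε : ℝ}
    (hτ : 0 < τ) (hτ1 : τ ≤ 1) (hε : 0 < ε) (hc0 : 0 ≤ c) (hc : c ≤ 1 / 2)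
    {b : (Fin d → ℤ) → ℂ} (hclose : ∀ n, ‖b n - T.a n‖ ≤ c * ε) (hbig : ∃ n, 2 * ε ≤ ‖T.a n‖)
    {A : Finset (Fin d → ℤ)} (hmem : ∀ n, ε / 2 ≤ ‖T.a n‖ → n ∈ A)
    (hA : T.β * Real.sqrt (T.gapInner A D) ≤ τ / 4) :
    ENNReal.ofReal (1 - 3 * τ / 4) * T.mixedRisk D (resampleDist p ε b) p K₁ K₂ m₁ m₂
      ≤ ENNReal.ofReal (approxBound m₁ m₂
          ((1 + c) / (1 - c) * T.S / K₁ * T.S + C₀ / K₂ * tailMass T.a (2 * ε))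
          (((1 + c) / (1 - c) * T.S / K₁) ^ 3 * T.S + (C₀ / K₂) ^ 3 * tailMass T.a (2 * ε)))
        + T.poolGap A p (K₁ + K₂) K₂ D τ m₁ m₂ := by
  classical
  have hS := T.S_pos
  obtain ⟨hr0, hr1⟩ := resampleDist_of_close (p := p) hε hc0 hc T.summable_a hclose hbig
  set r := resampleDist p ε b
  set E : Set (Fin d → ℤ) := {n | ε ≤ ‖b n‖}
  have hc1 : 0 < 1 - c := by linarith
  have hC₁ : 0 ≤ (1 + c) / (1 - c) * T.S := by positivity
  have hba : ∀ n, ‖T.a n‖ ≤ ‖b n‖ + c * ε := fun n => by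
    have := norm_sub_le (b n) (b n - T.a n)
    rw [sub_sub_cancel] at this
    linarith [hclose n]
  have hab : ∀ n, ‖b n‖ ≤ ‖T.a n‖ + c * ε := fun n => by
    have := norm_add_le (T.a n) (b n - T.a n)
    rw [add_sub_cancel] at this
    linarith [hclose n]
  have hz₁ : ∀ n ∈ E, r n = 0 → T.a n = 0 := fun n hn h => absurd h (hr1 n hn).1
  have hz₂ : ∀ n ∈ Eᶜ, p n = 0 → T.a n = 0 := fun n _ => T.eq_zero_of_dist_eq_zero hp n
  have hW₁ : ∀ n, ‖impWeight T.a r E K₁ n‖ ≤ (1 + c) / (1 - c) * T.S / K₁ :=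
    norm_impWeight_le (by exact_mod_cast hK₁) hC₁ fun n hn => (hr1 n hn).2
  have hW₂ := T.norm_impWeight_univ_le hC₀ hp hK₂ Eᶜ
  have hmass₁ : ∑' n, E.indicator (fun n => ‖T.a n‖) n ≤ T.S :=
    (T.summable_a.indicator E).tsum_le_tsum (Set.indicator_le_self' fun _ _ => norm_nonneg _)
      T.summable_a
  have hmass₂ : ∑' n, Eᶜ.indicator (fun n => ‖T.a n‖) n ≤ tailMass T.a (2 * ε) := by
    refine (T.summable_a.indicator Eᶜ).tsum_le_tsum (fun n => ?_) (T.summable_a.indicator _)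
    refine Set.indicator_le_indicator_of_subset (fun n hn => ?_) (fun _ => norm_nonneg _) n
    have hn' : ‖b n‖ < ε := not_le.1 hn
    have := hba n
    change ‖T.a n‖ < 2 * ε
    nlinarith
  have hmass₂0 : 0 ≤ ∑' n, Eᶜ.indicator (fun n => ‖T.a n‖) n :=
    tsum_nonneg fun n => Set.indicator_nonneg (fun _ _ => norm_nonneg _) n
  -- The resampled frequencies represent the kept modes and the fresh ones the discarded modes;
  -- together they reproduce f in the mean.
  let W : Fin K₁ ⊕ Fin K₂ → (Fin d → ℤ) → ℂ :=
    Sum.elim (fun _ => impWeight T.a r E K₁) (fun _ => impWeight T.a p Eᶜ K₂)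
  have h := T.lintegral_regExcess_add_gapTotal_le D hJ A (ι := Fin K₁ ⊕ Fin K₂)
    (Q := Sum.elim (fun _ => r) (fun _ => p)) (W := W)
    (c := max ((1 + c) / (1 - c) * T.S / K₁) (C₀ / K₂)) hτ hτ1 hm₁ hm₂ hA
    (fun k n => by
      rcases k with k | k
      · exact (hW₁ n).trans (le_max_left _ _)
      · exact (hW₂ n).trans (le_max_right _ _)) fun x => by
      have hs := T.summable_a_mul_mode x
      rw [Fintype.sum_sum_type]
      change ∑ _k : Fin K₁, ∫ n, impWeight T.a r E K₁ n * mode T.L n x ∂r.toMeasure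
        + ∑ _k : Fin K₂, ∫ n, impWeight T.a p Eᶜ K₂ n * mode T.L n x ∂p.toMeasure = T.f x
      rw [T.sum_integral_impWeight_mode hK₁ hz₁ hW₁, T.sum_integral_impWeight_mode hK₂ hz₂ hW₂,
        ← (hs.indicator E).tsum_add (hs.indicator Eᶜ), ← (T.hasSum_f x).tsum_eq]
      exact tsum_congr fun n => Set.indicator_self_add_compl_apply E _ n
  refine T.mul_mixedRisk_le D hτ hτ1 hm₁ hm₂ hA (h.trans (add_le_add
    (ENNReal.ofReal_le_ofReal (approxBound_mono hm₁.le hm₂.le ?_ ?_ ?_)) ?_))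
  · exact Finset.sum_nonneg fun _ _ => integral_nonneg fun _ => by positivity
  · rw [Fintype.sum_sum_type]
    refine add_le_add ?_ ?_
    · have := T.sum_integral_impWeight_pow_le hK₁ hz₁ hW₁ 1
      rw [pow_one] at this
      exact this.trans (by gcongr)
    · have := T.sum_integral_impWeight_pow_le hK₂ hz₂ hW₂ 1
      rw [pow_one] at this
      exact this.trans (by gcongr)
  · rw [Fintype.sum_sum_type]
    refine add_le_add ?_ ?_
    · exact (T.sum_integral_impWeight_pow_le hK₁ hz₁ hW₁ 3).trans (by gcongr)
    · exact (T.sum_integral_impWeight_pow_le hK₂ hz₂ hW₂ 3).trans (by gcongr)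
  · have := T.expGap_le_poolGap A p D (ι := Fin K₁ ⊕ Fin K₂) (Sum.elim (fun _ => r) (fun _ => p))
      (Finset.univ.image Sum.inr) (fun i hi => by
        obtain ⟨k, -, rfl⟩ := Finset.mem_image.1 hi
        rfl) (fun i hi m hm => by
        rcases i with k | k
        · refine hr0 m ?_
          have h1 : ‖T.a m‖ < ε / 2 := not_le.1 fun h => hm (hmem m h)
          have := hab m
          nlinarith
        · exact absurd (Finset.mem_image_of_mem _ (Finset.mem_univ k)) hi) hτ hm₁ hm₂
    rwa [Finset.card_image_of_injective _ Sum.inr_injective, Finset.card_univ, Fintype.card_fin,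
      Fintype.card_sum, Fintype.card_fin, Fintype.card_fin] at this

/-- The initial distribution plus the empirical distribution of the initial frequencies. -/
noncomputable def poolMeasure (p : PMF (Fin d → ℤ)) {K : ℕ} (ν : Fin K → Fin d → ℤ) :
    Measure (Fin d → ℤ) :=
  p.toMeasure + ENNReal.ofReal (1 / K) • ∑ k, Measure.dirac (ν k)

theorem poolMeasure_univ {K : ℕ} (hK : 0 < K) (ν : Fin K → Fin d → ℤ) :
    poolMeasure p ν Set.univ = 2 := by
  have hKr : (0 : ℝ) < K := by exact_mod_cast hK
  rw [poolMeasure, Measure.add_apply, measure_univ, Measure.smul_apply, Measure.finsetSum_apply]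
  simp only [measure_univ, Finset.sum_const, Finset.card_univ, Fintype.card_fin, nsmul_eq_mul,
    mul_one, smul_eq_mul]
  rw [← ENNReal.ofReal_natCast, ← ENNReal.ofReal_mul (by positivity), one_div_mul_cancel hKr.ne',
    ENNReal.ofReal_one]
  norm_num

/-- When nothing is known about the resampled frequencies, the comparison amplitudes vanish on them
and the K₂ samples from p represent all of f. The gaps at the resampled frequencies remain, and are
handled by domination. -/
theorem mixedRisk_le_dominated {K : ℕ} (hC₀ : 0 ≤ C₀) (hp : ∀ n, ‖T.a n‖ ≤ C₀ * (p n).toReal)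
    (hJ : 0 < J) (hK : 0 < K) (hK₂ : 0 < K₂) (hm₁ : 0 < m₁) (hm₂ : 0 < m₂) {ε X : ℝ} (hε : 0 < ε)
    (ν : Fin K → Fin d → ℤ) (v : Fin K → ℂ) (hX : 1 + K * (∑ k, ‖v k‖ ^ 2) / ε ^ 2 ≤ X) :
    ENNReal.ofReal (1 / 4) * T.mixedRisk D (resampleDist p ε (collected ν v)) p K₁ K₂ m₁ m₂
      ≤ ENNReal.ofReal (approxBound m₁ m₂ (C₀ / K₂ * T.S) ((C₀ / K₂) ^ 3 * T.S))
        + T.dominatedGap D (poolMeasure p ν) (K₁ + K₂) X ε m₁ m₂ := by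
  have hKr : (0 : ℝ) < K := by exact_mod_cast hK
  have hV : 0 ≤ ∑ k, ‖v k‖ ^ 2 := Finset.sum_nonneg fun _ _ => by positivity
  have hX1 : 1 ≤ X := le_trans (le_add_of_nonneg_right (by positivity)) hX
  have hle := resampleDist_toMeasure_le (p := p) ν v hε
  set r := resampleDist p ε (collected ν v)
  have hp1 : p.toMeasure ≤ ENNReal.ofReal X • p.toMeasure := by
    refine Measure.le_iff.2 fun s _ => ?_
    rw [Measure.smul_apply, smul_eq_mul]
    exact le_mul_of_one_le_left zero_le (ENNReal.one_le_ofReal.2 hX1)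
  have hQp : p.toMeasure ≤ ENNReal.ofReal X • poolMeasure p ν := by
    rw [poolMeasure, smul_add]
    exact hp1.trans (Measure.le_add_right le_rfl)
  have hQr : r.toMeasure ≤ ENNReal.ofReal X • poolMeasure p ν := by
    rw [poolMeasure, smul_add]
    refine hle.trans (add_le_add hp1 ?_)
    rw [smul_smul, ← ENNReal.ofReal_mul (by linarith)]
    refine Measure.le_iff.2 fun s _ => ?_
    rw [Measure.smul_apply, Measure.smul_apply, smul_eq_mul, smul_eq_mul]
    refine mul_le_mul' (ENNReal.ofReal_le_ofReal ?_) le_rfl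
    rw [mul_one_div, le_div_iff₀ hKr]
    refine le_trans (le_of_eq ?_) ((le_add_of_nonneg_left zero_le_one).trans hX)
    ring
  have hW := T.norm_impWeight_univ_le hC₀ hp hK₂ Set.univ
  have hr : ∀ n ∈ (Set.univ : Set (Fin d → ℤ)), p n = 0 → T.a n = 0 := fun n _ =>
    T.eq_zero_of_dist_eq_zero hp n
  have h0 : T.β * Real.sqrt (T.gapInner ∅ D) ≤ 1 / 4 := by simp [gapInner]
  let W : Fin K₁ ⊕ Fin K₂ → (Fin d → ℤ) → ℂ :=
    Sum.elim (fun _ _ => 0) (fun _ => impWeight T.a p Set.univ K₂)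
  have h := T.lintegral_regExcess_add_gapTotal_le D hJ ∅ (ι := Fin K₁ ⊕ Fin K₂)
    (Q := Sum.elim (fun _ => r) (fun _ => p)) (W := W) (c := C₀ / K₂) one_pos le_rfl hm₁ hm₂ h0
    (fun k n => by
      rcases k with k | k
      · change ‖(0 : ℂ)‖ ≤ _
        rw [norm_zero]
        positivity
      · exact hW n) fun x => by
      rw [Fintype.sum_sum_type]
      change ∑ _k : Fin K₁, ∫ n, 0 * mode T.L n x ∂r.toMeasure
        + ∑ _k : Fin K₂, ∫ n, impWeight T.a p Set.univ K₂ n * mode T.L n x ∂p.toMeasure = T.f x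
      rw [T.sum_integral_impWeight_mode hK₂ hr hW]
      simpa using (T.hasSum_f x).tsum_eq
  have h2 := T.mul_mixedRisk_le D (p := p) (r := r) one_pos le_rfl hm₁ hm₂ h0 (h.trans (add_le_add
    (ENNReal.ofReal_le_ofReal (approxBound_mono hm₁.le hm₂.le
      (S₁' := C₀ / K₂ * T.S) (S₂' := (C₀ / K₂) ^ 3 * T.S) ?_ ?_ ?_))
    (T.expGap_le_dominatedGap D hJ (Sum.elim (fun _ => r) (fun _ => p)) (π := poolMeasure p ν) (X := X) hX1 hε hm₁ hm₂ ?_)))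
  · rw [Fintype.card_sum, Fintype.card_fin, Fintype.card_fin] at h2
    norm_num at h2 ⊢
    exact h2
  · exact Finset.sum_nonneg fun _ _ => integral_nonneg fun _ => by positivity
  · rw [Fintype.sum_sum_type]
    have := T.sum_integral_impWeight_pow_le hK₂ hr hW 1
    rw [pow_one, tsum_indicator_univ_norm] at this
    simpa [W] using this
  · rw [Fintype.sum_sum_type]
    have := T.sum_integral_impWeight_pow_le hK₂ hr hW 3
    rw [tsum_indicator_univ_norm] at this
    simpa [W] using this
  · rintro (k | k)
    · exact hQr
    · exact hQp

end SecondStage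

end Target

end RFF

open MeasureTheory ProbabilityTheory
open scoped ENNReal ComplexConjugate

namespace RFF

namespace Target

variable {d : ℕ} (T : Target d)

/-! ### Means of the terms that appear when the first stage fails. -/

section Means

variable {J : ℕ} (hJ : 0 < J) {p : PMF (Fin d → ℤ)} {K : ℕ} (hK : 0 < K)

include hJ

theorem heavySq_meanLe {Y : Type*} [MeasurableSpace Y] [Countable Y] [MeasurableSingletonClass Y]
    {R : Measure Y} [IsProbabilityMeasure R] :
    MeanLe (dataLaw T.μ T.N J) R (fun D _ => ENNReal.ofReal (T.heavySq D))
      ((16 * T.s ^ 2 + 4) * (T.noiseTail (Real.sqrt J) / J)) := by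
  have hJr : (0 : ℝ) < J := by exact_mod_cast hJ
  have hn := T.noiseTail_nonneg (Real.sqrt J)
  have hns := T.noiseTail_le (Real.sqrt J)
  have hprob : IsProbabilityMeasure (dataLaw T.μ T.N J) := by unfold dataLaw; infer_instance
  have hm : Measurable fun D : Fin J → (Fin d → ℝ) × ℝ => T.heavyGap D := T.measurable_heavyGap
  have m1 : MeanLe (dataLaw T.μ T.N J) R
      (fun _ _ => ENNReal.ofReal (16 * (T.noiseTail (Real.sqrt J) / Real.sqrt J) ^ 2)) _ :=
    MeanLe.const (by positivity)
  have m2 := (MeanLe.of_left (Q := R) (b := T.noiseTail (Real.sqrt J) / J) (by positivity)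
    (hm.norm.pow_const 2).ennreal_ofReal (T.lintegral_heavyGap_sq_le hJ)).const_mul
      (r := 4) (by norm_num)
  refine (m1.add m2).mono (fun _ => ?_) (fun D _ => le_of_eq ?_) ?_
  · unfold heavySq
    fun_prop
  · rw [heavySq, ENNReal.ofReal_add (by positivity) (by positivity),
      ENNReal.ofReal_mul (p := 4) (by norm_num)]
  · rw [div_pow, Real.sq_sqrt hJr.le]
    have : T.noiseTail (Real.sqrt J) ^ 2 / J ≤ T.s ^ 2 * (T.noiseTail (Real.sqrt J) / J) := by
      rw [sq, mul_div_assoc]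
      gcongr
    linarith

theorem sqGap_sq_meanLe {Y : Type*} [MeasurableSpace Y] [Countable Y] [MeasurableSingletonClass Y]
    {R : Measure Y} [IsProbabilityMeasure R] :
    MeanLe (dataLaw T.μ T.N J) R (fun D _ => ENNReal.ofReal (‖T.sqGap ∅ D‖ ^ 2))
      (T.S ^ 2 * T.V / J) := by
  have := T.V_nonneg
  exact MeanLe.of_left (by positivity) ((T.measurable_sqGap ∅).norm.pow_const 2).ennreal_ofReal
    (T.lintegral_sqGap_sq_le hJ ∅ (by simp))

include hK

/-- For each fixed ν the pool measure has mass 2 and does not depend on the data, so uniform moment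
bounds apply although the resampling law itself depends on both. -/
theorem linCut_meanLe :
    MeanLe (dataLaw T.μ T.N J) (freqLaw p K)
      (fun D ν => ∫⁻ n, ENNReal.ofReal ((J * ‖T.linCut D n‖ ^ 2) ^ 10) ∂(poolMeasure p ν))
      (2 * momentConst 10 (T.S + 1 + T.V)) := by
  have hprob' : IsProbabilityMeasure (freqLaw p K) := by unfold freqLaw; infer_instance
  have hm : ∀ n, Measurable fun D : Fin J → (Fin d → ℝ) × ℝ =>
      ENNReal.ofReal ((J * ‖T.linCut D n‖ ^ 2) ^ 10) := fun n =>
    ((((T.measurable_linCut n).norm.pow_const 2).const_mul _).pow_const 10).ennreal_ofReal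
  have h0 := momentConst_nonneg 10 (T.S + 1 + T.V)
  refine MeanLe.of_forall (by positivity) (fun ν => measurable_lintegral_countable hm) fun ν => ?_
  refine (lintegral_lintegral_countable_le hm
    fun n => T.lintegral_linCut_pow_le hJ n 10).trans (le_of_eq ?_)
  rw [poolMeasure_univ hK, mul_comm, ENNReal.ofReal_mul (by norm_num)]
  norm_num

theorem γ_meanLe :
    MeanLe (dataLaw T.μ T.N J) (freqLaw p K)
      (fun D ν => ∫⁻ n, ∫⁻ m, ENNReal.ofReal ((J * ‖T.γ D (n - m)‖ ^ 2) ^ 10)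
        ∂(poolMeasure p ν) ∂(poolMeasure p ν)) (4 * momentConst 10 1) := by
  have hprob' : IsProbabilityMeasure (freqLaw p K) := by unfold freqLaw; infer_instance
  have hm : ∀ n, Measurable fun D : Fin J → (Fin d → ℝ) × ℝ =>
      ENNReal.ofReal ((J * ‖T.γ D n‖ ^ 2) ^ 10) := fun n =>
    ((((T.measurable_γ n).norm.pow_const 2).const_mul _).pow_const 10).ennreal_ofReal
  have h0 := momentConst_nonneg 10 1
  refine MeanLe.of_forall (by positivity) (fun ν => measurable_lintegral_countable fun n =>
    measurable_lintegral_countable fun m => hm (n - m)) fun ν => ?_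
  refine (lintegral_lintegral_countable_le (fun n => measurable_lintegral_countable fun m =>
    hm (n - m)) fun n => lintegral_lintegral_countable_le (fun m => hm (n - m))
      fun m => T.lintegral_γ_pow_le hJ (n - m) 10).trans (le_of_eq ?_)
  rw [poolMeasure_univ hK, mul_assoc, mul_comm, ENNReal.ofReal_mul (by norm_num)]
  norm_num

end Means

/-! ### The two cases combined, with all constants explicit. -/

section TwoStages

variable {J : ℕ} (D : Fin J → (Fin d → ℝ) × ℝ) {p : PMF (Fin d → ℤ)} {K K₁ K₂ : ℕ}
  {C₀ l₁ l₂ m₁ m₂ τ c ε : ℝ} {A : Finset (Fin d → ℤ)}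

/-- The approximation bound when the first stage is successful. -/
noncomputable def goodApprox (K₁ K₂ : ℕ) (C₀ m₁ m₂ c ε : ℝ) : ℝ :=
  approxBound m₁ m₂ ((1 + c) / (1 - c) * T.S / K₁ * T.S + C₀ / K₂ * tailMass T.a (2 * ε))
    (((1 + c) / (1 - c) * T.S / K₁) ^ 3 * T.S + (C₀ / K₂) ^ 3 * tailMass T.a (2 * ε))

/-- The part of the error bound that does not depend on the data, when the first stage fails. -/
noncomputable def badConst (J K₁ K₂ : ℕ) (C₀ m₁ m₂ ε : ℝ) : ℝ :=
  approxBound m₁ m₂ (C₀ / K₂ * T.S) ((C₀ / K₂) ^ 3 * T.S)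
    + (((K₁ + K₂ : ℕ) : ℝ) ^ 2 / (2 * m₂ * J) + 4 * ((K₁ + K₂ : ℕ) : ℝ) / (m₁ * J)) * (1 / ε)
    + 1 / (ε * Real.sqrt J)

/-- A bound for the mean of the data dependent part of the error when the first stage fails. -/
noncomputable def badMean (J K₁ K₂ : ℕ) (l₁ m₁ m₂ ε b : ℝ) (K : ℕ) : ℝ :=
  (((K₁ + K₂ : ℕ) : ℝ) ^ 2 / (2 * m₂ * J) + 4 * ((K₁ + K₂ : ℕ) : ℝ) / (m₁ * J))
      * (ε ^ 3 * (1 + 2 * K / (l₁ * ε ^ 2) * b))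
    + ((K₁ + K₂ : ℕ) : ℝ) ^ 2 / (2 * m₂ * J) * ε * (4 * momentConst 10 1)
    + 4 * ((K₁ + K₂ : ℕ) : ℝ) / (m₁ * J) * ε * (2 * momentConst 10 (T.S + 1 + T.V))
    + 2 * ((K₁ + K₂ : ℕ) : ℝ) / m₁ * ((16 * T.s ^ 2 + 4) * (T.noiseTail (Real.sqrt J) / J))
    + ε * Real.sqrt J * (T.S ^ 2 * T.V / J)

/-- The bound for the error of the resampled method. -/
noncomputable def totalBound (J K K₁ K₂ : ℕ) (C₀ l₁ m₁ m₂ τ c ε Acard t b : ℝ) : ℝ :=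
  1 / (1 - 3 * τ / 4) * (T.goodApprox K₁ K₂ C₀ m₁ m₂ c ε
      + T.poolBound J Acard (K₁ + K₂) K₂ τ m₁ m₂ t)
    + 4 * T.badConst J K₁ K₂ C₀ m₁ m₂ ε
      * (4 * T.β / (c * ε) ^ 2 * b + 16 * T.β ^ 2 / τ ^ 2 * (Acard ^ 2 / J))
    + 4 * T.badMean J K₁ K₂ l₁ m₁ m₂ ε b K

/-- The data dependent part of the error when the first stage fails. -/
noncomputable def badRest (p : PMF (Fin d → ℤ)) (K₁ K₂ : ℕ) (l₁ l₂ m₁ m₂ ε : ℝ)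
    (ν : Fin K → Fin d → ℤ) : ℝ≥0∞ :=
  ENNReal.ofReal ((((K₁ + K₂ : ℕ) : ℝ) ^ 2 / (2 * m₂ * J) + 4 * ((K₁ + K₂ : ℕ) : ℝ) / (m₁ * J)))
      * (ENNReal.ofReal (ε ^ 3) * (ENNReal.ofReal 1 + ENNReal.ofReal (2 * K / (l₁ * ε ^ 2))
        * ENNReal.ofReal (T.stageOne D p l₁ l₂ ν)))
    + ENNReal.ofReal (((K₁ + K₂ : ℕ) : ℝ) ^ 2 / (2 * m₂ * J) * ε)
      * (∫⁻ n, ∫⁻ m, ENNReal.ofReal ((J * ‖T.γ D (n - m)‖ ^ 2) ^ 10)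
        ∂(poolMeasure p ν) ∂(poolMeasure p ν))
    + ENNReal.ofReal (4 * ((K₁ + K₂ : ℕ) : ℝ) / (m₁ * J) * ε)
      * (∫⁻ n, ENNReal.ofReal ((J * ‖T.linCut D n‖ ^ 2) ^ 10) ∂(poolMeasure p ν))
    + ENNReal.ofReal (2 * ((K₁ + K₂ : ℕ) : ℝ) / m₁) * ENNReal.ofReal (T.heavySq D)
    + ENNReal.ofReal (ε * Real.sqrt J) * ENNReal.ofReal (‖T.sqGap ∅ D‖ ^ 2)

/-- This quantity is at least `1` when the first stage fails. -/
noncomputable def failure (p : PMF (Fin d → ℤ)) (A : Finset (Fin d → ℤ)) (l₁ l₂ τ c ε : ℝ)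
    (ν : Fin K → Fin d → ℤ) : ℝ≥0∞ :=
  ENNReal.ofReal (4 * T.β / (c * ε) ^ 2) * ENNReal.ofReal (T.stageOne D p l₁ l₂ ν)
    + ENNReal.ofReal (16 * T.β ^ 2 / τ ^ 2) * ENNReal.ofReal (T.gapInner A D)

theorem badConst_nonneg (hC₀ : 0 ≤ C₀) (hm₁ : 0 < m₁) (hm₂ : 0 < m₂) (hε : 0 < ε) :
    0 ≤ T.badConst J K₁ K₂ C₀ m₁ m₂ ε := by
  have := T.S_pos
  unfold badConst approxBound
  positivity

/-- The bound is split into a constant, to be multiplied by the failure probability, and a remainder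
whose mean is small even without it. -/
theorem dominatedGap_le (hJ : 0 < J) (hK : 0 < K) (hl₁ : 0 < l₁) (hl₂ : 0 < l₂) (hm₁ : 0 < m₁)
    (hm₂ : 0 < m₂) (hε : 0 < ε) (hC₀ : 0 ≤ C₀) (ν : Fin K → Fin d → ℤ) :
    ENNReal.ofReal (approxBound m₁ m₂ (C₀ / K₂ * T.S) ((C₀ / K₂) ^ 3 * T.S))
        + T.dominatedGap D (poolMeasure p ν) (K₁ + K₂)
          (1 + 2 * K / (l₁ * ε ^ 2) * T.stageOne D p l₁ l₂ ν) ε m₁ m₂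
      ≤ ENNReal.ofReal (T.badConst J K₁ K₂ C₀ m₁ m₂ ε) + T.badRest D p K₁ K₂ l₁ l₂ m₁ m₂ ε ν := by
  have hS := T.S_pos
  have hJr : (0 : ℝ) < J := by exact_mod_cast hJ
  have hsJ : 0 < Real.sqrt J := Real.sqrt_pos.2 hJr
  have hΔ := T.stageOne_nonneg D (p := p) hl₁ hl₂ ν
  have happ : 0 ≤ approxBound m₁ m₂ (C₀ / K₂ * T.S) ((C₀ / K₂) ^ 3 * T.S) := by
    unfold approxBound
    positivity
  have hX : ENNReal.ofReal (1 / ε + ε ^ 3 * (1 + 2 * K / (l₁ * ε ^ 2) * T.stageOne D p l₁ l₂ ν))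
      = ENNReal.ofReal (1 / ε) + ENNReal.ofReal (ε ^ 3) * (ENNReal.ofReal 1
        + ENNReal.ofReal (2 * K / (l₁ * ε ^ 2)) * ENNReal.ofReal (T.stageOne D p l₁ l₂ ν)) := by
    rw [← ENNReal.ofReal_mul (by positivity), ← ENNReal.ofReal_add (by positivity) (by positivity),
      ← ENNReal.ofReal_mul (by positivity), ← ENNReal.ofReal_add (by positivity) (by positivity)]
  -- Threshold 1/(ε√J): it joins the constant part, and the quadratic term has mean of order ε/√J.
  have hsq : ENNReal.ofReal ‖T.sqGap ∅ D‖ ≤ ENNReal.ofReal (1 / (ε * Real.sqrt J))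
      + ENNReal.ofReal (ε * Real.sqrt J) * ENNReal.ofReal (‖T.sqGap ∅ D‖ ^ 2) := by
    rw [← ENNReal.ofReal_mul (by positivity), ← ENNReal.ofReal_add (by positivity) (by positivity)]
    refine ENNReal.ofReal_le_ofReal ((self_le_add_pow_div (norm_nonneg (T.sqGap ∅ D))
      (t := 1 / (ε * Real.sqrt J)) (by positivity) 1).trans (le_of_eq ?_))
    field_simp
  unfold dominatedGap badConst badRest
  rw [hX]
  refine (add_le_add le_rfl (add_le_add le_rfl hsq)).trans (le_of_eq ?_)
  set κ₂ := ((K₁ + K₂ : ℕ) : ℝ) ^ 2 / (2 * m₂ * J)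
  set κ₁ := 4 * ((K₁ + K₂ : ℕ) : ℝ) / (m₁ * J)
  have hκ₂ : 0 ≤ κ₂ := by positivity
  have hκ₁ : 0 ≤ κ₁ := by positivity
  rw [ENNReal.ofReal_add (p := _ + (κ₂ + κ₁) * (1 / ε)) (by positivity) (by positivity),
    ENNReal.ofReal_add happ (by positivity), ENNReal.ofReal_mul (add_nonneg hκ₂ hκ₁),
    ENNReal.ofReal_add hκ₂ hκ₁, ENNReal.ofReal_mul hκ₂, ENNReal.ofReal_mul hκ₁]
  ring

/-- The indicator of failure is replaced by `failure`, which is measurable in the data and at least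
1 there, as in Markov's inequality. -/
theorem mixedRisk_le (hC₀ : 0 ≤ C₀) (hp : ∀ n, ‖T.a n‖ ≤ C₀ * (p n).toReal) (hJ : 0 < J)
    (hK : 0 < K) (hK₁ : 0 < K₁) (hK₂ : 0 < K₂) (hl₁ : 0 < l₁) (hl₂ : 0 < l₂) (hm₁ : 0 < m₁)
    (hm₂ : 0 < m₂) (hτ : 0 < τ) (hτ1 : τ ≤ 1) (hε : 0 < ε) (hc0 : 0 < c) (hc : c ≤ 1 / 2)
    (hbig : ∃ n, 2 * ε ≤ ‖T.a n‖) (hmem : ∀ n, ε / 2 ≤ ‖T.a n‖ → n ∈ A)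
    (ν : Fin K → Fin d → ℤ) :
    T.mixedRisk D (resampleDist p ε (collected ν
        (amplitudes T.L l₁ l₂ ν (fun j => (D j).1) (noisyValues T.f D)))) p K₁ K₂ m₁ m₂
      ≤ ENNReal.ofReal (1 / (1 - 3 * τ / 4)) * (ENNReal.ofReal (T.goodApprox K₁ K₂ C₀ m₁ m₂ c ε)
          + T.poolGap A p (K₁ + K₂) K₂ D τ m₁ m₂)
        + ENNReal.ofReal (4 * T.badConst J K₁ K₂ C₀ m₁ m₂ ε) * T.failure D p A l₁ l₂ τ c ε ν
        + ENNReal.ofReal 4 * T.badRest D p K₁ K₂ l₁ l₂ m₁ m₂ ε ν := by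
  have hβ := T.β_pos
  have hKr : (0 : ℝ) < K := by exact_mod_cast hK
  have hΔ := T.stageOne_nonneg D (p := p) hl₁ hl₂ ν
  have hv := T.risk_add_le_stageOne D (p := p) hl₁ hl₂ ν
  set v := amplitudes T.L l₁ l₂ ν (fun j => (D j).1) (noisyValues T.f D)
  dsimp only at hv
  set Δ := T.stageOne D p l₁ l₂ ν
  set R := T.mixedRisk D (resampleDist p ε (collected ν v)) p K₁ K₂ m₁ m₂
  have hrisk := T.risk_nonneg (network T.L ν v)
  have hV : 0 ≤ ∑ k, ‖v k‖ ^ 2 := Finset.sum_nonneg fun _ _ => by positivity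
  have hback : ∀ {s : ℝ} {B : ℝ≥0∞}, 0 < s → ENNReal.ofReal s * R ≤ B →
      R ≤ ENNReal.ofReal (1 / s) * B := by
    intro s B hs h
    calc R = ENNReal.ofReal (1 / s) * (ENNReal.ofReal s * R) := by
          rw [← mul_assoc, ← ENNReal.ofReal_mul (by positivity), one_div_mul_cancel hs.ne',
            ENNReal.ofReal_one, one_mul]
      _ ≤ _ := mul_le_mul' le_rfl h
  -- The first condition makes all collected amplitudes accurate to cε by Bessel's inequality; the
  -- second lets the inner gaps of A be absorbed.
  by_cases hgood : 4 * T.β * Δ ≤ (c * ε) ^ 2 ∧ T.β * Real.sqrt (T.gapInner A D) ≤ τ / 4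
  · refine le_trans ?_ (le_trans le_self_add le_self_add)
    refine hback (by linarith) (T.mixedRisk_le_of_close D hC₀ hp hJ hK₁ hK₂ hm₁ hm₂ hτ hτ1 hε
      hc0.le hc (fun n => ?_) hbig hmem hgood.2)
    have h1 := T.bessel ν v {n}
    rw [Finset.sum_singleton] at h1
    have h2 : T.β * T.risk (network T.L ν v) ≤ (c * ε) ^ 2 := by
      refine le_trans ?_ hgood.1
      have : T.risk (network T.L ν v) ≤ 4 * Δ := by
        have := mul_nonneg (half_pos hl₁).le hV
        linarith
      nlinarith
    exact (pow_le_pow_iff_left₀ (norm_nonneg _) (by positivity) two_ne_zero).1 (h1.trans h2)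
  -- The first-stage penalty bounds ∑|v|² by 2Δ/l₁, which fixes the domination factor X.
  · have hX : 1 + K * (∑ k, ‖v k‖ ^ 2) / ε ^ 2 ≤ 1 + 2 * K / (l₁ * ε ^ 2) * Δ := by
      have h1 : ∑ k, ‖v k‖ ^ 2 ≤ 2 / l₁ * Δ := by
        rw [div_mul_eq_mul_div, le_div_iff₀ hl₁]
        nlinarith
      calc _ ≤ 1 + K * (2 / l₁ * Δ) / ε ^ 2 := by gcongr
        _ = _ := by field_simp
    have h := hback (by norm_num) (T.mixedRisk_le_dominated (K₁ := K₁) D hC₀ hp hJ hK hK₂ hm₁ hm₂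
      hε ν v hX)
    have hfail : 1 ≤ T.failure D p A l₁ l₂ τ c ε ν := by
      have hg := T.gapInner_nonneg A D
      unfold failure
      rw [← ENNReal.ofReal_mul (by positivity), ← ENNReal.ofReal_mul (by positivity)]
      rcases not_and_or.1 hgood with h1 | h1
      · refine le_trans ?_ le_self_add
        rw [ENNReal.one_le_ofReal, div_mul_eq_mul_div, one_le_div (by positivity)]
        exact (not_le.1 h1).le
      · refine le_trans ?_ le_add_self
        rw [ENNReal.one_le_ofReal, div_mul_eq_mul_div, one_le_div (by positivity)]
        -- Squaring turns √gapInner into a quantity with a known mean.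
        have h2 := pow_le_pow_left₀ (by positivity) (not_le.1 h1).le 2
        rw [mul_pow, Real.sq_sqrt hg] at h2
        nlinarith
    have hb := T.badConst_nonneg (J := J) (K₁ := K₁) (K₂ := K₂) hC₀ hm₁ hm₂ hε
    calc R ≤ ENNReal.ofReal 4 * (ENNReal.ofReal (T.badConst J K₁ K₂ C₀ m₁ m₂ ε)
          + T.badRest D p K₁ K₂ l₁ l₂ m₁ m₂ ε ν) := by
          norm_num at h
          norm_num
          exact h.trans (mul_le_mul' le_rfl
            (T.dominatedGap_le D hJ hK hl₁ hl₂ hm₁ hm₂ hε hC₀ ν))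
      _ = ENNReal.ofReal (4 * T.badConst J K₁ K₂ C₀ m₁ m₂ ε) * 1
          + ENNReal.ofReal 4 * T.badRest D p K₁ K₂ l₁ l₂ m₁ m₂ ε ν := by
          rw [mul_add, ← ENNReal.ofReal_mul (by norm_num), mul_one]
      _ ≤ ENNReal.ofReal (4 * T.badConst J K₁ K₂ C₀ m₁ m₂ ε) * T.failure D p A l₁ l₂ τ c ε ν
          + ENNReal.ofReal 4 * T.badRest D p K₁ K₂ l₁ l₂ m₁ m₂ ε ν :=
          add_le_add (mul_le_mul' le_rfl hfail) le_rfl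
      _ ≤ _ := add_le_add le_add_self le_rfl

/-- The error bound for the resampled method, with all constants explicit. -/
theorem lintegral_mixedRisk_le {t : ℝ} (hC₀ : 0 ≤ C₀) (hp : ∀ n, ‖T.a n‖ ≤ C₀ * (p n).toReal)
    (hJ : 0 < J) (hK : 0 < K) (hK₁ : 0 < K₁) (hK₂ : 0 < K₂) (hl₁ : 0 < l₁) (hl₂ : 0 < l₂)
    (hm₁ : 0 < m₁) (hm₂ : 0 < m₂) (hτ : 0 < τ) (hτ1 : τ ≤ 1) (hε : 0 < ε) (hc0 : 0 < c)
    (hc : c ≤ 1 / 2) (hbig : ∃ n, 2 * ε ≤ ‖T.a n‖) (hmem : ∀ n, ε / 2 ≤ ‖T.a n‖ → n ∈ A)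
    (ht : 0 < t) (hA : T.S - ∑ n ∈ A, ‖T.a n‖ ≤ t) :
    ∫⁻ D, ∫⁻ ν, T.mixedRisk D (resampleDist p ε (collected ν
        (amplitudes T.L l₁ l₂ ν (fun j => (D j).1) (noisyValues T.f D)))) p K₁ K₂ m₁ m₂
        ∂(freqLaw p K) ∂(dataLaw T.μ T.N J)
      ≤ ENNReal.ofReal (T.totalBound J K K₁ K₂ C₀ l₁ m₁ m₂ τ c ε A.card t
          (T.stageOneBound J K C₀ l₁ l₂)) := by
  have hS := T.S_pos
  have hβ := T.β_pos
  have hprob : IsProbabilityMeasure (dataLaw T.μ T.N J) := by unfold dataLaw; infer_instance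
  have hprob' : IsProbabilityMeasure (freqLaw p K) := by unfold freqLaw; infer_instance
  have htail := tailMass_nonneg T.a (2 * ε)
  have hc1 : 0 < 1 - c := by linarith
  have hτ2 : 0 < 1 - 3 * τ / 4 := by linarith
  have hb := T.badConst_nonneg (J := J) (K₁ := K₁) (K₂ := K₂) hC₀ hm₁ hm₂ hε
  have hJr : (0 : ℝ) < J := by exact_mod_cast hJ
  have mΔ := T.meanLe_stageOne hC₀ hp hJ hK hl₁ hl₂
  have mgood := ((MeanLe.const (P := dataLaw T.μ T.N J) (Q := freqLaw p K)
    (b := T.goodApprox K₁ K₂ C₀ m₁ m₂ c ε) (by unfold goodApprox approxBound; positivity)).add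
    (T.meanLe_poolGap A p (K₁ + K₂) K₂ (R := freqLaw p K) hJ hτ hm₁ hm₂ ht hA)).const_mul
      (r := 1 / (1 - 3 * τ / 4)) (by positivity)
  have mfail := ((mΔ.const_mul (r := 4 * T.β / (c * ε) ^ 2) (by positivity)).add
    ((MeanLe.of_left (P := dataLaw T.μ T.N J) (Q := freqLaw p K) (b := A.card ^ 2 / J)
      (by positivity) (T.measurable_gapInner A).ennreal_ofReal
      (T.lintegral_gapInner_le hJ A)).const_mul (r := 16 * T.β ^ 2 / τ ^ 2)
        (by positivity))).const_mul (r := 4 * T.badConst J K₁ K₂ C₀ m₁ m₂ ε) (by positivity)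
  have m1 := ((((MeanLe.const (P := dataLaw T.μ T.N J) (Q := freqLaw p K) zero_le_one).add
    (mΔ.const_mul (r := 2 * K / (l₁ * ε ^ 2)) (by positivity))).const_mul
      (r := ε ^ 3) (by positivity)).const_mul
      (r := ((K₁ + K₂ : ℕ) : ℝ) ^ 2 / (2 * m₂ * J) + 4 * ((K₁ + K₂ : ℕ) : ℝ) / (m₁ * J))
        (by positivity))
  have m2 := (T.γ_meanLe hJ (p := p) hK).const_mul
    (r := ((K₁ + K₂ : ℕ) : ℝ) ^ 2 / (2 * m₂ * J) * ε) (by positivity)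
  have m3 := (T.linCut_meanLe hJ (p := p) hK).const_mul
    (r := 4 * ((K₁ + K₂ : ℕ) : ℝ) / (m₁ * J) * ε) (by positivity)
  have m4 := (T.heavySq_meanLe hJ (R := freqLaw p K)).const_mul
    (r := 2 * ((K₁ + K₂ : ℕ) : ℝ) / m₁) (by positivity)
  have m5 := (T.sqGap_sq_meanLe hJ (R := freqLaw p K)).const_mul
    (r := ε * Real.sqrt J) (by positivity)
  have mbad := ((((m1.add m2).add m3).add m4).add m5).const_mul (r := 4) (by norm_num)
  -- Monotonicity of the lower integral needs no measurability, so the minimizer may be an arbitrary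
  -- choice.
  exact (lintegral_mono fun D => lintegral_mono fun ν => T.mixedRisk_le D hC₀ hp hJ hK hK₁ hK₂ hl₁
    hl₂ hm₁ hm₂ hτ hτ1 hε hc0 hc hbig hmem ν).trans ((mgood.add mfail).add mbad).le

end TwoStages

theorem resampledError_eq (p : PMF (Fin d → ℤ)) (K J : ℕ) (l₁ l₂ m₁ m₂ ε q : ℝ) :
    resampledError T.L T.f T.μ T.N p K J l₁ l₂ m₁ m₂ ε q
      = ∫⁻ D, ∫⁻ ν, T.mixedRisk D (resampleDist p ε (collected ν
        (amplitudes T.L l₁ l₂ ν (fun j => (D j).1) (noisyValues T.f D)))) p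
          ⌊(K : ℝ) * (1 - q)⌋₊ ⌈(K : ℝ) * q⌉₊ m₁ m₂
        ∂(freqLaw p K) ∂(dataLaw T.μ T.N J) := by
  unfold resampledError
  refine lintegral_congr fun D => lintegral_congr fun ν => ?_
  dsimp only
  rw [lintegral_freqLaw_freqLaw (F := fun ω => ∫⁻ z, ‖network T.L ω (amplitudes T.L m₁ m₂ ω
    (fun j => (D j).1) (noisyValues T.f D)) z - T.f z‖ₑ ^ 2 ∂T.μ), mixedRisk]
  refine lintegral_congr fun ω => lintegral_enorm_sq_eq ?_
  refine MemLp.of_bound ((continuous_network _ _).sub T.continuous_f).aestronglyMeasurable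
    ((∑ k, ‖amplitudes T.L m₁ m₂ ω (fun j => (D j).1) (noisyValues T.f D) k‖) + T.S)
    (Filter.Eventually.of_forall fun z => ?_)
  exact (norm_sub_le _ _).trans (add_le_add (T.norm_network_le ω _ z) (T.norm_f_le z))

end Target

end RFF

/-! ### Sizes of all terms in powers of e. -/

open MeasureTheory ProbabilityTheory
open scoped ENNReal ComplexConjugate

namespace RFF

/-- The parameters of the method in terms of `e`, where the generalization bound of the first stage
is `e ^ 8`. -/
structure Regime (R κ : ℝ) (J K K₁ K₂ : ℕ) (l₁ l₂ m₁ m₂ e q : ℝ) : Prop where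
  one_le_R : 1 ≤ R
  κ_pos : 0 < κ
  e_pos : 0 < e
  e_le_one : e ≤ 1
  le_q : κ * e ≤ q
  q_add_le : q + R * e ^ 8 ≤ 1 / 2
  J_pos : 0 < J
  K_pos : 0 < K
  inv_K_le : 1 / (K : ℝ) ≤ R * e ^ 8
  inv_sqrt_J_le : 1 / Real.sqrt J ≤ R * e ^ 8
  l₁_pos : 0 < l₁
  l₂_pos : 0 < l₂
  m₁_pos : 0 < m₁
  m₂_pos : 0 < m₂
  K_div_l₁_le : K / l₁ ≤ R / e ^ 8
  K_sq_div_l₂_le : (K : ℝ) ^ 2 / l₂ ≤ R / e ^ 8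
  K_div_m₁_le : K / m₁ ≤ R / e ^ 8
  K_sq_div_m₂_le : (K : ℝ) ^ 2 / m₂ ≤ R / e ^ 8
  l₁_div_K_le : l₁ / K ≤ R * e ^ 8
  l₂_div_K_sq_le : l₂ / (K : ℝ) ^ 2 ≤ R * e ^ 8
  m₁_div_K_le : m₁ / K ≤ R * e ^ 8
  m₂_div_K_sq_le : m₂ / (K : ℝ) ^ 2 ≤ R * e ^ 8
  le_K₁ : K * (1 - q) - 1 ≤ K₁
  K₁_le : (K₁ : ℝ) ≤ K
  le_K₂ : K * q ≤ K₂
  K₂_le : (K₂ : ℝ) ≤ K * q + 1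

namespace Regime

variable {R κ : ℝ} {J K K₁ K₂ : ℕ} {l₁ l₂ m₁ m₂ e q : ℝ}
  (h : Regime R κ J K K₁ K₂ l₁ l₂ m₁ m₂ e q)

include h

theorem K_pos' : (0 : ℝ) < K := by exact_mod_cast h.K_pos

theorem J_pos' : (0 : ℝ) < J := by exact_mod_cast h.J_pos

theorem R_pos : 0 < R := one_pos.trans_le h.one_le_R

theorem q_pos : 0 < q := (mul_pos h.κ_pos h.e_pos).trans_le h.le_q

theorem inv_J_le : 1 / (J : ℝ) ≤ R ^ 2 * e ^ 16 := by
  have h1 := pow_le_pow_left₀ (by positivity) h.inv_sqrt_J_le 2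
  rw [div_pow, Real.sq_sqrt h.J_pos'.le] at h1
  calc 1 / (J : ℝ) ≤ _ := by simpa using h1
    _ = _ := by ring

theorem inv_K_le_one : 1 / (K : ℝ) ≤ 1 := by
  rw [div_le_one h.K_pos']
  exact_mod_cast h.K_pos

theorem K₂_div_K_le : (K₂ : ℝ) / K ≤ q + R * e ^ 8 := by
  have h1 := h.K₂_le
  have h2 := h.inv_K_le
  have := h.K_pos'
  calc (K₂ : ℝ) / K ≤ (K * q + 1) / K := by gcongr
    _ = q + 1 / K := by field_simp
    _ ≤ _ := by linarith

theorem K₂_div_K_le_one : (K₂ : ℝ) / K ≤ 1 :=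
  h.K₂_div_K_le.trans (h.q_add_le.trans (by norm_num))

theorem K₂_div_K_le' : (K₂ : ℝ) / K ≤ (1 + R) * (e + q) := by
  have h0 := h.e_pos
  have h1 : e ^ 8 ≤ e := pow_le_of_le_one h.e_pos.le h.e_le_one (by norm_num)
  have h2 := mul_le_mul_of_nonneg_left h1 h.R_pos.le
  have h3 := mul_nonneg h.R_pos.le h.q_pos.le
  have := h.K₂_div_K_le
  nlinarith

theorem card_div_K_le : ((K₁ + K₂ : ℕ) : ℝ) / K ≤ 2 := by
  have h1 := h.K₁_le
  have h2 := h.K₂_div_K_le_one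
  have := h.K_pos'
  push_cast
  rw [add_div]
  have : (K₁ : ℝ) / K ≤ 1 := by rwa [div_le_one this]
  linarith

theorem one_sub_mul_le : (1 - q - R * e ^ 8) * K ≤ K₁ := by
  have h1 := h.le_K₁
  have h2 := h.inv_K_le
  have h3 := h.K_pos'
  rw [div_le_iff₀ h3] at h2
  nlinarith

theorem K₁_pos : 0 < K₁ := by
  have h1 := h.one_sub_mul_le
  have h2 := h.q_add_le
  have h3 := h.K_pos'
  have : (0 : ℝ) < K₁ := by nlinarith
  exact_mod_cast this

theorem K₂_pos : 0 < K₂ := by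
  have : (0 : ℝ) < K₂ := (mul_pos h.K_pos' h.q_pos).trans_le h.le_K₂
  exact_mod_cast this

theorem inv_K₁_le : 1 / (K₁ : ℝ) ≤ 1 / (1 - q - R * e ^ 8) * (1 / K) := by
  have h2 := h.q_add_le
  have h3 := h.K_pos'
  rw [one_div_mul_one_div]
  exact one_div_le_one_div_of_le (mul_pos (by linarith) h3) h.one_sub_mul_le

theorem inv_K₁_le' : 1 / (K₁ : ℝ) ≤ 2 * (1 / K) := by
  refine h.inv_K₁_le.trans ?_
  have := h.K_pos'
  gcongr
  rw [div_le_iff₀] <;> linarith [h.q_add_le]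

theorem inv_K₂_le : 1 / (K₂ : ℝ) ≤ 1 / q * (1 / K) := by
  rw [one_div_mul_one_div, mul_comm]
  exact one_div_le_one_div_of_le (mul_pos h.K_pos' h.q_pos) h.le_K₂

theorem inv_q_le : 1 / q ≤ 1 / (κ * e) :=
  one_div_le_one_div_of_le (mul_pos h.κ_pos h.e_pos) h.le_q

end Regime

namespace Target

variable {d : ℕ} (T : Target d) {R κ : ℝ} {J K K₁ K₂ : ℕ} {l₁ l₂ m₁ m₂ e q : ℝ}
  (h : Regime R κ J K K₁ K₂ l₁ l₂ m₁ m₂ e q)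

include h

/-- Each term is e⁸ times something small. On A, the cardinality 2S/e² is outweighed by 1/J =
O(e¹⁶); fresh frequencies contribute the fraction K₂/K = O(e + q); the squared residual contributes
the mass t outside A. -/
theorem poolBound_le {τ t Ac : ℝ} (hτ : 0 < τ) (ht : 0 ≤ t) (hAc : 0 ≤ Ac)
    (hA : Ac ≤ 2 * T.S / e ^ 2) :
    T.poolBound J Ac (K₁ + K₂) K₂ τ m₁ m₂ t
      ≤ (8 * T.β * T.S * T.V * R ^ 2 / τ + 64 * T.β ^ 2 * momentConst 2 1 * T.S ^ 2 * R ^ 5 / τ ^ 2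
        + R ^ 3 * (1 + R) + 2 * T.V * R ^ 3 * (1 + R) + (1 + T.V) * R) * (e ^ 8 * (e + q + t)) := by
  have hβ := T.β_pos
  have hS := T.S_pos
  have hV := T.V_nonneg
  have hmc := momentConst_nonneg 2 1
  have hR := h.R_pos
  have hK := h.K_pos'
  have hJ := h.J_pos'
  have r9 := h.inv_sqrt_J_le
  have he := h.e_pos
  have hq := h.q_pos
  have hm₁ := h.m₁_pos
  have r1 := h.K_div_m₁_le
  have r2 := h.m₁_div_K_le
  have hm₂ := h.m₂_pos
  have r3 := h.K_sq_div_m₂_le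
  have r4 := h.m₂_div_K_sq_le
  have i1 := h.inv_J_le
  have hpow : ∀ k, e ^ (9 + k) ≤ e ^ 8 * (e + q + t) := fun k => by
    calc e ^ (9 + k) ≤ e ^ 9 := pow_le_pow_of_le_one he.le h.e_le_one (by omega)
      _ = e ^ 8 * e := by ring
      _ ≤ _ := by gcongr; linarith
  have hK₂ := h.K₂_div_K_le'
  have hK₂1 := h.K₂_div_K_le_one
  have hc := h.card_div_K_le
  have a1 : 4 * T.β / τ * (Ac * (T.V / J))
      ≤ 8 * T.β * T.S * T.V * R ^ 2 / τ * (e ^ 8 * (e + q + t)) := by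
    calc 4 * T.β / τ * (Ac * (T.V / J)) = 4 * T.β / τ * (Ac * (T.V * (1 / J))) := by ring
      _ ≤ 4 * T.β / τ * (2 * T.S / e ^ 2 * (T.V * (R ^ 2 * e ^ 16))) := by gcongr
      _ = 8 * T.β * T.S * T.V * R ^ 2 / τ * e ^ (9 + 5) := by field_simp; ring
      _ ≤ _ := by have := hpow 5; gcongr
  have a2 : 8 * T.β ^ 2 / (τ ^ 2 * m₂) * (Ac * ((K₁ + K₂ : ℕ) : ℝ)) * K₂ *
      (Ac * (momentConst 2 1 / J ^ 2))
      ≤ 64 * T.β ^ 2 * momentConst 2 1 * T.S ^ 2 * R ^ 5 / τ ^ 2 * (e ^ 8 * (e + q + t)) := by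
    calc _ = 8 * T.β ^ 2 / τ ^ 2 * momentConst 2 1 * Ac ^ 2 * (((K₁ + K₂ : ℕ) : ℝ) / K) * (K₂ / K)
          * (K ^ 2 / m₂) * (1 / J) ^ 2 := by field_simp
      _ ≤ 8 * T.β ^ 2 / τ ^ 2 * momentConst 2 1 * (2 * T.S / e ^ 2) ^ 2 * 2 * 1
          * (R / e ^ 8) * (R ^ 2 * e ^ 16) ^ 2 := by
          gcongr
      _ = 64 * T.β ^ 2 * momentConst 2 1 * T.S ^ 2 * R ^ 5 / τ ^ 2 * e ^ (9 + 11) := by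
          field_simp
          ring
      _ ≤ _ := by have := hpow 11; gcongr
  have hqt : e ^ 8 * ((1 + R) * (e + q)) ≤ (1 + R) * (e ^ 8 * (e + q + t)) := by
    have h1 : e ^ 8 * (e + q) ≤ e ^ 8 * (e + q + t) :=
      mul_le_mul_of_nonneg_left (by linarith) (by positivity)
    calc _ = (1 + R) * (e ^ 8 * (e + q)) := by ring
      _ ≤ _ := by gcongr
  have a3 : 1 / (2 * m₂) * K₂ ^ 2 * (1 / J) ≤ R ^ 3 * (1 + R) * (e ^ 8 * (e + q + t)) := by
    calc 1 / (2 * m₂) * K₂ ^ 2 * (1 / J) = 1 / 2 * ((K₂ / K) * (K₂ / K)) * (K ^ 2 / m₂) * (1 / J) := by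
          field_simp
      _ ≤ 1 / 2 * ((1 + R) * (e + q) * 1) * (R / e ^ 8) * (R ^ 2 * e ^ 16) := by
          gcongr
      _ = R ^ 3 * (1 / 2 * (e ^ 8 * ((1 + R) * (e + q)))) := by field_simp
      _ ≤ R ^ 3 * (e ^ 8 * ((1 + R) * (e + q))) := by
          have : 0 ≤ e ^ 8 * ((1 + R) * (e + q)) := by positivity
          exact mul_le_mul_of_nonneg_left (by linarith) (by positivity)
      _ ≤ R ^ 3 * ((1 + R) * (e ^ 8 * (e + q + t))) := by gcongr
      _ = _ := by ring
  have a4 : 2 / m₁ * K₂ * (T.V / J) ≤ 2 * T.V * R ^ 3 * (1 + R) * (e ^ 8 * (e + q + t)) := by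
    calc 2 / m₁ * K₂ * (T.V / J) = 2 * T.V * (K₂ / K) * (K / m₁) * (1 / J) := by field_simp
      _ ≤ 2 * T.V * ((1 + R) * (e + q)) * (R / e ^ 8) * (R ^ 2 * e ^ 16) := by
          gcongr
      _ = 2 * T.V * R ^ 3 * (e ^ 8 * ((1 + R) * (e + q))) := by field_simp
      _ ≤ 2 * T.V * R ^ 3 * ((1 + R) * (e ^ 8 * (e + q + t))) := by gcongr
      _ = _ := by ring
  have a5 : t * (1 + T.V) / Real.sqrt J ≤ (1 + T.V) * R * (e ^ 8 * (e + q + t)) := by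
    calc t * (1 + T.V) / Real.sqrt J = t * (1 + T.V) * (1 / Real.sqrt J) := by ring
      _ ≤ t * (1 + T.V) * (R * e ^ 8) := by
          gcongr
      _ = (1 + T.V) * R * (e ^ 8 * t) := by ring
      _ ≤ _ := by gcongr; linarith
  unfold poolBound
  linarith

/-- The first stage has error O(e⁸); with the cutoff e² the squared accuracy is e⁴, so failure has
probability O(e⁴). -/
theorem stageOneBound_le {C₀ : ℝ} (hC₀ : 0 ≤ C₀) :
    T.stageOneBound J K C₀ l₁ l₂
      ≤ (2 * C₀ * T.S * R + R * (C₀ ^ 2 * T.S ^ 2 + C₀ ^ 3 * T.S) + R ^ 3 + 2 * T.V * R ^ 3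
        + T.S * (1 + T.V) * R) * e ^ 8 := by
  have hS := T.S_pos
  have hV := T.V_nonneg
  have hR := h.R_pos
  have hK := h.K_pos'
  have hJ := h.J_pos'
  have r9 := h.inv_sqrt_J_le
  have he := h.e_pos
  have hl₁ := h.l₁_pos
  have r5 := h.K_div_l₁_le
  have r6 := h.l₁_div_K_le
  have hl₂ := h.l₂_pos
  have r7 := h.K_sq_div_l₂_le
  have r8 := h.l₂_div_K_sq_le
  have i1 := h.inv_J_le
  have i2 := h.inv_K_le
  have i3 := h.inv_K_le_one
  have a1 : C₀ / K * T.S ≤ C₀ * T.S * (R * e ^ 8) := by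
    calc C₀ / K * T.S = C₀ * T.S * (1 / K) := by ring
      _ ≤ _ := by gcongr
  have a2 : l₁ * (C₀ / K * T.S) ≤ C₀ * T.S * (R * e ^ 8) := by
    calc l₁ * (C₀ / K * T.S) = C₀ * T.S * (l₁ / K) := by ring
      _ ≤ _ := by gcongr
  have a3 : l₂ * ((C₀ / K * T.S) ^ 2 + (C₀ / K) ^ 3 * T.S)
      ≤ R * e ^ 8 * (C₀ ^ 2 * T.S ^ 2 + C₀ ^ 3 * T.S) := by
    calc l₂ * ((C₀ / K * T.S) ^ 2 + (C₀ / K) ^ 3 * T.S)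
        = l₂ / K ^ 2 * (C₀ ^ 2 * T.S ^ 2 + C₀ ^ 3 * T.S * (1 / K)) := by field_simp
      _ ≤ R * e ^ 8 * (C₀ ^ 2 * T.S ^ 2 + C₀ ^ 3 * T.S * 1) := by
          gcongr
      _ = _ := by ring
  have a4 : 1 / (2 * l₂) * K ^ 2 * (1 / J) ≤ R ^ 3 * e ^ 8 := by
    calc 1 / (2 * l₂) * K ^ 2 * (1 / J) = 1 / 2 * (K ^ 2 / l₂) * (1 / J) := by field_simp
      _ ≤ 1 * (R / e ^ 8) * (R ^ 2 * e ^ 16) := by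
          gcongr
          norm_num
      _ = _ := by field_simp
  have a5 : 2 / l₁ * K * (T.V / J) ≤ 2 * T.V * R ^ 3 * e ^ 8 := by
    calc 2 / l₁ * K * (T.V / J) = 2 * T.V * (K / l₁) * (1 / J) := by field_simp
      _ ≤ 2 * T.V * (R / e ^ 8) * (R ^ 2 * e ^ 16) := by
          gcongr
      _ = _ := by field_simp
  have a6 : T.S * (1 + T.V) / Real.sqrt J ≤ T.S * (1 + T.V) * (R * e ^ 8) := by
    calc T.S * (1 + T.V) / Real.sqrt J = T.S * (1 + T.V) * (1 / Real.sqrt J) := by ring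
      _ ≤ _ := by gcongr
  unfold stageOneBound approxBound poolBound
  simp only [zero_mul, mul_zero]
  linarith

theorem card_sq_div_le : ((K₁ + K₂ : ℕ) : ℝ) ^ 2 / (2 * m₂ * J) ≤ 2 * R ^ 3 * e ^ 8 := by
  have hR := h.R_pos
  have hK := h.K_pos'
  have hJ := h.J_pos'
  have r9 := h.inv_sqrt_J_le
  have he := h.e_pos
  have hm₂ := h.m₂_pos
  have r3 := h.K_sq_div_m₂_le
  have r4 := h.m₂_div_K_sq_le
  have i1 := h.inv_J_le
  have hc := h.card_div_K_le
  calc ((K₁ + K₂ : ℕ) : ℝ) ^ 2 / (2 * m₂ * J)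
      = 1 / 2 * (((K₁ + K₂ : ℕ) : ℝ) / K) ^ 2 * (K ^ 2 / m₂) * (1 / J) := by field_simp
    _ ≤ 1 / 2 * 2 ^ 2 * (R / e ^ 8) * (R ^ 2 * e ^ 16) := by
        gcongr
    _ = _ := by field_simp

theorem card_div_le : 4 * ((K₁ + K₂ : ℕ) : ℝ) / (m₁ * J) ≤ 8 * R ^ 3 * e ^ 8 := by
  have hR := h.R_pos
  have hK := h.K_pos'
  have hJ := h.J_pos'
  have r9 := h.inv_sqrt_J_le
  have he := h.e_pos
  have hm₁ := h.m₁_pos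
  have r1 := h.K_div_m₁_le
  have r2 := h.m₁_div_K_le
  have i1 := h.inv_J_le
  have hc := h.card_div_K_le
  calc 4 * ((K₁ + K₂ : ℕ) : ℝ) / (m₁ * J)
      = 4 * (((K₁ + K₂ : ℕ) : ℝ) / K) * (K / m₁) * (1 / J) := by field_simp
    _ ≤ 4 * 2 * (R / e ^ 8) * (R ^ 2 * e ^ 16) := by
        gcongr
    _ = _ := by field_simp; norm_num

/-- Only K₂ ≥ κeK frequencies represent f here, and the cubed weight costs e⁻³ against e⁸. The
resulting e⁵ becomes e⁹ after multiplication by the failure probability. -/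
theorem badConst_le {C₀ : ℝ} (hC₀ : 0 ≤ C₀) :
    T.badConst J K₁ K₂ C₀ m₁ m₂ (e ^ 2)
      ≤ (2 * C₀ * T.S * R / κ + R * (C₀ ^ 2 * T.S ^ 2 / κ ^ 2 + C₀ ^ 3 * T.S / κ ^ 3) + 10 * R ^ 3 + R)
        * e ^ 5 := by
  have hS := T.S_pos
  have hR := h.R_pos
  have hκ := h.κ_pos
  have hK := h.K_pos'
  have hJ := h.J_pos'
  have r9 := h.inv_sqrt_J_le
  have he := h.e_pos
  have he1 := h.e_le_one
  have hq := h.q_pos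
  have hm₁ := h.m₁_pos
  have r1 := h.K_div_m₁_le
  have r2 := h.m₁_div_K_le
  have hm₂ := h.m₂_pos
  have r3 := h.K_sq_div_m₂_le
  have r4 := h.m₂_div_K_sq_le
  have hK₂ : (0 : ℝ) < K₂ := by exact_mod_cast h.K₂_pos
  have i1 := h.inv_J_le
  have i2 := h.inv_K_le
  have i3 := h.inv_K_le_one
  have iK : 1 / (K₂ : ℝ) ≤ 1 / (κ * e) * (1 / K) :=
    h.inv_K₂_le.trans (mul_le_mul_of_nonneg_right h.inv_q_le (by positivity))
  have hpow : ∀ k, e ^ (5 + k) ≤ e ^ 5 := fun k => pow_le_pow_of_le_one he.le he1 (by omega)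
  have a1 : C₀ / K₂ * T.S ≤ C₀ * T.S * R / κ * e ^ 5 := by
    calc C₀ / K₂ * T.S = C₀ * T.S * (1 / K₂) := by ring
      _ ≤ C₀ * T.S * (1 / (κ * e) * (R * e ^ 8)) := by
          gcongr
          exact iK.trans (by gcongr)
      _ = C₀ * T.S * R / κ * e ^ (5 + 2) := by field_simp
      _ ≤ _ := by have := hpow 2; gcongr
  have a2 : m₁ * (C₀ / K₂ * T.S) ≤ C₀ * T.S * R / κ * e ^ 5 := by
    calc m₁ * (C₀ / K₂ * T.S) = C₀ * T.S * (m₁ * (1 / K₂)) := by ring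
      _ ≤ C₀ * T.S * (m₁ * (1 / (κ * e) * (1 / K))) := by gcongr
      _ = C₀ * T.S * (1 / (κ * e) * (m₁ / K)) := by ring
      _ ≤ C₀ * T.S * (1 / (κ * e) * (R * e ^ 8)) := by gcongr
      _ = C₀ * T.S * R / κ * e ^ (5 + 2) := by field_simp
      _ ≤ _ := by have := hpow 2; gcongr
  have a3 : m₂ * ((C₀ / K₂ * T.S) ^ 2 + (C₀ / K₂) ^ 3 * T.S)
      ≤ R * (C₀ ^ 2 * T.S ^ 2 / κ ^ 2 + C₀ ^ 3 * T.S / κ ^ 3) * e ^ 5 := by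
    calc m₂ * ((C₀ / K₂ * T.S) ^ 2 + (C₀ / K₂) ^ 3 * T.S)
        = m₂ * (C₀ ^ 2 * T.S ^ 2 * (1 / K₂) ^ 2 + C₀ ^ 3 * T.S * (1 / K₂) ^ 3) := by ring
      _ ≤ m₂ * (C₀ ^ 2 * T.S ^ 2 * (1 / (κ * e) * (1 / K)) ^ 2
          + C₀ ^ 3 * T.S * (1 / (κ * e) * (1 / K)) ^ 3) := by gcongr
      _ = m₂ / K ^ 2 * (C₀ ^ 2 * T.S ^ 2 / κ ^ 2 / e ^ 2 + C₀ ^ 3 * T.S / κ ^ 3 / e ^ 3 * (1 / K)) := by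
          field_simp
      _ ≤ R * e ^ 8 * (C₀ ^ 2 * T.S ^ 2 / κ ^ 2 / e ^ 2 + C₀ ^ 3 * T.S / κ ^ 3 / e ^ 3 * 1) := by
          gcongr
      _ = R * (C₀ ^ 2 * T.S ^ 2 / κ ^ 2 * e ^ (5 + 1) + C₀ ^ 3 * T.S / κ ^ 3 * e ^ 5) := by
          field_simp
          ring
      _ ≤ R * (C₀ ^ 2 * T.S ^ 2 / κ ^ 2 * e ^ 5 + C₀ ^ 3 * T.S / κ ^ 3 * e ^ 5) := by
          have := hpow 1
          gcongr
      _ = _ := by ring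
  have a4 : (((K₁ + K₂ : ℕ) : ℝ) ^ 2 / (2 * m₂ * J) + 4 * ((K₁ + K₂ : ℕ) : ℝ) / (m₁ * J))
      * (1 / e ^ 2) ≤ 10 * R ^ 3 * e ^ 5 := by
    calc _ ≤ (2 * R ^ 3 * e ^ 8 + 8 * R ^ 3 * e ^ 8) * (1 / e ^ 2) := by
          gcongr
          · exact card_sq_div_le h
          · exact card_div_le h
      _ = 10 * R ^ 3 * e ^ (5 + 1) := by field_simp; ring
      _ ≤ _ := by have := hpow 1; gcongr
  have a5 : 1 / (e ^ 2 * Real.sqrt J) ≤ R * e ^ 5 := by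
    calc 1 / (e ^ 2 * Real.sqrt J) = 1 / e ^ 2 * (1 / Real.sqrt J) := by rw [one_div_mul_one_div]
      _ ≤ 1 / e ^ 2 * (R * e ^ 8) := by gcongr
      _ = R * e ^ (5 + 1) := by field_simp
      _ ≤ _ := by have := hpow 1; gcongr
  unfold badConst approxBound
  refine (add_le_add (add_le_add (add_le_add (add_le_add a1 a2) a3) a4) a5).trans (le_of_eq ?_)
  ring

/-- The domination factor has mean 1 + O(e⁻⁴), so ε³X is O(e²) in the mean. The tail of the noise is
the one term without an extra power of e. -/
theorem badMean_le {b B : ℝ} (hb0 : 0 ≤ b) (hB : 0 ≤ B) (hb : b ≤ B * e ^ 8) :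
    T.badMean J K₁ K₂ l₁ m₁ m₂ (e ^ 2) b K
      ≤ (10 * R ^ 3 * (1 + 2 * R * B) + 8 * R ^ 3 * momentConst 10 1
        + 16 * R ^ 3 * momentConst 10 (T.S + 1 + T.V) + 4 * R ^ 3 * (16 * T.s ^ 2 + 4)
        + T.S ^ 2 * T.V * R) * (e ^ 8 * (e + T.noiseTail (Real.sqrt J))) := by
  have hS := T.S_pos
  have hV := T.V_nonneg
  have hR := h.R_pos
  have hK := h.K_pos'
  have hJ := h.J_pos'
  have r9 := h.inv_sqrt_J_le
  have hsJ : 0 < Real.sqrt J := Real.sqrt_pos.2 hJ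
  have he := h.e_pos
  have he1 := h.e_le_one
  have hm₁ := h.m₁_pos
  have r1 := h.K_div_m₁_le
  have r2 := h.m₁_div_K_le
  have hm₂ := h.m₂_pos
  have r3 := h.K_sq_div_m₂_le
  have r4 := h.m₂_div_K_sq_le
  have hl₁ := h.l₁_pos
  have r5 := h.K_div_l₁_le
  have r6 := h.l₁_div_K_le
  have hmc := momentConst_nonneg 10 1
  have hmc' := momentConst_nonneg 10 (T.S + 1 + T.V)
  have hw := T.noiseTail_nonneg (Real.sqrt J)
  have i1 := h.inv_J_le
  have hc := h.card_div_K_le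
  set w := T.noiseTail (Real.sqrt J)
  have hpow : ∀ k, e ^ (9 + k) ≤ e ^ 8 * (e + w) := fun k => by
    calc e ^ (9 + k) ≤ e ^ 9 := pow_le_pow_of_le_one he.le h.e_le_one (by omega)
      _ = e ^ 8 * e := by ring
      _ ≤ _ := by gcongr; linarith
  have k₂ := card_sq_div_le h
  have k₁ := card_div_le h
  have a1 : (((K₁ + K₂ : ℕ) : ℝ) ^ 2 / (2 * m₂ * J) + 4 * ((K₁ + K₂ : ℕ) : ℝ) / (m₁ * J))
      * ((e ^ 2) ^ 3 * (1 + 2 * K / (l₁ * (e ^ 2) ^ 2) * b))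
      ≤ 10 * R ^ 3 * (1 + 2 * R * B) * (e ^ 8 * (e + w)) := by
    have h1 : (e ^ 2) ^ 3 * (1 + 2 * K / (l₁ * (e ^ 2) ^ 2) * b) ≤ (1 + 2 * R * B) * e := by
      calc (e ^ 2) ^ 3 * (1 + 2 * K / (l₁ * (e ^ 2) ^ 2) * b)
          = e ^ 6 + 2 * (K / l₁) * e ^ 2 * b := by field_simp
        _ ≤ e ^ 6 + 2 * (R / e ^ 8) * e ^ 2 * (B * e ^ 8) := by
            gcongr
        _ = e ^ 6 + 2 * R * B * e ^ 2 := by field_simp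
        _ ≤ e + 2 * R * B * e := by
            have p6 : e ^ 6 ≤ e := pow_le_of_le_one he.le he1 (by norm_num)
            have p2 : e ^ 2 ≤ e := pow_le_of_le_one he.le he1 (by norm_num)
            gcongr
        _ = _ := by ring
    calc _ ≤ (((K₁ + K₂ : ℕ) : ℝ) ^ 2 / (2 * m₂ * J) + 4 * ((K₁ + K₂ : ℕ) : ℝ) / (m₁ * J))
          * ((1 + 2 * R * B) * e) := by gcongr
      _ ≤ (2 * R ^ 3 * e ^ 8 + 8 * R ^ 3 * e ^ 8) * ((1 + 2 * R * B) * e) := by gcongr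
      _ = 10 * R ^ 3 * (1 + 2 * R * B) * e ^ (9 + 0) := by ring
      _ ≤ _ := by have := hpow 0; gcongr
  have a2 : ((K₁ + K₂ : ℕ) : ℝ) ^ 2 / (2 * m₂ * J) * e ^ 2 * (4 * momentConst 10 1)
      ≤ 8 * R ^ 3 * momentConst 10 1 * (e ^ 8 * (e + w)) := by
    calc _ ≤ 2 * R ^ 3 * e ^ 8 * e ^ 2 * (4 * momentConst 10 1) := by gcongr
      _ = 8 * R ^ 3 * momentConst 10 1 * e ^ (9 + 1) := by ring
      _ ≤ _ := by have := hpow 1; gcongr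
  have a3 : 4 * ((K₁ + K₂ : ℕ) : ℝ) / (m₁ * J) * e ^ 2 * (2 * momentConst 10 (T.S + 1 + T.V))
      ≤ 16 * R ^ 3 * momentConst 10 (T.S + 1 + T.V) * (e ^ 8 * (e + w)) := by
    calc _ ≤ 8 * R ^ 3 * e ^ 8 * e ^ 2 * (2 * momentConst 10 (T.S + 1 + T.V)) := by gcongr
      _ = 16 * R ^ 3 * momentConst 10 (T.S + 1 + T.V) * e ^ (9 + 1) := by ring
      _ ≤ _ := by have := hpow 1; gcongr
  have a4 : 2 * ((K₁ + K₂ : ℕ) : ℝ) / m₁ * ((16 * T.s ^ 2 + 4) * (w / J))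
      ≤ 4 * R ^ 3 * (16 * T.s ^ 2 + 4) * (e ^ 8 * (e + w)) := by
    calc _ = 2 * (((K₁ + K₂ : ℕ) : ℝ) / K) * (K / m₁) * (16 * T.s ^ 2 + 4) * w * (1 / J) := by
          field_simp
      _ ≤ 2 * 2 * (R / e ^ 8) * (16 * T.s ^ 2 + 4) * w * (R ^ 2 * e ^ 16) := by
          gcongr
      _ = 4 * R ^ 3 * (16 * T.s ^ 2 + 4) * (e ^ 8 * w) := by field_simp; ring
      _ ≤ _ := by gcongr; linarith
  have a5 : e ^ 2 * Real.sqrt J * (T.S ^ 2 * T.V / J) ≤ T.S ^ 2 * T.V * R * (e ^ 8 * (e + w)) := by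
    calc e ^ 2 * Real.sqrt J * (T.S ^ 2 * T.V / J)
        = e ^ 2 * (T.S ^ 2 * T.V) * (1 / Real.sqrt J) := by
          have : (J : ℝ) = Real.sqrt J ^ 2 := (Real.sq_sqrt hJ.le).symm
          generalize Real.sqrt J = r at this hsJ
          rw [this]
          field_simp
      _ ≤ e ^ 2 * (T.S ^ 2 * T.V) * (R * e ^ 8) := by gcongr
      _ = T.S ^ 2 * T.V * R * e ^ (9 + 1) := by ring
      _ ≤ _ := by have := hpow 1; gcongr
  unfold badMean
  linarith

/-- The lost mass is at most vq while K₂ ≥ Kq, so q cancels and the loss is a relative error C₀v/S²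
of the main term S²/K. The square of Γ comes from the quartic penalty; fourth moments carry an
additional 1/K. -/
theorem goodApprox_le {C₀ c v Γ : ℝ} (hC₀ : 0 ≤ C₀) (hc0 : 0 ≤ c) (hc : c ≤ 1 / 2)
    (hv : tailMass T.a (2 * e ^ 2) ≤ v * q) (hΓ1 : 1 ≤ Γ)
    (hΓ : (1 + c) / (1 - c) / (1 - q - R * e ^ 8) + C₀ * v / T.S ^ 2 ≤ Γ) :
    T.goodApprox K₁ K₂ C₀ m₁ m₂ c (e ^ 2)
      ≤ Γ ^ 2 * approxBound m₁ m₂ (T.S ^ 2 / K) 0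
        + R ^ 2 * (216 * T.S ^ 4 + C₀ ^ 3 * T.S / κ ^ 3) * (e ^ 8 * e) := by
  have hS := T.S_pos
  have hR := h.R_pos
  have hκ := h.κ_pos
  have hK := h.K_pos'
  have he := h.e_pos
  have he1 := h.e_le_one
  have hq := h.q_pos
  have hm₁ := h.m₁_pos
  have r1 := h.K_div_m₁_le
  have r2 := h.m₁_div_K_le
  have hm₂ := h.m₂_pos
  have r3 := h.K_sq_div_m₂_le
  have r4 := h.m₂_div_K_sq_le
  have hc1 : 0 < 1 - c := by linarith
  have hc3 : (1 + c) / (1 - c) ≤ 3 := by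
    rw [div_le_iff₀ hc1]
    linarith
  have iK₁ := h.inv_K₁_le
  have iK₁' := h.inv_K₁_le'
  have iK₂ := h.inv_K₂_le
  have i2 := h.inv_K_le
  have htail := tailMass_nonneg T.a (2 * e ^ 2)
  have htailS : tailMass T.a (2 * e ^ 2) ≤ T.S := tailMass_le_tsum T.summable_a _
  have hK₁ : (0 : ℝ) < K₁ := by exact_mod_cast h.K₁_pos
  have hK₂ : (0 : ℝ) < K₂ := by exact_mod_cast h.K₂_pos
  set g₁ := (1 + c) / (1 - c) * T.S / K₁ * T.S + C₀ / K₂ * tailMass T.a (2 * e ^ 2) with hg₁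
  set g₂ := ((1 + c) / (1 - c) * T.S / K₁) ^ 3 * T.S + (C₀ / K₂) ^ 3 * tailMass T.a (2 * e ^ 2)
    with hg₂
  have hg₁0 : 0 ≤ g₁ := by positivity
  have b1 : g₁ ≤ Γ * (T.S ^ 2 / K) := by
    calc g₁ = (1 + c) / (1 - c) * T.S ^ 2 * (1 / K₁)
          + C₀ * tailMass T.a (2 * e ^ 2) * (1 / K₂) := by rw [hg₁]; ring
      _ ≤ (1 + c) / (1 - c) * T.S ^ 2 * (1 / (1 - q - R * e ^ 8) * (1 / K))
          + C₀ * (v * q) * (1 / q * (1 / K)) := by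
          have : 0 ≤ v * q := htail.trans hv
          gcongr
      _ = ((1 + c) / (1 - c) / (1 - q - R * e ^ 8) + C₀ * v / T.S ^ 2) * (T.S ^ 2 / K) := by
          have : 1 - q - R * e ^ 8 ≠ 0 := by linarith [h.q_add_le]
          field_simp
      _ ≤ _ := by gcongr
  have b2 : m₂ * g₂ ≤ R ^ 2 * (216 * T.S ^ 4 + C₀ ^ 3 * T.S / κ ^ 3) * (e ^ 8 * e) := by
    calc m₂ * g₂ = m₂ * (((1 + c) / (1 - c) * T.S) ^ 3 * T.S * (1 / K₁) ^ 3
          + C₀ ^ 3 * tailMass T.a (2 * e ^ 2) * (1 / K₂) ^ 3) := by rw [hg₂]; ring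
      _ ≤ m₂ * ((3 * T.S) ^ 3 * T.S * (2 * (1 / K)) ^ 3
          + C₀ ^ 3 * T.S * (1 / (κ * e) * (1 / K)) ^ 3) := by
          have h2 : 1 / (K₂ : ℝ) ≤ 1 / (κ * e) * (1 / K) :=
            iK₂.trans (mul_le_mul_of_nonneg_right h.inv_q_le (by positivity))
          gcongr
      _ = m₂ / K ^ 2 * (1 / K) * (216 * T.S ^ 4 + C₀ ^ 3 * T.S / κ ^ 3 / e ^ 3) := by
          field_simp
          ring
      _ ≤ R * e ^ 8 * (R * e ^ 8) * (216 * T.S ^ 4 + C₀ ^ 3 * T.S / κ ^ 3 / e ^ 3) := by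
          gcongr
      _ = R ^ 2 * (216 * T.S ^ 4 * e ^ (9 + 7) + C₀ ^ 3 * T.S / κ ^ 3 * e ^ (9 + 4)) := by
          field_simp
          ring
      _ ≤ R ^ 2 * (216 * T.S ^ 4 * e ^ 9 + C₀ ^ 3 * T.S / κ ^ 3 * e ^ 9) := by
          have p7 : e ^ (9 + 7) ≤ e ^ 9 := pow_le_pow_of_le_one he.le he1 (by omega)
          have p4 : e ^ (9 + 4) ≤ e ^ 9 := pow_le_pow_of_le_one he.le he1 (by omega)
          gcongr
      _ = _ := by ring
  have b3 : (1 + m₁) * g₁ ≤ Γ ^ 2 * ((1 + m₁) * (T.S ^ 2 / K)) := by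
    calc (1 + m₁) * g₁ ≤ (1 + m₁) * (Γ * (T.S ^ 2 / K)) := by gcongr
      _ = Γ * ((1 + m₁) * (T.S ^ 2 / K)) := by ring
      _ ≤ _ := by
          gcongr
          nlinarith
  have b4 : m₂ * g₁ ^ 2 ≤ Γ ^ 2 * (m₂ * (T.S ^ 2 / K) ^ 2) := by
    calc m₂ * g₁ ^ 2 ≤ m₂ * (Γ * (T.S ^ 2 / K)) ^ 2 := by gcongr
      _ = _ := by ring
  unfold goodApprox approxBound
  rw [← hg₁, ← hg₂]
  linarith

/-- The constant of the lower order terms. -/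
noncomputable def lowerOrderConst (R κ C₀ c τ : ℝ) : ℝ :=
  let B := 2 * C₀ * T.S * R + R * (C₀ ^ 2 * T.S ^ 2 + C₀ ^ 3 * T.S) + R ^ 3 + 2 * T.V * R ^ 3
    + T.S * (1 + T.V) * R
  1 / (1 - 3 * τ / 4) * (R ^ 2 * (216 * T.S ^ 4 + C₀ ^ 3 * T.S / κ ^ 3)
      + (8 * T.β * T.S * T.V * R ^ 2 / τ + 64 * T.β ^ 2 * momentConst 2 1 * T.S ^ 2 * R ^ 5 / τ ^ 2
        + R ^ 3 * (1 + R) + 2 * T.V * R ^ 3 * (1 + R) + (1 + T.V) * R))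
    + 4 * (2 * C₀ * T.S * R / κ + R * (C₀ ^ 2 * T.S ^ 2 / κ ^ 2 + C₀ ^ 3 * T.S / κ ^ 3)
        + 10 * R ^ 3 + R)
      * (4 * T.β / c ^ 2 * B + 64 * T.β ^ 2 * T.S ^ 2 * R ^ 2 / τ ^ 2)
    + 4 * (10 * R ^ 3 * (1 + 2 * R * B) + 8 * R ^ 3 * momentConst 10 1
        + 16 * R ^ 3 * momentConst 10 (T.S + 1 + T.V) + 4 * R ^ 3 * (16 * T.s ^ 2 + 4)
        + T.S ^ 2 * T.V * R)

/-- The error bound up to lower order terms. -/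
theorem totalBound_le {C₀ c τ : ℝ} (hC₀ : 0 ≤ C₀) (hc0 : 0 < c) (hc : c ≤ 1 / 2) (hτ : 0 < τ)
    (hτ1 : τ ≤ 1) {t Ac v Γ : ℝ} (ht : 0 ≤ t) (hAc : 0 ≤ Ac) (hA : Ac ≤ 2 * T.S / e ^ 2)
    (hv : tailMass T.a (2 * e ^ 2) ≤ v * q) (hΓ1 : 1 ≤ Γ)
    (hΓ : (1 + c) / (1 - c) / (1 - q - R * e ^ 8) + C₀ * v / T.S ^ 2 ≤ Γ) :
    T.totalBound J K K₁ K₂ C₀ l₁ m₁ m₂ τ c (e ^ 2) Ac t (T.stageOneBound J K C₀ l₁ l₂)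
      ≤ 1 / (1 - 3 * τ / 4) * Γ ^ 2 * approxBound m₁ m₂ (T.S ^ 2 / K) 0
        + T.lowerOrderConst R κ C₀ c τ * (e ^ 8 * (e + q + t + T.noiseTail (Real.sqrt J))) := by
  have hβ := T.β_pos
  have hS := T.S_pos
  have hV := T.V_nonneg
  have hR := h.R_pos
  have hκ := h.κ_pos
  have he := h.e_pos
  have hq := h.q_pos
  have hl₁ := h.l₁_pos
  have hl₂ := h.l₂_pos
  have hm₁ := h.m₁_pos
  have hm₂ := h.m₂_pos
  have hmc := momentConst_nonneg 2 1
  have hmc' := momentConst_nonneg 10 1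
  have hmc'' := momentConst_nonneg 10 (T.S + 1 + T.V)
  have hw := T.noiseTail_nonneg (Real.sqrt J)
  have i1 := h.inv_J_le
  have hτ2 : 0 < 1 - 3 * τ / 4 := by linarith
  have hJ := h.J_pos'
  have hb0 : 0 ≤ T.stageOneBound J K C₀ l₁ l₂ := by
    unfold stageOneBound approxBound poolBound
    positivity
  have g1 := T.goodApprox_le h hC₀ hc0.le hc hv hΓ1 hΓ
  have g2 := T.poolBound_le h hτ ht hAc hA
  have g3 := T.stageOneBound_le h hC₀
  have g4 := T.badConst_le h hC₀
  have g40 := T.badConst_nonneg (J := J) (K₁ := K₁) (K₂ := K₂) hC₀ hm₁ hm₂ (pow_pos he 2)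
  set B := 2 * C₀ * T.S * R + R * (C₀ ^ 2 * T.S ^ 2 + C₀ ^ 3 * T.S) + R ^ 3 + 2 * T.V * R ^ 3
    + T.S * (1 + T.V) * R with hB
  have hB0 : 0 ≤ B := by positivity
  have g5 := T.badMean_le h hb0 hB0 g3
  set b := T.stageOneBound J K C₀ l₁ l₂
  set w := T.noiseTail (Real.sqrt J)
  set Y := e ^ 8 * (e + q + t + w) with hY
  have y1 : e ^ 8 * e ≤ Y := mul_le_mul_of_nonneg_left (by linarith) (by positivity)
  have y2 : e ^ 8 * (e + q + t) ≤ Y := mul_le_mul_of_nonneg_left (by linarith) (by positivity)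
  have y3 : e ^ 8 * (e + w) ≤ Y := mul_le_mul_of_nonneg_left (by linarith) (by positivity)
  set c₁ := R ^ 2 * (216 * T.S ^ 4 + C₀ ^ 3 * T.S / κ ^ 3) with hc₁
  set c₂ := 8 * T.β * T.S * T.V * R ^ 2 / τ
    + 64 * T.β ^ 2 * momentConst 2 1 * T.S ^ 2 * R ^ 5 / τ ^ 2
    + R ^ 3 * (1 + R) + 2 * T.V * R ^ 3 * (1 + R) + (1 + T.V) * R with hc₂
  set c₃ := 2 * C₀ * T.S * R / κ + R * (C₀ ^ 2 * T.S ^ 2 / κ ^ 2 + C₀ ^ 3 * T.S / κ ^ 3)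
    + 10 * R ^ 3 + R with hc₃
  set c₄ := 10 * R ^ 3 * (1 + 2 * R * B) + 8 * R ^ 3 * momentConst 10 1
    + 16 * R ^ 3 * momentConst 10 (T.S + 1 + T.V) + 4 * R ^ 3 * (16 * T.s ^ 2 + 4)
    + T.S ^ 2 * T.V * R with hc₄
  have n1 : 0 ≤ c₁ := by positivity
  have n2 : 0 ≤ c₂ := by positivity
  have n3 : 0 ≤ c₃ := by positivity
  have n4 : 0 ≤ c₄ := by positivity
  -- The probability of failure: inaccurate amplitudes, or large gaps within A.
  have f1 : 4 * T.β / (c * e ^ 2) ^ 2 * b + 16 * T.β ^ 2 / τ ^ 2 * (Ac ^ 2 / J)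
      ≤ (4 * T.β / c ^ 2 * B + 64 * T.β ^ 2 * T.S ^ 2 * R ^ 2 / τ ^ 2) * e ^ 4 := by
    have j1 : 4 * T.β / (c * e ^ 2) ^ 2 * b ≤ 4 * T.β / c ^ 2 * B * e ^ 4 := by
      calc _ ≤ 4 * T.β / (c * e ^ 2) ^ 2 * (B * e ^ 8) := by gcongr
        _ = _ := by field_simp
    have j2 : 16 * T.β ^ 2 / τ ^ 2 * (Ac ^ 2 / J)
        ≤ 64 * T.β ^ 2 * T.S ^ 2 * R ^ 2 / τ ^ 2 * e ^ 4 := by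
      have p4 : e ^ (4 + 8) ≤ e ^ 4 := pow_le_pow_of_le_one he.le h.e_le_one (by omega)
      calc _ = 16 * T.β ^ 2 / τ ^ 2 * (Ac ^ 2 * (1 / J)) := by ring
        _ ≤ 16 * T.β ^ 2 / τ ^ 2 * ((2 * T.S / e ^ 2) ^ 2 * (R ^ 2 * e ^ 16)) := by gcongr
        _ = 64 * T.β ^ 2 * T.S ^ 2 * R ^ 2 / τ ^ 2 * e ^ (4 + 8) := by field_simp; ring
        _ ≤ _ := by gcongr
    linarith
  -- Here e⁵ · e⁴ = e⁸ · e, one power below the main term.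
  have f2 : 4 * T.badConst J K₁ K₂ C₀ m₁ m₂ (e ^ 2)
      * (4 * T.β / (c * e ^ 2) ^ 2 * b + 16 * T.β ^ 2 / τ ^ 2 * (Ac ^ 2 / J))
      ≤ 4 * c₃ * (4 * T.β / c ^ 2 * B + 64 * T.β ^ 2 * T.S ^ 2 * R ^ 2 / τ ^ 2) * Y := by
    calc _ ≤ 4 * (c₃ * e ^ 5)
          * ((4 * T.β / c ^ 2 * B + 64 * T.β ^ 2 * T.S ^ 2 * R ^ 2 / τ ^ 2) * e ^ 4) := by gcongr
      _ = 4 * c₃ * (4 * T.β / c ^ 2 * B + 64 * T.β ^ 2 * T.S ^ 2 * R ^ 2 / τ ^ 2) * (e ^ 8 * e) := by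
          ring
      _ ≤ _ := by gcongr
  have f3 : 1 / (1 - 3 * τ / 4) * (T.goodApprox K₁ K₂ C₀ m₁ m₂ c (e ^ 2)
      + T.poolBound J Ac (K₁ + K₂) K₂ τ m₁ m₂ t)
      ≤ 1 / (1 - 3 * τ / 4) * (Γ ^ 2 * approxBound m₁ m₂ (T.S ^ 2 / K) 0 + c₁ * Y + c₂ * Y) := by
    refine mul_le_mul_of_nonneg_left ?_ (by positivity)
    have := mul_le_mul_of_nonneg_left y1 n1
    have := mul_le_mul_of_nonneg_left y2 n2
    linarith
  have f4 := mul_le_mul_of_nonneg_left y3 n4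
  unfold totalBound lowerOrderConst
  dsimp only
  rw [← hB, ← hc₁, ← hc₂, ← hc₃, ← hc₄]
  linarith

end Target

end RFF

open MeasureTheory ProbabilityTheory
open scoped ENNReal ComplexConjugate

namespace RFF

/-! ### The generalization bound and the tuned parameters up to constants. -/

section Parameters

/-- `x` lies between `1 / R` and `R`. -/
def Comparable (R x : ℝ) : Prop := 1 / R ≤ x ∧ x ≤ R

theorem Comparable.mono {R R' x : ℝ} (hR : 0 < R) (h : R ≤ R') (hx : Comparable R x) :
    Comparable R' x :=
  ⟨(one_div_le_one_div_of_le hR h).trans hx.1, hx.2.trans h⟩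

theorem exists_comparable {α : Type*} [TopologicalSpace α] {s : Set α} (hs : IsCompact s)
    {g : α → ℝ} (hg : ContinuousOn g s) (hpos : ∀ z ∈ s, 0 < g z) :
    ∃ R, 1 ≤ R ∧ ∀ z ∈ s, Comparable R (g z) := by
  obtain ⟨U, hU⟩ := (hs.bddAbove_image hg)
  obtain ⟨V, hV⟩ := (hs.bddAbove_image (hg.inv₀ fun z hz => (hpos z hz).ne'))
  refine ⟨max 1 (max U V), le_max_left _ _, fun z hz => ⟨?_, ?_⟩⟩
  · have h1 : (g z)⁻¹ ≤ V := hV ⟨z, hz, rfl⟩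
    have h2 : (g z)⁻¹ ≤ max 1 (max U V) := h1.trans ((le_max_right _ _).trans (le_max_right _ _))
    rw [one_div]
    exact inv_le_of_inv_le₀ (hpos z hz) h2
  · have h1 : g z ≤ U := hU ⟨z, hz, rfl⟩
    exact h1.trans ((le_max_left _ _).trans (le_max_right _ _))

theorem exists_comparable_family {α ι : Type*} [TopologicalSpace α] [Fintype ι] {s : Set α}
    (hs : IsCompact s) {g : ι → α → ℝ} (hg : ∀ i, ContinuousOn (g i) s)
    (hpos : ∀ i, ∀ z ∈ s, 0 < g i z) :
    ∃ R, 1 ≤ R ∧ ∀ i, ∀ z ∈ s, Comparable R (g i z) := by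
  choose R hR1 hR using fun i => exists_comparable hs (hg i) (hpos i)
  have h0 : ∀ i, 0 ≤ R i := fun i => zero_le_one.trans (hR1 i)
  refine ⟨1 + ∑ i, R i, le_add_of_nonneg_right (Finset.sum_nonneg fun i _ => h0 i),
    fun i z hz => (hR i z hz).mono (one_pos.trans_le (hR1 i)) ?_⟩
  have := Finset.single_le_sum (f := R) (fun i _ => h0 i) (Finset.mem_univ i)
  linarith

theorem max_mul_le {R x y u v : ℝ} (hx : Comparable R x) (hy : Comparable R y) (hu : 0 ≤ u)
    (hv : 0 ≤ v) (hR : 0 < R) : max (x * u) (y * v) ≤ R * (u + v) := by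
  have := mul_le_mul_of_nonneg_right hx.2 hu
  have := mul_le_mul_of_nonneg_right hy.2 hv
  have := mul_nonneg hR.le hu
  have := mul_nonneg hR.le hv
  exact max_le (by linarith) (by linarith)

theorem le_max_mul {R x y u v : ℝ} (hx : Comparable R x) (hy : Comparable R y) (hu : 0 ≤ u)
    (hv : 0 ≤ v) : 1 / (2 * R) * (u + v) ≤ max (x * u) (y * v) := by
  have h1 := mul_le_mul_of_nonneg_right hx.1 hu
  have h2 := mul_le_mul_of_nonneg_right hy.1 hv
  have h3 := le_max_left (x * u) (y * v)
  have h4 := le_max_right (x * u) (y * v)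
  have : 1 / (2 * R) * (u + v) = (1 / R * u + 1 / R * v) / 2 := by ring
  linarith

variable {δ lam c₁ B b : ℝ} {K J : ℕ}

/-- The coefficients of `1 / √J` and `1 / K` in the generalization bound and in the regularization
parameters. -/
noncomputable def paramCoeff (δ lam c₁ : ℝ) : Fin 6 → ℝ × ℝ → ℝ :=
  ![fun z => Real.sqrt (2 * (1 + 3 * δ / 2) * c₁ * z.1 / δ)
      + Real.sqrt ((1 + 3 * δ / 2) * (z.1 ^ 2 + z.2)) * (Real.sqrt 2 / Real.sqrt δ),
    fun z => (1 + 3 * δ / 2) * z.1 * (1 + lam) + Real.sqrt ((1 + 3 * δ / 2) * (z.1 ^ 2 + z.2)) * lam,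
    fun z => Real.sqrt (c₁ / ((1 + 3 * δ / 2) * z.1 * (2 * δ))),
    fun _ => lam,
    fun z => Real.sqrt (1 / ((1 + 3 * δ / 2) * (z.1 ^ 2 + z.2) * (2 * δ))),
    fun z => lam / Real.sqrt ((1 + 3 * δ / 2) * (z.1 ^ 2 + z.2))]

/-- K and J enter only through 1/K and 1/√J, with coefficients depending on (B, b). All comparisons
between different (B, b) reduce to these coefficients. -/
theorem genBound_eq (hJ : 0 < J) :
    genBound δ lam c₁ K J B b = paramCoeff δ lam c₁ 0 (B, b) * (1 / Real.sqrt J)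
      + paramCoeff δ lam c₁ 1 (B, b) * (1 / K) := by
  have hJr : (0 : ℝ) < J := by exact_mod_cast hJ
  have h1 : Real.sqrt (2 * (1 + 3 * δ / 2) * c₁ * B / (J * δ))
      = Real.sqrt (2 * (1 + 3 * δ / 2) * c₁ * B / δ) / Real.sqrt J := by
    rw [← Real.sqrt_div' _ hJr.le, div_div, mul_comm (J : ℝ)]
  simp only [genBound, h1, Real.sqrt_mul hJr.le, paramCoeff, Matrix.cons_val_zero,
    Matrix.cons_val_one]
  ring

theorem reg₁_eq (hJ : 0 < J) (hK : 0 < K) :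
    reg₁ δ lam c₁ K J B = K * max (paramCoeff δ lam c₁ 2 (B, b) * (1 / Real.sqrt J))
      (paramCoeff δ lam c₁ 3 (B, b) * (1 / K)) := by
  have hJr : (0 : ℝ) < J := by exact_mod_cast hJ
  have hKr : (0 : ℝ) < K := by exact_mod_cast hK
  have h1 : Real.sqrt (c₁ / ((1 + 3 * δ / 2) * B * (2 * J * δ)))
      = Real.sqrt (c₁ / ((1 + 3 * δ / 2) * B * (2 * δ))) * (1 / Real.sqrt J) := by
    rw [mul_one_div, ← Real.sqrt_div' _ hJr.le, div_div]
    congr 2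
    ring
  have h2 : paramCoeff δ lam c₁ 3 (B, b) = lam := rfl
  have h3 : paramCoeff δ lam c₁ 2 (B, b) = Real.sqrt (c₁ / ((1 + 3 * δ / 2) * B * (2 * δ))) := rfl
  rw [reg₁, h1, h2, h3, mul_max_of_nonneg _ _ hKr.le]
  congr 1
  field_simp

theorem reg₂_eq (hJ : 0 < J) (hK : 0 < K) :
    reg₂ δ lam K J B b = K ^ 2 * max (paramCoeff δ lam c₁ 4 (B, b) * (1 / Real.sqrt J))
      (paramCoeff δ lam c₁ 5 (B, b) * (1 / K)) := by
  have hJr : (0 : ℝ) < J := by exact_mod_cast hJ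
  have hKr : (0 : ℝ) < K := by exact_mod_cast hK
  have h1 : Real.sqrt (1 / ((1 + 3 * δ / 2) * (B ^ 2 + b) * (2 * J * δ)))
      = Real.sqrt (1 / ((1 + 3 * δ / 2) * (B ^ 2 + b) * (2 * δ))) * (1 / Real.sqrt J) := by
    rw [mul_one_div, ← Real.sqrt_div' _ hJr.le, div_div]
    congr 2
    ring
  have h2 : paramCoeff δ lam c₁ 5 (B, b) = lam / Real.sqrt ((1 + 3 * δ / 2) * (B ^ 2 + b)) := rfl
  have h3 : paramCoeff δ lam c₁ 4 (B, b)
      = Real.sqrt (1 / ((1 + 3 * δ / 2) * (B ^ 2 + b) * (2 * δ))) := rfl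
  have h4 : ∀ x y : ℝ, K * max x (y * (1 / K)) = max (K * x) y := fun x y => by
    rw [mul_max_of_nonneg _ _ hKr.le]
    congr 1
    field_simp
  rw [reg₂, h1, h2, h3, sq (K : ℝ), mul_assoc (K : ℝ) K (max _ _), h4, mul_assoc]

/-- The six coefficients are continuous and positive on the compact set [B₀, B₁] × [0, b₁];
positivity of B₀ keeps the denominators away from zero. -/
theorem exists_comparable_paramCoeff (hδ : 0 < δ) (hlam : 0 < lam) (hc₁ : 0 < c₁) {B₀ : ℝ}
    (hB₀ : 0 < B₀) (B₁ b₁ : ℝ) :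
    ∃ R, 1 ≤ R ∧ ∀ B b, B₀ ≤ B → B ≤ B₁ → 0 ≤ b → b ≤ b₁ → ∀ i,
      Comparable R (paramCoeff δ lam c₁ i (B, b)) := by
  have hD : 0 < 1 + 3 * δ / 2 := by positivity
  have hs : IsCompact (Set.Icc B₀ B₁ ×ˢ Set.Icc 0 b₁) := isCompact_Icc.prod isCompact_Icc
  have hmem : ∀ z ∈ Set.Icc B₀ B₁ ×ˢ Set.Icc 0 b₁, 0 < z.1 ∧ 0 ≤ z.2 := fun z hz =>
    ⟨hB₀.trans_le hz.1.1, hz.2.1⟩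
  have hcont : ∀ i, ContinuousOn (paramCoeff δ lam c₁ i) (Set.Icc B₀ B₁ ×ˢ Set.Icc 0 b₁) := by
    intro i
    fin_cases i
    · exact (by fun_prop : Continuous fun z : ℝ × ℝ =>
        Real.sqrt (2 * (1 + 3 * δ / 2) * c₁ * z.1 / δ)
        + Real.sqrt ((1 + 3 * δ / 2) * (z.1 ^ 2 + z.2)) * (Real.sqrt 2 / Real.sqrt δ)).continuousOn
    · exact (by fun_prop : Continuous fun z : ℝ × ℝ => (1 + 3 * δ / 2) * z.1 * (1 + lam)
        + Real.sqrt ((1 + 3 * δ / 2) * (z.1 ^ 2 + z.2)) * lam).continuousOn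
    · refine ContinuousOn.sqrt (ContinuousOn.div continuousOn_const
        (by fun_prop) fun z hz => ?_)
      have := (hmem z hz).1
      positivity
    · exact continuousOn_const
    · refine ContinuousOn.sqrt (ContinuousOn.div continuousOn_const
        (by fun_prop) fun z hz => ?_)
      have := hmem z hz
      have : 0 < z.1 ^ 2 + z.2 := by nlinarith [sq_pos_of_pos this.1]
      positivity
    · refine ContinuousOn.div continuousOn_const (by fun_prop) fun z hz => ?_
      have := hmem z hz
      have : 0 < z.1 ^ 2 + z.2 := by nlinarith [sq_pos_of_pos this.1]
      positivity
  have hpos : ∀ i, ∀ z ∈ Set.Icc B₀ B₁ ×ˢ Set.Icc 0 b₁, 0 < paramCoeff δ lam c₁ i z := by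
    intro i z hz
    obtain ⟨h1, h2⟩ := hmem z hz
    have h3 : 0 < z.1 ^ 2 + z.2 := by nlinarith [sq_pos_of_pos h1]
    fin_cases i
    · change 0 < Real.sqrt (2 * (1 + 3 * δ / 2) * c₁ * z.1 / δ)
        + Real.sqrt ((1 + 3 * δ / 2) * (z.1 ^ 2 + z.2)) * (Real.sqrt 2 / Real.sqrt δ)
      positivity
    · change 0 < (1 + 3 * δ / 2) * z.1 * (1 + lam)
        + Real.sqrt ((1 + 3 * δ / 2) * (z.1 ^ 2 + z.2)) * lam
      positivity
    · change 0 < Real.sqrt (c₁ / ((1 + 3 * δ / 2) * z.1 * (2 * δ)))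
      positivity
    · exact hlam
    · change 0 < Real.sqrt (1 / ((1 + 3 * δ / 2) * (z.1 ^ 2 + z.2) * (2 * δ)))
      positivity
    · change 0 < lam / Real.sqrt ((1 + 3 * δ / 2) * (z.1 ^ 2 + z.2))
      positivity
  obtain ⟨R, hR1, hR⟩ := exists_comparable_family hs hcont hpos
  exact ⟨R, hR1, fun B b h1 h2 h3 h4 i => hR i (B, b) ⟨⟨h1, h2⟩, ⟨h3, h4⟩⟩⟩

/-- The sizes of the regularization parameters in terms of a comparable generalization bound. -/
theorem reg_bounds {R E : ℝ} (hR : 1 ≤ R) (hJ : 0 < J) (hK : 0 < K) (hE : 0 < E)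
    (h : ∀ i, Comparable R (paramCoeff δ lam c₁ i (B, b)))
    (hE1 : 1 / R * (1 / Real.sqrt J + 1 / K) ≤ E) (hE2 : E ≤ R * (1 / Real.sqrt J + 1 / K)) :
    0 < reg₁ δ lam c₁ K J B ∧ 0 < reg₂ δ lam K J B b
      ∧ K / reg₁ δ lam c₁ K J B ≤ 2 * R ^ 2 / E ∧ (K : ℝ) ^ 2 / reg₂ δ lam K J B b ≤ 2 * R ^ 2 / E
      ∧ reg₁ δ lam c₁ K J B / K ≤ 2 * R ^ 2 * E
      ∧ reg₂ δ lam K J B b / (K : ℝ) ^ 2 ≤ 2 * R ^ 2 * E := by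
  have hJr : (0 : ℝ) < J := by exact_mod_cast hJ
  have hKr : (0 : ℝ) < K := by exact_mod_cast hK
  have hR0 : 0 < R := one_pos.trans_le hR
  rw [reg₁_eq (b := b) hJ hK, reg₂_eq (c₁ := c₁) hJ hK]
  set u := 1 / Real.sqrt J
  set v := 1 / (K : ℝ)
  have hu : 0 < u := by positivity
  have hv : 0 < v := by positivity
  have huv : u + v ≤ R * E := by
    rw [one_div_mul_eq_div, div_le_iff₀ hR0] at hE1
    linarith
  have key : ∀ x y, Comparable R x → Comparable R y → 0 < max (x * u) (y * v) ∧
      1 / max (x * u) (y * v) ≤ 2 * R ^ 2 / E ∧ max (x * u) (y * v) ≤ 2 * R ^ 2 * E := by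
    intro x y hx hy
    have h1 := le_max_mul hx hy hu.le hv.le
    have h2 := max_mul_le hx hy hu.le hv.le hR0
    have h3 : 0 < 1 / (2 * R) * (u + v) := by positivity
    have hmax := h3.trans_le h1
    refine ⟨hmax, ?_, ?_⟩
    · rw [div_le_div_iff₀ hmax hE]
      have h4 : u + v ≤ 2 * R * max (x * u) (y * v) := by
        rw [one_div_mul_eq_div, div_le_iff₀ (by positivity)] at h1
        linarith
      calc 1 * E ≤ R * (u + v) := by linarith
        _ ≤ R * (2 * R * max (x * u) (y * v)) := by gcongr
        _ = _ := by ring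
    · calc max (x * u) (y * v) ≤ R * (R * E) := h2.trans (by gcongr)
        _ ≤ 2 * R ^ 2 * E := by nlinarith [mul_pos (pow_pos hR0 2) hE]
  obtain ⟨a1, a2, a3⟩ := key _ _ (h 2) (h 3)
  obtain ⟨b1, b2, b3⟩ := key _ _ (h 4) (h 5)
  refine ⟨by positivity, by positivity, ?_, ?_, ?_, ?_⟩
  · refine le_trans (le_of_eq ?_) a2
    field_simp
  · refine le_trans (le_of_eq ?_) b2
    field_simp
  · rwa [mul_div_cancel_left₀ _ hKr.ne']
  · rwa [mul_div_cancel_left₀ _ (by positivity)]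

/-- The approximation bound with tuned regularization parameters is strictly below the
generalization bound. -/
theorem mul_approxBound_le (hδ : 0 < δ) (hlam : 0 < lam) (hc₁ : 0 ≤ c₁) (hJ : 0 < J) (hK : 0 < K)
    (hB : 0 < B) :
    (1 + 3 * δ / 2) * Target.approxBound (reg₁ δ lam c₁ K J B) (reg₂ δ lam K J B 0) (B / K) 0
      ≤ genBound δ lam c₁ K J B 0 := by
  have hJr : (0 : ℝ) < J := by exact_mod_cast hJ
  have hKr : (0 : ℝ) < K := by exact_mod_cast hK
  set D := 1 + 3 * δ / 2 with hD
  have hD0 : 0 < D := by positivity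
  set x := 2 * J * δ with hx
  have hx0 : 0 < x := by positivity
  have h1 : reg₁ δ lam c₁ K J B ≤ K * Real.sqrt (c₁ / (D * B * x)) + lam :=
    max_le (by linarith) (le_add_of_nonneg_left (by positivity))
  -- Both maxima are replaced by sums. After multiplication by D the summands match those of the
  -- generalization bound, which has even larger constants under its roots.
  have h2 : reg₂ δ lam K J B 0
      ≤ K * (K * Real.sqrt (1 / (D * (B ^ 2 + 0) * x)) + lam / Real.sqrt (D * (B ^ 2 + 0))) := by
    unfold reg₂
    refine mul_le_mul_of_nonneg_left ?_ hKr.le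
    exact max_le (le_add_of_nonneg_right (by positivity)) (le_add_of_nonneg_left (by positivity))
  have s1 : D * B * Real.sqrt (c₁ / (D * B * x)) = Real.sqrt (D * B * c₁ / x) := by
    rw [← Real.sqrt_sq (by positivity : 0 ≤ D * B), ← Real.sqrt_mul (by positivity),
      Real.sqrt_sq (by positivity : 0 ≤ D * B)]
    congr 1
    field_simp
  have s2 : D * B ^ 2 * Real.sqrt (1 / (D * (B ^ 2 + 0) * x)) = Real.sqrt (D * B ^ 2) / Real.sqrt x := by
    rw [← Real.sqrt_div' _ hx0.le, ← Real.sqrt_sq (by positivity : 0 ≤ D * B ^ 2),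
      ← Real.sqrt_mul (by positivity), Real.sqrt_sq (by positivity : 0 ≤ D * B ^ 2)]
    congr 1
    field_simp
    ring
  have s3 : D * B ^ 2 * (lam / Real.sqrt (D * (B ^ 2 + 0))) = Real.sqrt (D * B ^ 2) * lam := by
    rw [add_zero]
    have h0 : 0 < Real.sqrt (D * B ^ 2) := by positivity
    have h3 : D * B ^ 2 = Real.sqrt (D * B ^ 2) ^ 2 := (Real.sq_sqrt (by positivity)).symm
    generalize Real.sqrt (D * B ^ 2) = r at h0 h3 ⊢
    rw [h3]
    field_simp
  have t1 : D * (B / K) * reg₁ δ lam c₁ K J B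
      ≤ Real.sqrt (D * B * c₁ / x) + D * B / K * lam := by
    calc _ ≤ D * (B / K) * (K * Real.sqrt (c₁ / (D * B * x)) + lam) := by gcongr
      _ = D * B * Real.sqrt (c₁ / (D * B * x)) + D * B / K * lam := by field_simp
      _ = _ := by rw [s1]
  have t2 : D * (B / K) ^ 2 * reg₂ δ lam K J B 0
      ≤ Real.sqrt (D * B ^ 2) * (lam / K + 1 / Real.sqrt x) := by
    calc _ ≤ D * (B / K) ^ 2 * (K * (K * Real.sqrt (1 / (D * (B ^ 2 + 0) * x))
          + lam / Real.sqrt (D * (B ^ 2 + 0)))) := by gcongr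
      _ = D * B ^ 2 * Real.sqrt (1 / (D * (B ^ 2 + 0) * x))
          + D * B ^ 2 * (lam / Real.sqrt (D * (B ^ 2 + 0))) / K := by field_simp
      _ = _ := by rw [s2, s3]; ring
  have u1 : Real.sqrt (D * B * c₁ / x) ≤ Real.sqrt (2 * D * c₁ * B / (J * δ)) := by
    refine Real.sqrt_le_sqrt ?_
    rw [hx, div_le_div_iff₀ (by positivity) (by positivity)]
    have : 0 ≤ D * B * c₁ * (J * δ) := by positivity
    nlinarith
  have u2 : 1 / Real.sqrt x ≤ Real.sqrt 2 / Real.sqrt (J * δ) := by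
    rw [← Real.sqrt_div' _ (by positivity), ← Real.sqrt_one, ← Real.sqrt_div' _ hx0.le]
    refine Real.sqrt_le_sqrt ?_
    rw [hx, div_le_div_iff₀ (by positivity) (by positivity)]
    nlinarith [mul_pos hJr hδ]
  have u3 := mul_le_mul_of_nonneg_left u2 (Real.sqrt_nonneg (D * B ^ 2))
  unfold Target.approxBound genBound
  rw [← hD, add_zero, add_zero]
  have e1 : D * (B / K + reg₁ δ lam c₁ K J B * (B / K) + reg₂ δ lam K J B 0 * (B / K) ^ 2)
      = D * B / K + D * (B / K) * reg₁ δ lam c₁ K J B + D * (B / K) ^ 2 * reg₂ δ lam K J B 0 := by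
    ring
  rw [e1]
  have e2 : D * B / K * (1 + lam) = D * B / K + D * B / K * lam := by ring
  rw [e2]
  linarith

end Parameters

/-! ### Bounds for the rate constants of an admissible sampling law. -/

section RateConstants

variable {d : ℕ} (T : Target d) {p : PMF (Fin d → ℤ)} {C₀ : ℝ}

theorem toReal_pmf_le_one (n : Fin d → ℤ) : (p n).toReal ≤ 1 :=
  ENNReal.toReal_le_of_le_ofReal zero_le_one (by simpa using PMF.coe_le_one p n)

theorem pow_div_pow_le (hC₀ : 0 ≤ C₀) (hp : ∀ n, ‖T.a n‖ ≤ C₀ * (p n).toReal) (j : ℕ)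
    (n : Fin d → ℤ) : ‖T.a n‖ ^ (j + 1) / (p n).toReal ^ j ≤ C₀ ^ j * ‖T.a n‖ := by
  refine div_le_of_le_mul₀ (by positivity) (by positivity) ?_
  calc ‖T.a n‖ ^ (j + 1) = ‖T.a n‖ ^ j * ‖T.a n‖ := pow_succ _ _
    _ ≤ (C₀ * (p n).toReal) ^ j * ‖T.a n‖ := by gcongr; exact hp n
    _ = _ := by ring

theorem summable_norm_sq : Summable fun n => ‖T.a n‖ ^ 2 := by
  refine (T.summable_a.mul_left T.S).of_nonneg_of_le (fun n => by positivity) fun n => ?_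
  rw [sq]
  gcongr
  exact T.summable_a.le_tsum n fun _ _ => norm_nonneg _

theorem tsum_norm_sq_pos : 0 < ∑' n, ‖T.a n‖ ^ 2 := by
  obtain ⟨n, hn⟩ := T.exists_coeff_ne_zero
  exact (summable_norm_sq T).tsum_pos (fun _ => by positivity) n (pow_pos (norm_pos_iff.2 hn) 2)

theorem tsum_norm_sq_le : ∑' n, ‖T.a n‖ ^ 2 ≤ T.S ^ 2 := by
  rw [sq T.S]
  nth_rewrite 2 [Target.S]
  rw [← tsum_mul_left]
  refine (summable_norm_sq T).tsum_le_tsum (fun n => ?_) (T.summable_a.mul_left _)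
  rw [sq]
  gcongr
  exact T.summable_a.le_tsum n fun _ _ => norm_nonneg _

/-- The lower bound uses p ≤ 1, the upper one |a| ≤ C₀p. They confine the rate constant to a compact
interval in (0, ∞) that depends on p only through C₀. -/
theorem rateConst_bounds (hC₀ : 0 ≤ C₀) (hp : ∀ n, ‖T.a n‖ ≤ C₀ * (p n).toReal) :
    ∑' n, ‖T.a n‖ ^ 2 ≤ rateConst T.a (fun n => (p n).toReal) ∧
      rateConst T.a (fun n => (p n).toReal) ≤ C₀ * T.S := by
  have h1 := pow_div_pow_le T hC₀ hp 1
  simp only [pow_one] at h1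
  have hs : Summable fun n => ‖T.a n‖ ^ 2 / (p n).toReal :=
    (T.summable_a.mul_left C₀).of_nonneg_of_le (fun n => by positivity) h1
  constructor
  · refine (summable_norm_sq T).tsum_le_tsum (fun n => ?_) hs
    rcases (ENNReal.toReal_nonneg (a := p n)).eq_or_lt with h0 | h0
    · have := hp n
      rw [← h0, mul_zero] at this
      rw [le_antisymm this (norm_nonneg _)]
      simp
    · rw [le_div_iff₀ h0]
      exact mul_le_of_le_one_right (by positivity) (toReal_pmf_le_one n)
  · rw [Target.S, ← tsum_mul_left]
    exact hs.tsum_le_tsum h1 (T.summable_a.mul_left _)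

theorem rateConst'_bounds (hC₀ : 0 ≤ C₀) (hp : ∀ n, ‖T.a n‖ ≤ C₀ * (p n).toReal) :
    0 ≤ rateConst' T.a (fun n => (p n).toReal) ∧
      rateConst' T.a (fun n => (p n).toReal) ≤ C₀ ^ 3 * T.S := by
  have h1 := pow_div_pow_le T hC₀ hp 3
  have hs : Summable fun n => ‖T.a n‖ ^ 4 / (p n).toReal ^ 3 :=
    (T.summable_a.mul_left (C₀ ^ 3)).of_nonneg_of_le (fun n => by positivity) h1
  refine ⟨tsum_nonneg fun n => by positivity, ?_⟩
  rw [Target.S, ← tsum_mul_left]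
  exact hs.tsum_le_tsum h1 (T.summable_a.mul_left _)

theorem rateConst_optimalDist : rateConst T.a (optimalDist T.a) = T.S ^ 2 := by
  have hS := T.S_pos
  rw [rateConst, sq, Target.S, ← tsum_mul_left]
  refine tsum_congr fun n => ?_
  rw [optimalDist]
  change ‖T.a n‖ ^ 2 / (‖T.a n‖ / T.S) = T.S * ‖T.a n‖
  rcases eq_or_ne ‖T.a n‖ 0 with h0 | h0
  · simp [h0]
  · field_simp

/-- Bessel's inequality for the empty network. It makes c₁ positive even without noise. -/
theorem integral_norm_sq_f_pos : 0 < ∫ x, ‖T.f x‖ ^ 2 ∂T.μ := by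
  obtain ⟨n, hn⟩ := T.exists_coeff_ne_zero
  have h := T.bessel (ι := Empty) (fun k => k.elim) (fun k => k.elim) {n}
  simp only [Finset.sum_singleton, collected, network, Finset.univ_eq_empty, Finset.sum_empty,
    zero_sub, norm_neg] at h
  have h1 : 0 < ‖T.a n‖ ^ 2 := pow_pos (norm_pos_iff.2 hn) 2
  exact pos_of_mul_pos_right (h1.trans_le h) T.β_pos.le

end RateConstants

end RFF

open MeasureTheory ProbabilityTheory
open scoped ENNReal ComplexConjugate

namespace RFF

/-! ### Choice of the small parameters. -/

section Smallness

open Filter Topology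

/-- The expression tends to 1 < D as s → 0. The same s will serve as τ, as the accuracy c, and as
the margin in Γ. -/
theorem exists_sampling_slack {D : ℝ} (hD : 1 < D) :
    ∃ s : ℝ, 0 < s ∧ s ≤ 1 / 2 ∧ 1 / (1 - 3 * s / 4) * ((1 + s) / (1 - s) + s) ^ 2 < D := by
  have h : ContinuousAt (fun s : ℝ => 1 / (1 - 3 * s / 4) * ((1 + s) / (1 - s) + s) ^ 2) 0 := by
    refine ContinuousAt.mul (ContinuousAt.div₀ (by fun_prop) (by fun_prop) (by norm_num))
      (ContinuousAt.pow (ContinuousAt.add (ContinuousAt.div₀ (by fun_prop) (by fun_prop)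
        (by norm_num)) continuousAt_id) 2)
  have h1 : ∀ᶠ s : ℝ in 𝓝[>] 0, 1 / (1 - 3 * s / 4) * ((1 + s) / (1 - s) + s) ^ 2 < D :=
    (h.eventually (gt_mem_nhds (by norm_num; exact hD))).filter_mono nhdsWithin_le_nhds
  have h2 : ∀ᶠ s : ℝ in 𝓝[>] 0, s ∈ Set.Ioc 0 (1 / 2) := Ioc_mem_nhdsGT (by norm_num)
  obtain ⟨s, hs1, hs2⟩ := (h1.and h2).exists
  exact ⟨s, hs2.1, hs2.2, hs1⟩

/-- The hypotheses make the exponents 1 - θ, 1 + θ - 2θ' and 1 - θ' positive, so every error term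
vanishes as e → 0. -/
theorem eventually_parameters_small {R κ θ θ' M C₀ S Γ s η T₀ α : ℝ} (hθ : θ < 1)
    (hθ' : 2 * θ' < 1 + θ) (hη : 0 < η) (hΓ : (1 + s) / (1 - s) < Γ) (hα : 0 < α) :
    ∀ᶠ e : ℝ in 𝓝[>] 0, e ≤ 1 ∧ κ * e ^ (1 - θ) + R * e ^ 8 ≤ 1 / 2
      ∧ (1 + s) / (1 - s) / (1 - κ * e ^ (1 - θ) - R * e ^ 8)
        + C₀ * (M * e ^ (1 + θ - 2 * θ')) / S ^ 2 ≤ Γ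
      ∧ e + κ * e ^ (1 - θ) + ((e ^ 2 / 2) ^ (1 - θ') * M + e) ≤ η
      ∧ T₀ * (R * e ^ 8) ≤ 1 ∧ 2 * e ^ 2 ≤ α := by
  have r1 : ContinuousAt (fun e : ℝ => e ^ (1 - θ)) 0 :=
    Real.continuousAt_rpow_const _ _ (Or.inr (by linarith))
  have r2 : ContinuousAt (fun e : ℝ => e ^ (1 + θ - 2 * θ')) 0 :=
    Real.continuousAt_rpow_const _ _ (Or.inr (by linarith))
  have r3 : ContinuousAt (fun e : ℝ => (e ^ 2 / 2) ^ (1 - θ')) 0 :=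
    ContinuousAt.rpow_const (by fun_prop) (Or.inr (by linarith))
  have z1 : (0 : ℝ) ^ (1 - θ) = 0 := Real.zero_rpow (by linarith)
  have z2 : (0 : ℝ) ^ (1 + θ - 2 * θ') = 0 := Real.zero_rpow (by linarith)
  have z3 : (0 : ℝ) ^ (1 - θ') = 0 := Real.zero_rpow (by linarith)
  have key : ∀ g : ℝ → ℝ, ContinuousAt g 0 → ∀ y, g 0 < y → ∀ᶠ e in 𝓝[>] 0, g e ≤ y :=
    fun g hg y hy => ((hg.eventually (gt_mem_nhds hy)).mono fun _ h => h.le).filter_mono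
      nhdsWithin_le_nhds
  refine (key _ continuousAt_id _ one_pos).and ((key _ ?_ _ ?_).and ((key _ ?_ _ ?_).and
    ((key _ ?_ _ ?_).and ((key _ ?_ _ ?_).and (key _ ?_ _ ?_)))))
  · fun_prop
  · simp [z1]
  · refine ContinuousAt.add (ContinuousAt.div₀ continuousAt_const (by fun_prop) ?_) (by fun_prop)
    simp [z1]
  · simpa [z1, z2] using hΓ
  · fun_prop
  · simpa [z1, z3] using hη
  · fun_prop
  · simp
  · fun_prop
  · simpa using hα

end Smallness

/-- Both generalization bounds are comparable to 1/√J + 1/K. The second-stage parameters, tuned to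
other constants, therefore have sizes governed by the same e⁸. -/
theorem regime_of_genBound {δ lam c₁ κ e q B b B' : ℝ} {R : ℝ} {K J : ℕ} (hR : 1 ≤ R) (hκ : 0 < κ)
    (hK : 0 < K) (hJ : 0 < J) (he : 0 < e) (he1 : e ≤ 1) (hq : κ * e ≤ q)
    (hqe : q + 2 * R ^ 2 * e ^ 8 ≤ 1 / 2)
    (h : ∀ i, Comparable R (paramCoeff δ lam c₁ i (B, b)))
    (h' : ∀ i, Comparable R (paramCoeff δ lam c₁ i (B', 0)))
    (hE : genBound δ lam c₁ K J B b = e ^ 8) :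
    Regime (2 * R ^ 2) κ J K ⌊(K : ℝ) * (1 - q)⌋₊ ⌈(K : ℝ) * q⌉₊ (reg₁ δ lam c₁ K J B)
      (reg₂ δ lam K J B b) (reg₁ δ lam c₁ K J B') (reg₂ δ lam K J B' 0) e q ∧
      e ^ 8 ≤ R ^ 2 * genBound δ lam c₁ K J B' 0 := by
  have hJr : (0 : ℝ) < J := by exact_mod_cast hJ
  have hKr : (0 : ℝ) < K := by exact_mod_cast hK
  have hR0 : 0 < R := one_pos.trans_le hR
  have hE0 : 0 < e ^ 8 := by positivity
  have hu : 0 < 1 / Real.sqrt J := by positivity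
  have hv : 0 < 1 / (K : ℝ) := by positivity
  have hlow : ∀ {B b}, (∀ i, Comparable R (paramCoeff δ lam c₁ i (B, b))) →
      1 / R * (1 / Real.sqrt J + 1 / K) ≤ genBound δ lam c₁ K J B b := by
    intro B b h
    rw [genBound_eq hJ]
    have := mul_le_mul_of_nonneg_right (h 0).1 hu.le
    have := mul_le_mul_of_nonneg_right (h 1).1 hv.le
    linarith
  have hE1 := hlow h
  rw [hE] at hE1
  have hE2 : e ^ 8 ≤ R * (1 / Real.sqrt J + 1 / K) := by
    rw [← hE, genBound_eq hJ]
    have := mul_le_mul_of_nonneg_right (h 0).2 hu.le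
    have := mul_le_mul_of_nonneg_right (h 1).2 hv.le
    linarith
  have huv : 1 / Real.sqrt J + 1 / K ≤ 2 * R ^ 2 * e ^ 8 := by
    rw [one_div_mul_eq_div, div_le_iff₀ hR0] at hE1
    refine hE1.trans ?_
    rw [mul_comm]
    gcongr
    nlinarith
  obtain ⟨a1, a2, a3, a4, a5, a6⟩ := reg_bounds hR hJ hK hE0 h hE1 hE2
  obtain ⟨b1, b2, b3, b4, b5, b6⟩ := reg_bounds hR hJ hK hE0 h' hE1 hE2
  have hq0 : 0 < q := (mul_pos hκ he).trans_le hq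
  have hq1 : q ≤ 1 := by
    have : 0 < 2 * R ^ 2 * e ^ 8 := by positivity
    linarith
  constructor
  · exact
    { one_le_R := by nlinarith
      κ_pos := hκ
      e_pos := he
      e_le_one := he1
      le_q := hq
      q_add_le := hqe
      J_pos := hJ
      K_pos := hK
      inv_K_le := by linarith
      inv_sqrt_J_le := by linarith
      l₁_pos := a1
      l₂_pos := a2
      m₁_pos := b1
      m₂_pos := b2
      K_div_l₁_le := a3
      K_sq_div_l₂_le := a4
      K_div_m₁_le := b3
      K_sq_div_m₂_le := b4
      l₁_div_K_le := a5
      l₂_div_K_sq_le := a6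
      m₁_div_K_le := b5
      m₂_div_K_sq_le := b6
      le_K₁ := by linarith [Nat.lt_floor_add_one ((K : ℝ) * (1 - q))]
      K₁_le := (Nat.floor_le (mul_nonneg hKr.le (by linarith))).trans (by nlinarith)
      le_K₂ := Nat.le_ceil _
      K₂_le := (Nat.ceil_lt_add_one (by positivity)).le }
  · have h1 := hlow h'
    rw [one_div_mul_eq_div, div_le_iff₀ hR0] at h1
    calc e ^ 8 ≤ R * (1 / Real.sqrt J + 1 / K) := hE2
      _ ≤ R * (genBound δ lam c₁ K J B' 0 * R) := by gcongr
      _ = _ := by ring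

theorem tsum_sub_sum_eq_tailMass {Λ : Type*} {a : Λ → ℂ} (ha : Summable fun n => ‖a n‖) {t : ℝ}
    {A : Finset Λ} (hA : ∀ n, n ∈ A ↔ t ≤ ‖a n‖) :
    ∑' n, ‖a n‖ - ∑ n ∈ A, ‖a n‖ = tailMass a t := by
  rw [← ha.sum_add_tsum_subtype_compl A, add_sub_cancel_left, tailMass]
  refine (tsum_subtype {n | n ∉ A} (fun n => ‖a n‖)).trans ?_
  congr 2
  ext n
  simp [hA]

/-! ### Absorption of the lower order terms into the slack. -/

namespace Target

variable {d : ℕ} (T : Target d)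

set_option maxHeartbeats 1000000 in
/-- The error of the resampled method is at most the generalization bound for the optimal
distribution. The terms of lower order are absorbed by the factor `1 + 3 * δ / 2` in this bound: the
main term of the error is the bound without this factor. -/
theorem exists_resampledError_le {δ lam κ θ θ' C₀ : ℝ} (hδ : 0 < δ) (hlam : 0 < lam) (hκ : 0 < κ)
    (hθ0 : 0 ≤ θ) (hθ : θ < 1) (hθ' : 2 * θ' < 1 + θ) (hsum : Summable fun n => ‖T.a n‖ ^ θ')
    (hC₀ : 0 ≤ C₀) :
    ∃ e₀ : ℝ, 0 < e₀ ∧ ∀ p : PMF (Fin d → ℤ), (∀ n, ‖T.a n‖ ≤ C₀ * (p n).toReal) →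
      ∀ (K J : ℕ) (B b c₁ E : ℝ), 0 < K → 0 < J →
        B = rateConst T.a (fun n => (p n).toReal) →
        b = rateConst' T.a (fun n => (p n).toReal) / K →
        c₁ = ∫ x, ‖T.f x‖ ^ 2 ∂T.μ + T.s ^ 2 →
        E = genBound δ lam c₁ K J B b → E ≤ e₀ →
        resampledError T.L T.f T.μ T.N p K J (reg₁ δ lam c₁ K J B) (reg₂ δ lam K J B b)
            (reg₁ δ lam c₁ K J (T.S ^ 2)) (reg₂ δ lam K J (T.S ^ 2) 0)
            (E ^ (1 / 4 : ℝ)) (κ * E ^ ((1 - θ) / 8))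
          ≤ ENNReal.ofReal (genBound δ lam c₁ K J (T.S ^ 2) 0) := by
  have hS := T.S_pos
  obtain ⟨c₁, hc₁⟩ : ∃ c₁, c₁ = ∫ x, ‖T.f x‖ ^ 2 ∂T.μ + T.s ^ 2 := ⟨_, rfl⟩
  have hc₁0 : 0 < c₁ := hc₁ ▸ add_pos_of_pos_of_nonneg (integral_norm_sq_f_pos T) (sq_nonneg _)
  -- The range of B contains both C_p ≤ C₀S and C_{p_*} = S².
  obtain ⟨R, hR1, hR⟩ := exists_comparable_paramCoeff hδ hlam hc₁0 (tsum_norm_sq_pos T)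
    (C₀ * T.S + T.S ^ 2) (C₀ ^ 3 * T.S)
  have hR0 : 0 < R := one_pos.trans_le hR1
  set D := 1 + 3 * δ / 2 with hD
  have hD1 : 1 < D := by
    rw [hD]
    linarith
  obtain ⟨s, hs0, hs1, hsD⟩ := exists_sampling_slack hD1
  set Γ := (1 + s) / (1 - s) + s with hΓ
  have hΓ1 : 1 ≤ Γ := by
    have : 1 ≤ (1 + s) / (1 - s) := by
      rw [le_div_iff₀ (by linarith)]
      linarith
    linarith
  set A₀ := 1 / (1 - 3 * s / 4) * Γ ^ 2 with hA₀
  have hA₀0 : 0 ≤ A₀ := mul_nonneg (one_div_nonneg.2 (by linarith)) (sq_nonneg _)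
  set W := |T.lowerOrderConst (2 * R ^ 2) κ C₀ s s| * R ^ 2 + 1 with hW
  have hW0 : 0 < W := by positivity
  -- The share 1 - A₀/D left by the main term is spent on the lower order terms, whose small factor
  -- will be at most 2η: η from powers of e and η from the noise tail.
  set η := (1 - A₀ / D) / (2 * W) with hη
  have hη0 : 0 < η := by
    have : A₀ / D < 1 := (div_lt_one (by linarith)).2 hsD
    exact div_pos (by linarith) (by positivity)
  obtain ⟨T₀, hT₀⟩ := Filter.eventually_atTop.1 (T.tendsto_noiseTail.eventually (gt_mem_nhds hη0))
  obtain ⟨n₀, hn₀⟩ := T.exists_coeff_ne_zero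
  set M := ∑' n, ‖T.a n‖ ^ θ' with hM
  have hM0 : 0 ≤ M := tsum_nonneg fun n => by positivity
  obtain ⟨e₁, he₁, hsmall⟩ := mem_nhdsGT_iff_exists_Ioo_subset.1
    -- One constant stands in for two: M for the mass outside A, and 2^(1-θ')M/κ for the mass below
    -- the cutoff relative to q.
    (eventually_parameters_small (R := 2 * R ^ 2) (κ := κ) (M := M + (2 : ℝ) ^ (1 - θ') * M / κ)
      (C₀ := C₀) (S := T.S) (T₀ := T₀) hθ hθ' hη0 (lt_add_of_pos_right ((1 + s) / (1 - s)) hs0)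
      (norm_pos_iff.2 hn₀))
  have he₁' : (0 : ℝ) < e₁ := he₁
  -- Halving e₁ turns the non-strict bound on E into membership in an open interval.
  refine ⟨(e₁ / 2) ^ 8, by positivity, ?_⟩
  intro p hp K J B b c₁' E hK hJ hB hb hc₁' hE hEe
  obtain rfl : c₁' = c₁ := hc₁'.trans hc₁.symm
  obtain ⟨B_ge, B_le⟩ := hB ▸ rateConst_bounds T hC₀ hp
  obtain ⟨b_ge, b_le⟩ := rateConst'_bounds T hC₀ hp
  have hKr : (1 : ℝ) ≤ K := by exact_mod_cast hK
  have hJr : (0 : ℝ) < J := by exact_mod_cast hJ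
  have hb0 : 0 ≤ b := hb ▸ div_nonneg b_ge (by linarith)
  have hb1 : b ≤ C₀ ^ 3 * T.S := hb ▸ (div_le_self b_ge hKr).trans b_le
  have h1 := hR B b B_ge (B_le.trans (by nlinarith)) hb0 hb1
  have h2 := hR (T.S ^ 2) 0 (tsum_norm_sq_le T) (by nlinarith [mul_nonneg hC₀ hS.le]) le_rfl
    (by positivity)
  have hE0 : 0 < E := by
    rw [hE, genBound_eq hJ]
    have p1 := (one_div_pos.2 hR0).trans_le (h1 0).1
    have p2 := (one_div_pos.2 hR0).trans_le (h1 1).1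
    positivity
  set e := E ^ (1 / 8 : ℝ) with he
  have he0 : 0 < e := Real.rpow_pos_of_pos hE0 _
  have he8 : E = e ^ 8 := by
    rw [he, ← Real.rpow_natCast, ← Real.rpow_mul hE0.le]
    norm_num
  have hε : E ^ (1 / 4 : ℝ) = e ^ 2 := by
    rw [he, ← Real.rpow_natCast, ← Real.rpow_mul hE0.le]
    norm_num
  have hq : E ^ ((1 - θ) / 8) = e ^ (1 - θ) := by
    rw [he, ← Real.rpow_mul hE0.le]
    congr 1
    ring
  have hee₁ : e < e₁ := by
    have : e ≤ e₁ / 2 := le_of_pow_le_pow_left₀ (n := 8) (by norm_num) (by positivity)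
      (he8 ▸ hEe)
    linarith
  obtain ⟨s1, s2, s3, s4, s5, s6⟩ := hsmall ⟨he0, hee₁⟩
  clear_value e η W A₀ Γ D M
  rw [hε, hq]
  have hqle : κ * e ≤ κ * e ^ (1 - θ) := by
    have := Real.rpow_le_rpow_of_exponent_ge he0 s1 (by linarith : 1 - θ ≤ 1)
    rw [Real.rpow_one] at this
    gcongr
  obtain ⟨hreg, hcmp⟩ := regime_of_genBound hR1 hκ hK hJ he0 s1 hqle s2 h1 h2 (hE.symm.trans he8)
  have hfin := finite_setOf_le_norm T.summable_a (t := e ^ 2 / 2) (by positivity)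
  have hmem : ∀ n, n ∈ hfin.toFinset ↔ e ^ 2 / 2 ≤ ‖T.a n‖ := fun n => by simp
  have hθ1 : θ' ≤ 1 := by linarith
  have htail : T.S - ∑ n ∈ hfin.toFinset, ‖T.a n‖ ≤ (e ^ 2 / 2) ^ (1 - θ') * M + e := by
    rw [Target.S, tsum_sub_sum_eq_tailMass T.summable_a hmem]
    have := tailMass_le hθ1 (by positivity : 0 < e ^ 2 / 2) T.summable_a hsum
    rw [← hM] at this
    linarith
  have hcard : (hfin.toFinset.card : ℝ) ≤ 2 * T.S / e ^ 2 := by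
    rw [le_div_iff₀ (by positivity)]
    have : _ ≤ T.S := card_mul_le_tsum T.summable_a fun n hn => (hmem n).1 hn
    linarith
  have hv : tailMass T.a (2 * e ^ 2)
      ≤ ((M + (2 : ℝ) ^ (1 - θ') * M / κ) * e ^ (1 + θ - 2 * θ')) * (κ * e ^ (1 - θ)) := by
    refine (tailMass_le hθ1 (by positivity) T.summable_a hsum).trans ?_
    rw [← hM]
    have hx : e ^ (1 + θ - 2 * θ') * e ^ (1 - θ) = (e ^ 2) ^ (1 - θ') := by
      rw [← Real.rpow_add he0, ← Real.rpow_natCast e 2, ← Real.rpow_mul he0.le]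
      congr 1
      push_cast
      ring
    calc (2 * e ^ 2) ^ (1 - θ') * M = 2 ^ (1 - θ') * M / κ * κ * (e ^ 2) ^ (1 - θ') := by
          rw [Real.mul_rpow (by norm_num) (by positivity), div_mul_cancel₀ _ hκ.ne']
          ring
      _ ≤ (M + (2 : ℝ) ^ (1 - θ') * M / κ) * κ * (e ^ 2) ^ (1 - θ') := by
          gcongr
          exact le_add_of_nonneg_left hM0
      _ = _ := by rw [← hx]; ring
  have ht0 : 0 < (e ^ 2 / 2) ^ (1 - θ') * M + e := by positivity
  have htM : (e ^ 2 / 2) ^ (1 - θ') * M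
      ≤ (e ^ 2 / 2) ^ (1 - θ') * (M + (2 : ℝ) ^ (1 - θ') * M / κ) := by
    have : 0 ≤ 2 ^ (1 - θ') * M / κ := by positivity
    gcongr
    linarith
  -- A small generalization bound forces √J ≥ 1/(2R²e⁸) ≥ T₀.
  have hnoise : T.noiseTail (Real.sqrt J) < η := by
    refine hT₀ _ ?_
    have hpos : 0 < 2 * R ^ 2 * e ^ 8 := by positivity
    have h3 := hreg.inv_sqrt_J_le
    rw [div_le_iff₀ (by positivity)] at h3
    by_contra hlt
    push Not at hlt
    nlinarith [mul_lt_mul_of_pos_left hlt hpos]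
  have herr := T.lintegral_mixedRisk_le (A := hfin.toFinset) hC₀ hp hJ hK hreg.K₁_pos hreg.K₂_pos
    hreg.l₁_pos hreg.l₂_pos hreg.m₁_pos hreg.m₂_pos hs0 (by linarith) (by positivity) hs0 hs1
    ⟨n₀, s6⟩ (fun n => (hmem n).2) ht0 htail
  rw [T.resampledError_eq]
  refine herr.trans (ENNReal.ofReal_le_ofReal ?_)
  refine (T.totalBound_le hreg hC₀ hs0 hs1 hs0 (by linarith) ht0.le (Nat.cast_nonneg _) hcard hv hΓ1
    (hΓ ▸ s3)).trans ?_
  have happ := mul_approxBound_le hδ hlam hc₁0.le hJ hK (by positivity : 0 < T.S ^ 2)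
  rw [← hD] at happ
  set E₂ := genBound δ lam c₁' K J (T.S ^ 2) 0
  set X := approxBound (reg₁ δ lam c₁' K J (T.S ^ 2)) (reg₂ δ lam K J (T.S ^ 2) 0) (T.S ^ 2 / K) 0
  set z := e + κ * e ^ (1 - θ) + ((e ^ 2 / 2) ^ (1 - θ') * M + e) + T.noiseTail (Real.sqrt J)
    with hz
  have hz0 : 0 ≤ z := by
    have := T.noiseTail_nonneg (Real.sqrt J)
    positivity
  have hzη : z ≤ 2 * η := by linarith
  have hE₂ : 0 ≤ E₂ := by
    have : 0 < R ^ 2 * E₂ := (pow_pos he0 8).trans_le hcmp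
    exact (pos_of_mul_pos_right this (sq_nonneg R)).le
  have hmain : A₀ * X ≤ A₀ / D * E₂ := by
    rw [div_mul_eq_mul_div, le_div_iff₀ (by linarith)]
    calc A₀ * X * D = A₀ * (D * X) := by ring
      _ ≤ _ := by gcongr
  -- Here e⁸ ≤ R²E₂ passes from the first-stage bound to the optimal one, and W was chosen to
  -- dominate the resulting constant.
  have hrest : T.lowerOrderConst (2 * R ^ 2) κ C₀ s s * (e ^ 8 * z) ≤ (1 - A₀ / D) * E₂ := by
    calc _ ≤ |T.lowerOrderConst (2 * R ^ 2) κ C₀ s s| * (e ^ 8 * z) := by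
          gcongr
          exact le_abs_self _
      _ ≤ |T.lowerOrderConst (2 * R ^ 2) κ C₀ s s| * (R ^ 2 * E₂ * z) := by gcongr
      _ = (|T.lowerOrderConst (2 * R ^ 2) κ C₀ s s| * R ^ 2) * (z * E₂) := by ring
      _ ≤ W * (2 * η * E₂) := by
          gcongr
          linarith
      _ = (2 * W) * η * E₂ := by ring
      _ = (1 - A₀ / D) * E₂ := by rw [hη, mul_div_cancel₀ _ (by positivity)]
  rw [← hA₀]
  linarith

end Target

end RFF

/-! ### The theorem in terms of the original data. -/

open MeasureTheory ProbabilityTheory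
open scoped ENNReal ComplexConjugate

namespace RFF

theorem isProbabilityMeasure_pointLaw {d : ℕ} {L : ℝ} {ρ : (Fin d → ℝ) → ℝ}
    (hρ1 : ∫⁻ x in cube d L, ENNReal.ofReal (ρ x) = 1) :
    IsProbabilityMeasure (pointLaw L ρ) :=
  ⟨by rw [pointLaw, withDensity_apply _ MeasurableSet.univ, Measure.restrict_univ, hρ1]⟩

/-- The lower decay bound serves to exclude f = 0. A nonzero index exists because d > 0. -/
theorem exists_coeff_ne_zero_of_decay {d : ℕ} (hd : 0 < d) {a : (Fin d → ℤ) → ℂ} {c ℓ : ℝ}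
    (hc : 0 < c) (h : ∀ n, n ≠ 0 → (c / len n) ^ ℓ ≤ ‖a n‖) : ∃ n, a n ≠ 0 := by
  have hn : (fun _ : Fin d => (1 : ℤ)) ≠ 0 := fun h0 => one_ne_zero (congrFun h0 ⟨0, hd⟩)
  refine ⟨_, norm_pos_iff.1 (lt_of_lt_of_le ?_ (h _ hn))⟩
  have : 0 < len (fun _ : Fin d => (1 : ℤ)) := (norm_pos_iff.2 hn).trans_le (norm_le_len _)
  positivity

theorem genBound_nonneg {δ lam c₁ B b : ℝ} {K J : ℕ} (hδ : 0 ≤ δ) (hlam : 0 ≤ lam) (hB : 0 ≤ B) :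
    0 ≤ genBound δ lam c₁ K J B b := by
  unfold genBound
  positivity

end RFF

theorem mainTheorem2
    {d : ℕ} (hd : 0 < d) (L : ℝ) (hL : 0 < L)
    -- the target function: continuous, `2L`-periodic in each variable, with Fourier decay
    (f : (Fin d → ℝ) → ℂ) (hf : Continuous f)
    (hper : ∀ (x : Fin d → ℝ) (n : Fin d → ℤ), f (fun i => x i + 2 * L * (n i : ℝ)) = f x)
    (c C ℓ : ℝ) (hc : 0 < c) (hC : 0 < C) (hℓ : (d : ℝ) < ℓ)
    (hdecay : ∀ n : Fin d → ℤ, n ≠ 0 →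
      (c / RFF.len n) ^ ℓ ≤ ‖RFF.coeff L f n‖ ∧ ‖RFF.coeff L f n‖ ≤ (C / RFF.len n) ^ ℓ)
    -- the density of the data points, bounded below on the cube
    (ρ : (Fin d → ℝ) → ℝ) (hρm : Measurable ρ) (ρ₀ : ℝ) (hρ₀ : 0 < ρ₀)
    (hρ : ∀ x ∈ RFF.cube d L, ρ₀ ≤ ρ x)
    (hρ1 : ∫⁻ x in RFF.cube d L, ENNReal.ofReal (ρ x) = 1)
    -- the law of the noise: mean zero and variance `s²`
    (N : Measure ℝ) (hN : IsProbabilityMeasure N) (s : ℝ)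
    (hN2 : MemLp (fun ξ : ℝ => ξ) 2 N)
    (hNmean : ∫ ξ, ξ ∂N = 0) (hNvar : ∫ ξ, ξ ^ 2 ∂N = s ^ 2)
    -- the fixed parameters
    (lam : ℝ) (hlam : 0 < lam) (hlam2 : lam < 2) (δ : ℝ) (hδ : 0 < δ) (κ : ℝ) (hκ : 0 < κ) :
    ∃ M : ℝ, 0 < M ∧ ∀ C'' : ℝ, 0 < C'' → ∃ e₀ : ℝ, 0 < e₀ ∧
      ∀ (p : PMF (Fin d → ℤ)), (∀ n, ‖RFF.coeff L f n‖ ≤ C'' * (p n).toReal) →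
      ∀ K J : ℕ, 0 < K → 0 < J →
        let μ : Measure (Fin d → ℝ) := RFF.pointLaw L ρ
        let c₁ : ℝ := RFF.c₁ μ f s
        let Cp : ℝ := RFF.rateConst (RFF.coeff L f) (fun n => (p n).toReal)
        let cK : ℝ := RFF.rateConst' (RFF.coeff L f) (fun n => (p n).toReal) / K
        let Copt : ℝ := RFF.rateConst (RFF.coeff L f) (RFF.optimalDist (RFF.coeff L f))
        let E : ℝ := RFF.genBound δ lam c₁ K J Cp cK
        let ε : ℝ := E ^ (1 / 4 : ℝ)
        let q : ℝ := κ * E ^ ((1 - d / ℓ) / 8)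
        E ≤ e₀ →
          RFF.resampledError L f μ N p K J
              (RFF.reg₁ δ lam c₁ K J Cp) (RFF.reg₂ δ lam K J Cp cK)
              (RFF.reg₁ δ lam c₁ K J Copt) (RFF.reg₂ δ lam K J Copt 0) ε q
            ≤ ENNReal.ofReal
                (RFF.genBound δ lam c₁ K J Copt 0 * (1 + C'' * M * q ^ (1 / 2 : ℝ))) := by

  have hd' : (0 : ℝ) < d := by exact_mod_cast hd
  have hℓ0 : 0 < ℓ := hd'.trans hℓ
  have hup : ∀ n, n ≠ 0 → ‖RFF.coeff L f n‖ ≤ (C / RFF.len n) ^ ℓ := fun n hn => (hdecay n hn).2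
  have hθ1 : d / ℓ < 1 := (div_lt_one hℓ0).2 hℓ
  have hθ0 : 0 < d / ℓ := div_pos hd' hℓ0
  let T : RFF.Target d :=
    { L := L
      f := f
      μ := RFF.pointLaw L ρ
      N := N
      s := s
      -- The normalization of the Fourier coefficients times the inverse lower bound of the density.
      β := (ρ₀ * (2 * L) ^ d)⁻¹
      L_pos := hL
      continuous_f := hf
      periodic_f := hper
      summable_norm_coeff := by
        simpa using RFF.summable_rpow_of_decay hC hℓ0 hup one_pos (by simpa using hℓ)
      exists_coeff_ne_zero := RFF.exists_coeff_ne_zero_of_decay hd hc fun n hn => (hdecay n hn).1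
      isProbabilityMeasure_μ := RFF.isProbabilityMeasure_pointLaw hρ1
      isProbabilityMeasure_N := hN
      memLp_noise := hN2
      mean_noise := hNmean
      variance_noise := hNvar
      β_pos := by positivity
      integral_cube_le := fun g hg hg0 => by
        rw [mul_comm ρ₀, mul_inv, mul_assoc]
        gcongr
        exact RFF.integral_cube_le_integral_pointLaw hρ₀ hρ hρ1 hg hg0 }
  -- Any positive constant would do, since the error is bounded without the additional factor; the
  -- dependence on C'' is confined to e₀.
  refine ⟨1, one_pos, fun C₀ hC₀ => ?_⟩
  -- θ' is the midpoint of d/ℓ and (1 + d/ℓ)/2: above the first, |a|^θ' is summable; below the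
  -- second, the mass lost at the cutoff is o(q).
  obtain ⟨e₀, he₀, h⟩ := T.exists_resampledError_le (θ := d / ℓ) (θ' := 1 / 4 + 3 / 4 * (d / ℓ))
    hδ hlam hκ hθ0.le hθ1 (by linarith)
    (RFF.summable_rpow_of_decay hC hℓ0 hup (by positivity) (by
      have : d / ℓ * ℓ = d := div_mul_cancel₀ _ hℓ0.ne'
      nlinarith)) hC₀.le
  refine ⟨e₀, he₀, fun p hp K J hK hJ => ?_⟩
  intro μ c₁ Cp cK Copt E ε q hE
  have hopt : Copt = T.S ^ 2 := RFF.rateConst_optimalDist T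
  have hmain := h p hp K J Cp cK c₁ E hK hJ rfl rfl rfl rfl hE
  rw [hopt]
  refine hmain.trans (ENNReal.ofReal_le_ofReal ?_)
  have hE₂ : 0 ≤ RFF.genBound δ lam c₁ K J (T.S ^ 2) 0 :=
    RFF.genBound_nonneg hδ.le hlam.le (sq_nonneg _)
  have hE₁ : 0 ≤ E := RFF.genBound_nonneg hδ.le hlam.le (tsum_nonneg fun n => by positivity)
  refine le_mul_of_one_le_right hE₂ (le_add_of_nonneg_right ?_)
  have hq : 0 ≤ q := mul_nonneg hκ.le (Real.rpow_nonneg hE₁ _)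
  positivity
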